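/- There are absolute constants $C_1,C_2>0$ such that the following holds. Let $\mathbf A\in\mathbb R^{m\times n}$ have rank $n$, with largest and smallest singular values $\sigma_{\max}(\mathbf A)$ and $\sigma_{\min}(\mathbf A)$, condition number $\kappa=\sigma_{\max}(\mathbf A)/\sigma_{\min}(\mathbf A)$ and stable rank $r=\|\mathbf A\|_F^2/\|\mathbf A\|^2$, and let $\mathbf b=\mathbf A\mathbf x_*$. Let $k\ge 1$ and $K,L\ge 0$, and let $\nu$ be a probability distribution on $\mathbb R^m$ such that a random vector $\mathbf s\sim\nu$ is - isotropic: $\mathbb E[\mathbf s\mathbf s^\top]=\mathbf I$; - $K$-sub-gaussian: $\mathbf v^\top\mathbf s$ is $K$-sub-gaussian for every unit vector $\mathbf v$, where a random variable $X$ is called $K$-sub-gaussian if $\inf\{t>0:\mathbb E\exp(X^2/t^2)\le 2\}\le K$; - Euclidean-concentrated with constant $L$: for every matrix $\mathbf M$ with $m$ columns, $\|\mathbf M\mathbf s\|-\|\mathbf M\|_F$ is $L\|\mathbf M\|$-sub-gaussian. For $j\ge 0$ let $\mathrm{Err}(\mathbf A,j)=\mathbb E\,\|\mathbf A(\mathbf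 I-(\mathbf S\mathbf A)^\dagger\mathbf S\mathbf A)\|_F^2$, where $\mathbf S$ is a random $j\times m$ matrix with i.i.d. rows of law $\nu$ and $\dagger$ is the Moore–Penrose pseudoinverse, and put $\gamma_k=k/\mathrm{Err}(\mathbf A,k-1)$. Consider sketch-and-project, $$\mathbf x_{t+1}=\mathbf x_t-(\mathbf S_t\mathbf A)^\dagger\mathbf S_t(\mathbf A\mathbf x_t-\mathbf b),\qquad t=0,1,2,\dots,$$ where $\mathbf S_0,\mathbf S_1,\dots$ are independent random $k\times m$ matrices, each with i.i.d. rows of law $\nu$, and its worst-case expected convergence rate $$\mathrm{Rate}(\mathbf A,k)=\sup\Big\{\rho:\ \mathbb E\|\mathbf x_t-\mathbf x_*\|^2\le(1-\rho)^t\|\mathbf x_0-\mathbf x_*\|^2\ \ \forall\,\mathbf x_0\in\mathbb R^n,\ t\ge 0\Big\}.$$ If $r\ge C_1\max\{k,\,L^2\log\kappa,\,K^4L^2\}$, then there is an $\epsilon$ with $0\le\epsilon\le C_2K^2L/\sqrt r$ such that $$\mathrm{Rate}(\mathbf A,k)\ \ge\ (1-\epsilon)\,\frac{\gamma_k\sigma_{\min}^2(\mathbf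 A)}{\gamma_k\sigma_{\min}^2(\mathbf A)+1}\ \ge\ (1-\epsilon)\Big(1-\frac kn\Big)\frac{k\,\sigma_{\min}^2(\mathbf A)}{\mathrm{Err}(\mathbf A,k-1)}.$$ -/

import Mathlib

open MeasureTheory ProbabilityTheory Matrix

noncomputable section

namespace SketchProject

/-! ### Moore-Penrose pseudoinverse -/

/-- The four Penrose equations: `Y` is the Moore-Penrose pseudoinverse of the real matrix `X`. -/
structure IsMoorePenrose {p q : ℕ} (X : Matrix (Fin p) (Fin q) ℝ)
    (Y : Matrix (Fin q) (Fin p) ℝ) : Prop where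
  mul_mul_self : X * Y * X = X
  self_mul_mul : Y * X * Y = Y
  symm_left : (X * Y)ᵀ = X * Y
  symm_right : (Y * X)ᵀ = Y * X

/-- The Penrose equations have at most one solution. -/
theorem IsMoorePenrose.unique {p q : ℕ} {X : Matrix (Fin p) (Fin q) ℝ}
    {Y Z : Matrix (Fin q) (Fin p) ℝ} (hY : IsMoorePenrose X Y) (hZ : IsMoorePenrose X Z) :
    Y = Z := by
  have h1 : X * Y = X * Z := by
    have : (X * Z) * (X * Y) = X * Y := by
      rw [← Matrix.mul_assoc, hZ.mul_mul_self]
    have h' : (X * Y) * (X * Z) = X * Z := by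
      rw [← Matrix.mul_assoc, hY.mul_mul_self]
    have h2 := congrArg Matrix.transpose this
    rw [Matrix.transpose_mul, hY.symm_left, hZ.symm_left, h'] at h2
    exact h2.symm
  have h2 : Y * X = Z * X := by
    have : (Y * X) * (Z * X) = Y * X := by
      rw [Matrix.mul_assoc, ← Matrix.mul_assoc X, hZ.mul_mul_self]
    have h' : (Z * X) * (Y * X) = Z * X := by
      rw [Matrix.mul_assoc, ← Matrix.mul_assoc X, hY.mul_mul_self]
    have h2 := congrArg Matrix.transpose this
    rw [Matrix.transpose_mul, hY.symm_right, hZ.symm_right, h'] at h2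
    exact h2.symm
  calc Y = Y * X * Y := hY.self_mul_mul.symm
    _ = Z * X * Y := by rw [h2]
    _ = Z * (X * Y) := Matrix.mul_assoc _ _ _
    _ = Z * X * Z := by rw [h1, ← Matrix.mul_assoc]
    _ = Z := hZ.self_mul_mul

/-- Every real matrix has a Moore-Penrose pseudoinverse. -/
theorem exists_isMoorePenrose {p q : ℕ} (X : Matrix (Fin p) (Fin q) ℝ) :
    ∃ Y, IsMoorePenrose X Y := by
  have hH : (Xᵀ * X).IsHermitian := by
    simpa using Matrix.isHermitian_conjTranspose_mul_self X
  set U : Matrix (Fin q) (Fin q) ℝ := (hH.eigenvectorUnitary : Matrix (Fin q) (Fin q) ℝ) with hU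
  set d : Fin q → ℝ := hH.eigenvalues with hd
  have hUU : Uᵀ * U = 1 := by
    have := Unitary.coe_star_mul_self hH.eigenvectorUnitary
    simpa [Matrix.star_eq_conjTranspose] using this
  have hsp : Xᵀ * X = U * Matrix.diagonal d * Uᵀ := by
    have := hH.spectral_theorem
    rw [Unitary.conjStarAlgAut_apply] at this
    simpa [Matrix.star_eq_conjTranspose, Function.comp_def] using this
  set H := Xᵀ * X with hHdef
  set G := U * Matrix.diagonal (fun i => (d i)⁻¹) * Uᵀ with hG
  have key : ∀ a b : Fin q → ℝ, (U * Matrix.diagonal a * Uᵀ) * (U * Matrix.diagonal b * Uᵀ)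
      = U * Matrix.diagonal (fun i => a i * b i) * Uᵀ := by
    intro a b
    calc _ = U * Matrix.diagonal a * (Uᵀ * U) * Matrix.diagonal b * Uᵀ := by
          simp only [Matrix.mul_assoc]
      _ = _ := by
          rw [hUU, Matrix.mul_one, Matrix.mul_assoc U, Matrix.diagonal_mul_diagonal]
  have symm : ∀ a : Fin q → ℝ, (U * Matrix.diagonal a * Uᵀ)ᵀ = U * Matrix.diagonal a * Uᵀ := by
    intro a
    simp [Matrix.transpose_mul, Matrix.mul_assoc]
  have hGT : Gᵀ = G := symm _
  have hHT : Hᵀ = H := by rw [hsp]; exact symm _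
  have hGHs : (G * H)ᵀ = G * H := by rw [hsp, hG, key]; exact symm _
  have hHGH : H * G * H = H := by
    rw [hsp, hG, key, key]
    congr 3
    ext i
    by_cases h : d i = 0 <;> simp [h]
  have hGHG : G * H * G = G := by
    rw [hsp, hG, key, key]
    congr 3
    ext i
    by_cases h : d i = 0 <;> simp [h]
  have hXGH : X * G * H = X := by
    have hz : (X * G * H - X)ᵀ * (X * G * H - X) = 0 := by
      have e1 : (X * G * H - X)ᵀ = H * G * Xᵀ - Xᵀ := by
        rw [Matrix.transpose_sub, Matrix.transpose_mul, hHT, Matrix.transpose_mul, hGT]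
        simp only [hHdef, Matrix.mul_assoc]
      have a1 : H * G * Xᵀ * (X * G * H) = H := by
        calc _ = H * G * H * G * H := by simp only [hHdef, Matrix.mul_assoc]
          _ = H := by rw [hHGH, hHGH]
      have a2 : H * G * Xᵀ * X = H := by
        calc _ = H * G * H := by simp only [hHdef, Matrix.mul_assoc]
          _ = H := hHGH
      have a3 : Xᵀ * (X * G * H) = H := by
        calc _ = H * G * H := by simp only [hHdef, Matrix.mul_assoc]
          _ = H := hHGH
      rw [e1, Matrix.sub_mul, Matrix.mul_sub, Matrix.mul_sub, a1, a2, a3, ← hHdef]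
      simp
    have hz' : (X * G * H - X)ᴴ * (X * G * H - X) = 0 := by
      simpa [Matrix.conjTranspose_eq_transpose_of_trivial] using hz
    exact sub_eq_zero.mp (Matrix.conjTranspose_mul_self_eq_zero.mp hz')
  refine ⟨G * Xᵀ, ⟨?_, ?_, ?_, ?_⟩⟩
  · calc X * (G * Xᵀ) * X = X * G * H := by simp only [hHdef, Matrix.mul_assoc]
      _ = X := hXGH
  · calc G * Xᵀ * X * (G * Xᵀ) = G * H * G * Xᵀ := by simp only [hHdef, Matrix.mul_assoc]
      _ = G * Xᵀ := by rw [hGHG]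
  · rw [Matrix.transpose_mul, Matrix.transpose_mul, Matrix.transpose_transpose, hGT,
      Matrix.mul_assoc]
  · have : G * Xᵀ * X = G * H := by simp only [hHdef, Matrix.mul_assoc]
    rw [this, hGHs]

/-- The Moore-Penrose pseudoinverse of a real matrix. -/
def pinv {p q : ℕ} (X : Matrix (Fin p) (Fin q) ℝ) : Matrix (Fin q) (Fin p) ℝ :=
  (exists_isMoorePenrose X).choose

theorem isMoorePenrose_pinv {p q : ℕ} (X : Matrix (Fin p) (Fin q) ℝ) :
    IsMoorePenrose X (pinv X) :=
  (exists_isMoorePenrose X).choose_spec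

/-! ### Norms, extreme singular values, condition number, stable rank -/

/-- The squared Frobenius norm. -/
def frobSq {p q : ℕ} (B : Matrix (Fin p) (Fin q) ℝ) : ℝ :=
  ∑ i, ∑ j, B i j ^ 2

/-- The spectral norm (operator norm between Euclidean spaces). -/
def opNorm {p q : ℕ} (B : Matrix (Fin p) (Fin q) ℝ) : ℝ :=
  ‖LinearMap.toContinuousLinearMap (Matrix.toEuclideanLin B)‖

/-- The largest singular value (Mathlib's singular values are decreasing, indexed from `0`). -/
def sigmaMax {m n : ℕ} (A : Matrix (Fin m) (Fin n) ℝ) : ℝ :=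
  (Matrix.toEuclideanLin A).singularValues 0

/-- The smallest of the `n` singular values of an `m × n` matrix, for `n ≥ 1`. -/
def sigmaMin {m n : ℕ} (A : Matrix (Fin m) (Fin n) ℝ) : ℝ :=
  (Matrix.toEuclideanLin A).singularValues (n - 1)

/-- The condition number `σ_max / σ_min`. -/
def condNumber {m n : ℕ} (A : Matrix (Fin m) (Fin n) ℝ) : ℝ :=
  sigmaMax A / sigmaMin A

/-- The stable rank `‖A‖_F² / ‖A‖²`. -/
def stableRank {m n : ℕ} (A : Matrix (Fin m) (Fin n) ℝ) : ℝ :=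
  frobSq A / opNorm A ^ 2

/-! ### Concentration of random variables and vectors -/

/-- Sub-gaussian concentration with constant `K`:
`inf {t > 0 : 𝔼 exp (X² / t²) ≤ 2} ≤ K`. The expectation and the infimum take values in `[0, ∞]`;
the infimum of the empty set is `∞`. -/
def SubGaussianConc {Ω : Type*} [MeasurableSpace Ω] (μ : Measure Ω) (X : Ω → ℝ) (K : ℝ) : Prop :=
  sInf (ENNReal.ofReal ''
    {t : ℝ | 0 < t ∧ ∫⁻ ω, ENNReal.ofReal (Real.exp (X ω ^ 2 / t ^ 2)) ∂μ ≤ 2})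
    ≤ ENNReal.ofReal K

/-- A random vector with law `ν` is `K`-sub-gaussian: all its one-dimensional marginals in unit
directions satisfy sub-gaussian concentration with constant `K`. -/
def SubGaussianVector {m : ℕ} (ν : Measure (EuclideanSpace ℝ (Fin m))) (K : ℝ) : Prop :=
  ∀ v : EuclideanSpace ℝ (Fin m), ‖v‖ = 1 → SubGaussianConc ν (fun s => inner ℝ v s) K

/-- A random vector with law `ν` satisfies Euclidean concentration with constant `L`: for every
matrix `B` the variable `‖B s‖ - ‖B‖_F` is `L ‖B‖`-sub-gaussian. -/
def EuclideanConc {m : ℕ} (ν : Measure (EuclideanSpace ℝ (Fin m))) (L : ℝ) : Prop :=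
  ∀ (p : ℕ) (B : Matrix (Fin p) (Fin m) ℝ),
    SubGaussianConc ν (fun s => ‖Matrix.toEuclideanLin B s‖ - √(frobSq B)) (L * opNorm B)

/-- A random vector with law `ν` is isotropic: `𝔼 [s sᵀ] = I`. -/
def Isotropic {m : ℕ} (ν : Measure (EuclideanSpace ℝ (Fin m))) : Prop :=
  ∀ i j : Fin m, ∫ s, s i * s j ∂ν = if i = j then 1 else 0

/-! ### Random sketches, randomized SVD error, sketch-and-project -/

/-- The matrix with rows `s 0, …, s (k - 1)`. -/
def rowMatrix {k m : ℕ} (s : Fin k → EuclideanSpace ℝ (Fin m)) : Matrix (Fin k) (Fin m) ℝ :=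
  Matrix.of fun i j => s i j

/-- The law of (the rows of) a sketch of size `k`: the `k` rows are i.i.d. with law `ν`. -/
def sketchLaw {m : ℕ} (ν : Measure (EuclideanSpace ℝ (Fin m))) (k : ℕ) :
    Measure (Fin k → EuclideanSpace ℝ (Fin m)) :=
  Measure.pi fun _ => ν

instance sketchLaw_isProbabilityMeasure {m : ℕ} (ν : Measure (EuclideanSpace ℝ (Fin m)))
    [IsProbabilityMeasure ν] (k : ℕ) :
    IsProbabilityMeasure (sketchLaw ν k) := by
  unfold sketchLaw; infer_instance

/-- The sketched projection matrix `(S A)† S A`. -/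
def sketchProj {k m n : ℕ} (S : Matrix (Fin k) (Fin m) ℝ) (A : Matrix (Fin m) (Fin n) ℝ) :
    Matrix (Fin n) (Fin n) ℝ :=
  pinv (S * A) * (S * A)

/-- The randomized SVD error `Err(A, k) = 𝔼 ‖A (I - (S A)† S A)‖_F²`, where the sketch `S` has
`k` i.i.d. rows with law `ν`. -/
def svdErr {m n : ℕ} (ν : Measure (EuclideanSpace ℝ (Fin m))) (A : Matrix (Fin m) (Fin n) ℝ)
    (k : ℕ) : ℝ :=
  ∫ s, frobSq (A * (1 - sketchProj (rowMatrix s) A)) ∂(sketchLaw ν k)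

/-- `γ_k = k / Err(A, k - 1)`, for `k ≥ 1`. -/
def gammaCoeff {m n : ℕ} (ν : Measure (EuclideanSpace ℝ (Fin m))) (A : Matrix (Fin m) (Fin n) ℝ)
    (k : ℕ) : ℝ :=
  k / svdErr ν A (k - 1)

/-- The sketch-and-project iterates `x_{t+1} = x_t - (S_t A)† S_t (A x_t - b)` for a given sequence
of sketching matrices. -/
def iterate {k m n : ℕ} (A : Matrix (Fin m) (Fin n) ℝ) (b : EuclideanSpace ℝ (Fin m))
    (S : ℕ → Matrix (Fin k) (Fin m) ℝ) (x₀ : EuclideanSpace ℝ (Fin n)) :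
    ℕ → EuclideanSpace ℝ (Fin n)
  | 0 => x₀
  | t + 1 => iterate A b S x₀ t -
      Matrix.toEuclideanLin (pinv (S t * A))
        (Matrix.toEuclideanLin (S t) (Matrix.toEuclideanLin A (iterate A b S x₀ t) - b))

/-- The worst-case expected convergence rate of sketch-and-project for `A x = b` with solution `xs`:
the supremum of all `ρ` with `𝔼 ‖x_t - xs‖² ≤ (1 - ρ)^t ‖x₀ - xs‖²` for all `x₀` and `t`.
The sketches `S_0, S_1, …` are independent, each having `k` i.i.d. rows with law `ν`. -/
def rate {m n : ℕ} (ν : Measure (EuclideanSpace ℝ (Fin m))) [IsProbabilityMeasure ν]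
    (A : Matrix (Fin m) (Fin n) ℝ) (b : EuclideanSpace ℝ (Fin m)) (xs : EuclideanSpace ℝ (Fin n))
    (k : ℕ) : ℝ :=
  sSup {ρ : ℝ | ∀ (x₀ : EuclideanSpace ℝ (Fin n)) (t : ℕ),
    ∫ s, ‖iterate A b (fun τ => rowMatrix (s τ)) x₀ t - xs‖ ^ 2
      ∂(Measure.infinitePi fun _ : ℕ => sketchLaw ν k) ≤ (1 - ρ) ^ t * ‖x₀ - xs‖ ^ 2}

end SketchProject

end

/-!
# Sharp convergence rate of sketch-and-project

One step of sketch-and-project multiplies the error by the complementary projection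
`I - (S A)† S A`, and the sketches are independent. The rate is therefore at least the smallest
eigenvalue of the mean projection `𝔼 (S A)† S A` (`le_rate`), and the task is to bound this
eigenvalue below by `(1 - ε) γ σ² / (γ σ² + 1)`.

**Regularization.** Put `X = S A` and `R = μ (Xᵀ X + μ)⁻¹` with `μ = θ ‖A‖_F²`, `θ = L / √r`. Then
`I - R ≤ X† X` (`sub_regResid_le_sketchProj`), and `R` obeys the Sherman-Morrison formula with
denominators `D ≥ μ`. With `a_i = Aᵀ s_i` and `R_i` the residual without row `i`, it gives the
leave-one-out expansion `I - R = ∑ᵢ a_i (R_i a_i)ᵀ / D_i`, where `D_i = μ + a_iᵀ R_i a_i`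
(`sub_regResid_mulVec`).

**Denominators.** The row `s_i` is independent of `R_i`, and `a_iᵀ R_i a_i = ‖M s_i‖²` where
`Mᵀ M = A R_i Aᵀ`. Euclidean concentration makes `D_i` close to `F_i = μ + tr (A R_i Aᵀ)`, and the
regularization controls the rare event of a small `D_i` by moments of order four only. The mean of
`⟨s, u⟩ ⟨s, w⟩ / D` is thus `⟨u, w⟩ / F` up to a relative error `O(K² θ)`
(`SketchHyp.integral_div_updDenom`). The energy `tr (A R_i Aᵀ)` concentrates by a
bounded-differences argument (`integral_sub_integral_sq_le`), and its mean exceeds `Err(A, k - 1)`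
by at most `θ ‖A‖_F²` (`SketchHyp.meanEnergy_le`), because each row loses only a fraction `O(θ)` of
a dimension to the regularization.

**Spectral step.** Let `lam` be the smallest eigenvalue of `𝔼 (I - R)`, with unit eigenvector `x`.
Testing with the bottom singular vector gives `lam ≤ O(k σ² / ‖A‖_F²)`. Adding rows one at a time
changes `𝔼 ‖A R x‖²` by a bounded factor, and its sum over the rows is comparable to
`lam ‖A‖_F²`, so that `𝔼 ‖A R x‖² = O(σ²)` for the residual of `k - 1` rows. Testing the
leave-one-out formula for `x` against `y = (AᵀA)⁻¹ x` now yields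
`lam ⟨y, x⟩ ≥ (k / Err) (1 - lam - O(K² θ))` (up to a factor `1 - O(K² θ)`), in which all errors
are bounded uniformly in the condition number since `‖A y‖ ≤ 1 / σ` compensates
`𝔼 ‖A R x‖² = O(σ²)`. As `⟨y, x⟩ ≤ 1 / σ²`, solving for `lam` proves the bound
(`SketchHyp.le_sub_meanResid_of_sigma`).

The simplified bound follows from `Err(A, k - 1) ≥ (n - k) σ²` (`one_sub_div_mul_le`).
-/

noncomputable section

namespace SketchProject

/-! ### Positive contractions and the regularized residual -/

theorem dotProduct_mulVec_symm {n : ℕ} {R : Matrix (Fin n) (Fin n) ℝ} (hR : Rᵀ = R)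
    (x y : Fin n → ℝ) : x ⬝ᵥ R *ᵥ y = R *ᵥ x ⬝ᵥ y := by
  rw [Matrix.dotProduct_mulVec, ← Matrix.mulVec_transpose, hR]

theorem dotProduct_sq_le {n : ℕ} (x y : Fin n → ℝ) :
    (x ⬝ᵥ y) ^ 2 ≤ (x ⬝ᵥ x) * (y ⬝ᵥ y) := by
  have := Finset.sum_mul_sq_le_sq_mul_sq Finset.univ x y
  simpa [dotProduct, sq] using this

theorem dotProduct_self_nonneg' {n : ℕ} (x : Fin n → ℝ) : 0 ≤ x ⬝ᵥ x :=
  Finset.sum_nonneg fun i _ => mul_self_nonneg (x i)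

theorem mulVec_dotProduct_mulVec {m n : ℕ} (A : Matrix (Fin m) (Fin n) ℝ) (x : Fin n → ℝ)
    (y : Fin m → ℝ) : A *ᵥ x ⬝ᵥ y = x ⬝ᵥ Aᵀ *ᵥ y := by
  rw [Matrix.mulVec_transpose, dotProduct_comm x, ← Matrix.dotProduct_mulVec, dotProduct_comm]

/-- A real positive semidefinite matrix factors as `Qᵀ Q`. -/
theorem exists_transpose_mul_self {n : ℕ} {N : Matrix (Fin n) (Fin n) ℝ} (hN : Nᵀ = N)
    (hN0 : ∀ x, 0 ≤ x ⬝ᵥ N *ᵥ x) : ∃ Q : Matrix (Fin n) (Fin n) ℝ, N = Qᵀ * Q := by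
  have h : N.PosSemidef := by
    refine Matrix.PosSemidef.of_dotProduct_mulVec_nonneg ?_ ?_
    · simpa [Matrix.IsHermitian, Matrix.conjTranspose_eq_transpose_of_trivial] using hN
    · intro x
      simpa using hN0 x
  open scoped MatrixOrder in
  obtain ⟨Q, hQ⟩ := CStarAlgebra.nonneg_iff_eq_star_mul_self.mp h.nonneg
  exact ⟨Q, by simpa [Matrix.star_eq_conjTranspose,
    Matrix.conjTranspose_eq_transpose_of_trivial] using hQ⟩

/-- A symmetric matrix `R` with `0 ≤ R ≤ 1` in the Loewner order, expressed by quadratic forms. -/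
structure IsPosContraction {n : ℕ} (R : Matrix (Fin n) (Fin n) ℝ) : Prop where
  symm : Rᵀ = R
  nonneg : ∀ x, 0 ≤ x ⬝ᵥ R *ᵥ x
  le : ∀ x, x ⬝ᵥ R *ᵥ x ≤ x ⬝ᵥ x

namespace IsPosContraction

variable {n : ℕ} {R : Matrix (Fin n) (Fin n) ℝ}

theorem mulVec_self_le (hR : IsPosContraction R) (x : Fin n → ℝ) :
    R *ᵥ x ⬝ᵥ R *ᵥ x ≤ x ⬝ᵥ R *ᵥ x := by
  have h1 := hR.nonneg (x - R *ᵥ x)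
  have h2 := hR.le (R *ᵥ x)
  rw [Matrix.mulVec_sub, dotProduct_sub, sub_dotProduct, sub_dotProduct,
    dotProduct_mulVec_symm hR.symm x (R *ᵥ x)] at h1
  linarith

theorem mulVec_self_le_self (hR : IsPosContraction R) (x : Fin n → ℝ) :
    R *ᵥ x ⬝ᵥ R *ᵥ x ≤ x ⬝ᵥ x :=
  (hR.mulVec_self_le x).trans (hR.le x)

end IsPosContraction

/-- The column vector `Aᵀ s`, i.e. the row of the sketched matrix `S A` coming from the row `s`. -/
def sketchedRow {m n : ℕ} (A : Matrix (Fin m) (Fin n) ℝ) (s : EuclideanSpace ℝ (Fin m)) :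
    Fin n → ℝ := Aᵀ *ᵥ s.ofLp

/-- The regularized Gram matrix `(S A)ᵀ (S A) + μ I` of the sketch with rows `s`. -/
def regGram {m n j : ℕ} (μ : ℝ) (A : Matrix (Fin m) (Fin n) ℝ)
    (s : Fin j → EuclideanSpace ℝ (Fin m)) : Matrix (Fin n) (Fin n) ℝ :=
  (rowMatrix s * A)ᵀ * (rowMatrix s * A) + μ • 1

/-- The regularized residual `μ ((S A)ᵀ (S A) + μ I)⁻¹`. It decreases to the complementary
projection `I - (S A)† S A` as `μ ↓ 0`. -/
def regResid {m n j : ℕ} (μ : ℝ) (A : Matrix (Fin m) (Fin n) ℝ)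
    (s : Fin j → EuclideanSpace ℝ (Fin m)) : Matrix (Fin n) (Fin n) ℝ :=
  μ • (regGram μ A s)⁻¹

section Deterministic

variable {m n j : ℕ} {μ : ℝ} (A : Matrix (Fin m) (Fin n) ℝ)

theorem sketchedRow_dotProduct (s : EuclideanSpace ℝ (Fin m)) (x : Fin n → ℝ) :
    sketchedRow A s ⬝ᵥ x = s.ofLp ⬝ᵥ A *ᵥ x := by
  rw [sketchedRow, dotProduct_comm, ← mulVec_dotProduct_mulVec, dotProduct_comm]

theorem regGram_mulVec (μ : ℝ) (s : Fin j → EuclideanSpace ℝ (Fin m)) (x : Fin n → ℝ) :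
    regGram μ A s *ᵥ x = ∑ i, (sketchedRow A (s i) ⬝ᵥ x) • sketchedRow A (s i) + μ • x := by
  rw [regGram, Matrix.add_mulVec, Matrix.smul_mulVec, Matrix.one_mulVec,
    ← Matrix.mulVec_mulVec]
  congr 1
  ext l
  simp only [Matrix.mulVec, dotProduct, Matrix.transpose_apply, Matrix.mul_apply, rowMatrix,
    sketchedRow, Matrix.of_apply, Finset.sum_apply, Pi.smul_apply, smul_eq_mul]
  refine Finset.sum_congr rfl fun i _ => ?_
  rw [mul_comm]
  congr 1
  · refine Finset.sum_congr rfl fun l _ => ?_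
    congr 1
    exact Finset.sum_congr rfl fun l _ => mul_comm _ _
  · exact Finset.sum_congr rfl fun l _ => mul_comm _ _

theorem dotProduct_regGram_mulVec (μ : ℝ) (s : Fin j → EuclideanSpace ℝ (Fin m))
    (x : Fin n → ℝ) :
    x ⬝ᵥ regGram μ A s *ᵥ x = (rowMatrix s * A) *ᵥ x ⬝ᵥ (rowMatrix s * A) *ᵥ x
      + μ * (x ⬝ᵥ x) := by
  rw [mulVec_dotProduct_mulVec, regGram, Matrix.add_mulVec, Matrix.smul_mulVec,
    Matrix.one_mulVec, ← Matrix.mulVec_mulVec, dotProduct_add, dotProduct_smul, smul_eq_mul]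

theorem regGram_transpose (μ : ℝ) (s : Fin j → EuclideanSpace ℝ (Fin m)) :
    (regGram μ A s)ᵀ = regGram μ A s := by
  simp [regGram, Matrix.transpose_mul, Matrix.mul_assoc]

theorem regGram_isUnit_det (hμ : 0 < μ) (s : Fin j → EuclideanSpace ℝ (Fin m)) :
    IsUnit (regGram μ A s).det := by
  rw [isUnit_iff_ne_zero]
  intro h0
  obtain ⟨v, hv, hv0⟩ := Matrix.exists_mulVec_eq_zero_iff.mpr h0
  have := dotProduct_regGram_mulVec A μ s v
  rw [hv0, dotProduct_zero] at this
  have h1 := dotProduct_self_nonneg' ((rowMatrix s * A) *ᵥ v)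
  have h2 : 0 < v ⬝ᵥ v :=
    lt_of_le_of_ne (dotProduct_self_nonneg' v) (fun h => hv (dotProduct_self_eq_zero.mp h.symm))
  nlinarith [mul_pos hμ h2]

theorem regGram_mulVec_regResid (hμ : 0 < μ) (s : Fin j → EuclideanSpace ℝ (Fin m))
    (x : Fin n → ℝ) : regGram μ A s *ᵥ (regResid μ A s *ᵥ x) = μ • x := by
  rw [regResid, Matrix.smul_mulVec, Matrix.mulVec_smul, Matrix.mulVec_mulVec,
    Matrix.mul_nonsing_inv _ (regGram_isUnit_det A hμ s), Matrix.one_mulVec]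

theorem eq_regResid_mulVec (hμ : 0 < μ) (s : Fin j → EuclideanSpace ℝ (Fin m))
    {x y : Fin n → ℝ} (h : regGram μ A s *ᵥ y = μ • x) : y = regResid μ A s *ᵥ x := by
  rw [regResid, Matrix.smul_mulVec, ← Matrix.mulVec_smul, ← h, Matrix.mulVec_mulVec,
    Matrix.nonsing_inv_mul _ (regGram_isUnit_det A hμ s), Matrix.one_mulVec]

theorem regResid_isPosContraction (hμ : 0 < μ) (s : Fin j → EuclideanSpace ℝ (Fin m)) :
    IsPosContraction (regResid μ A s) := by
  have hT : (regResid μ A s)ᵀ = regResid μ A s := by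
    rw [regResid, Matrix.transpose_smul, Matrix.transpose_nonsing_inv, regGram_transpose]
  have key : ∀ x, μ * (x ⬝ᵥ regResid μ A s *ᵥ x) =
      (regResid μ A s *ᵥ x) ⬝ᵥ regGram μ A s *ᵥ (regResid μ A s *ᵥ x) := by
    intro x
    rw [regGram_mulVec_regResid A hμ, dotProduct_smul, smul_eq_mul, dotProduct_comm]
  refine ⟨hT, fun x => ?_, fun x => ?_⟩
  · have h := key x
    rw [dotProduct_regGram_mulVec] at h
    have h1 := dotProduct_self_nonneg' ((rowMatrix s * A) *ᵥ (regResid μ A s *ᵥ x))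
    have h2 := dotProduct_self_nonneg' (regResid μ A s *ᵥ x)
    have : 0 ≤ μ * (x ⬝ᵥ regResid μ A s *ᵥ x) := by rw [h]; positivity
    exact nonneg_of_mul_nonneg_right this hμ
  · have h := key x
    rw [dotProduct_regGram_mulVec] at h
    have h1 := dotProduct_self_nonneg' ((rowMatrix s * A) *ᵥ (regResid μ A s *ᵥ x))
    have h3 : regResid μ A s *ᵥ x ⬝ᵥ regResid μ A s *ᵥ x ≤ x ⬝ᵥ regResid μ A s *ᵥ x := by
      nlinarith
    have h4 := dotProduct_self_nonneg' (x - regResid μ A s *ᵥ x)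
    rw [dotProduct_sub, sub_dotProduct, sub_dotProduct,
      dotProduct_comm (regResid μ A s *ᵥ x) x] at h4
    linarith

theorem regGram_insertNth_mulVec (μ : ℝ) (i : Fin (j + 1)) (v : EuclideanSpace ℝ (Fin m))
    (s : Fin j → EuclideanSpace ℝ (Fin m)) (x : Fin n → ℝ) :
    regGram μ A (i.insertNth v s : Fin (j + 1) → EuclideanSpace ℝ (Fin m)) *ᵥ x =
      regGram μ A s *ᵥ x + (sketchedRow A v ⬝ᵥ x) • sketchedRow A v := by
  rw [regGram_mulVec, regGram_mulVec, Fin.sum_univ_succAbove _ i]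
  simp only [Fin.insertNth_apply_same, Fin.insertNth_apply_succAbove]
  abel

/-- The denominator of the rank-one update of the residual `R` by the row coming from `v`. -/
def updDenom (μ : ℝ) (A : Matrix (Fin m) (Fin n) ℝ) (R : Matrix (Fin n) (Fin n) ℝ)
    (v : EuclideanSpace ℝ (Fin m)) : ℝ :=
  μ + sketchedRow A v ⬝ᵥ R *ᵥ sketchedRow A v

theorem le_updDenom {R : Matrix (Fin n) (Fin n) ℝ} (hR : IsPosContraction R)
    (v : EuclideanSpace ℝ (Fin m)) : μ ≤ updDenom μ A R v :=
  le_add_of_nonneg_right (hR.nonneg _)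

/-- The Sherman-Morrison update of the residual when one row is added to the sketch. -/
theorem regResid_insertNth_mulVec (hμ : 0 < μ) (i : Fin (j + 1))
    (v : EuclideanSpace ℝ (Fin m)) (s : Fin j → EuclideanSpace ℝ (Fin m)) (x : Fin n → ℝ) :
    regResid μ A (i.insertNth v s : Fin (j + 1) → EuclideanSpace ℝ (Fin m)) *ᵥ x =
      regResid μ A s *ᵥ x - ((sketchedRow A v ⬝ᵥ regResid μ A s *ᵥ x) /
        updDenom μ A (regResid μ A s) v) • regResid μ A s *ᵥ sketchedRow A v := by
  symm
  apply eq_regResid_mulVec A hμ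
  have hR := regResid_isPosContraction A hμ s
  have hD : 0 < updDenom μ A (regResid μ A s) v := hμ.trans_le (le_updDenom A hR v)
  have hDdef : updDenom μ A (regResid μ A s) v
      = μ + sketchedRow A v ⬝ᵥ regResid μ A s *ᵥ sketchedRow A v := rfl
  rw [regGram_insertNth_mulVec, Matrix.mulVec_sub, Matrix.mulVec_smul,
    regGram_mulVec_regResid A hμ, regGram_mulVec_regResid A hμ, dotProduct_sub,
    dotProduct_smul, smul_eq_mul, smul_smul, sub_add, ← sub_smul, sub_eq_self]
  convert zero_smul ℝ _
  have : sketchedRow A v ⬝ᵥ regResid μ A s *ᵥ sketchedRow A v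
      = updDenom μ A (regResid μ A s) v - μ := by rw [hDdef]; ring
  rw [this]
  field_simp
  ring

theorem dotProduct_regResid_insertNth (hμ : 0 < μ) (i : Fin (j + 1))
    (v : EuclideanSpace ℝ (Fin m)) (s : Fin j → EuclideanSpace ℝ (Fin m)) (x : Fin n → ℝ) :
    x ⬝ᵥ regResid μ A (i.insertNth v s : Fin (j + 1) → EuclideanSpace ℝ (Fin m)) *ᵥ x =
      x ⬝ᵥ regResid μ A s *ᵥ x - (sketchedRow A v ⬝ᵥ regResid μ A s *ᵥ x) ^ 2 /
        updDenom μ A (regResid μ A s) v := by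
  rw [regResid_insertNth_mulVec A hμ, dotProduct_sub, dotProduct_smul, smul_eq_mul,
    dotProduct_mulVec_symm (regResid_isPosContraction A hμ s).symm x (sketchedRow A v),
    dotProduct_comm (regResid μ A s *ᵥ x)]
  ring

/-- The leave-one-out expansion of `1 - R`: each row contributes a rank-one term in which
the residual `R_i` does not depend on that row. -/
theorem sub_regResid_mulVec (hμ : 0 < μ) (s : Fin (j + 1) → EuclideanSpace ℝ (Fin m))
    (x : Fin n → ℝ) :
    x - regResid μ A s *ᵥ x = ∑ i, ((sketchedRow A (s i) ⬝ᵥ regResid μ A (i.removeNth s) *ᵥ x) /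
      updDenom μ A (regResid μ A (i.removeNth s)) (s i)) • sketchedRow A (s i) := by
  have h := regGram_mulVec_regResid A hμ s x
  rw [regGram_mulVec] at h
  have h1 : μ • (x - regResid μ A s *ᵥ x) = ∑ i, (sketchedRow A (s i) ⬝ᵥ regResid μ A s *ᵥ x) •
      sketchedRow A (s i) := by
    rw [smul_sub, ← h, add_sub_cancel_right]
  have h2 : ∀ i, sketchedRow A (s i) ⬝ᵥ regResid μ A s *ᵥ x = μ *
      ((sketchedRow A (s i) ⬝ᵥ regResid μ A (i.removeNth s) *ᵥ x) /
      updDenom μ A (regResid μ A (i.removeNth s)) (s i)) := by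
    intro i
    have hR := regResid_isPosContraction A hμ (i.removeNth s)
    have hD : 0 < updDenom μ A (regResid μ A (i.removeNth s)) (s i) :=
      hμ.trans_le (le_updDenom A hR _)
    conv_lhs => rw [← Fin.insertNth_self_removeNth i s]
    rw [regResid_insertNth_mulVec A hμ, dotProduct_sub, dotProduct_smul, smul_eq_mul,
      Fin.insertNth_apply_same]
    have : sketchedRow A (s i) ⬝ᵥ regResid μ A (i.removeNth s) *ᵥ sketchedRow A (s i)
      = updDenom μ A (regResid μ A (i.removeNth s)) (s i) - μ := by rw [updDenom]; ring
    rw [this]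
    field_simp
    ring
  have h3 : x - regResid μ A s *ᵥ x = μ⁻¹ • (μ • (x - regResid μ A s *ᵥ x)) := by
    rw [smul_smul, inv_mul_cancel₀ hμ.ne', one_smul]
  rw [h3, h1, Finset.smul_sum]
  refine Finset.sum_congr rfl fun i _ => ?_
  rw [h2 i, smul_smul, ← mul_assoc, inv_mul_cancel₀ hμ.ne', one_mul]

end Deterministic

/-! ### Spectral norm, residual energy and traces -/

theorem norm_sq_eq_dotProduct {m : ℕ} (s : EuclideanSpace ℝ (Fin m)) :
    ‖s‖ ^ 2 = s.ofLp ⬝ᵥ s.ofLp := by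
  rw [EuclideanSpace.real_norm_sq_eq]
  simp [dotProduct, sq]

theorem norm_sq_toEuclideanLin {p m : ℕ} (B : Matrix (Fin p) (Fin m) ℝ)
    (s : EuclideanSpace ℝ (Fin m)) :
    ‖Matrix.toEuclideanLin B s‖ ^ 2 = B *ᵥ s.ofLp ⬝ᵥ B *ᵥ s.ofLp := by
  rw [norm_sq_eq_dotProduct]
  simp [Matrix.toLpLin_apply]

theorem opNorm_nonneg {p q : ℕ} (B : Matrix (Fin p) (Fin q) ℝ) : 0 ≤ opNorm B := norm_nonneg _

theorem mulVec_self_le_opNorm {m n : ℕ} (A : Matrix (Fin m) (Fin n) ℝ) (x : Fin n → ℝ) :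
    A *ᵥ x ⬝ᵥ A *ᵥ x ≤ opNorm A ^ 2 * (x ⬝ᵥ x) := by
  have h := (LinearMap.toContinuousLinearMap (Matrix.toEuclideanLin A)).le_opNorm
    (WithLp.toLp 2 x)
  have h2 := norm_sq_toEuclideanLin A (WithLp.toLp 2 x)
  have h3 := norm_sq_eq_dotProduct (WithLp.toLp 2 x)
  simp only at h2 h3
  rw [← h2, ← h3, ← mul_pow]
  exact pow_le_pow_left₀ (norm_nonneg _) h 2

theorem opNorm_le_of_forall {m n : ℕ} (A : Matrix (Fin m) (Fin n) ℝ) {c : ℝ} (hc : 0 ≤ c)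
    (h : ∀ x, A *ᵥ x ⬝ᵥ A *ᵥ x ≤ c ^ 2 * (x ⬝ᵥ x)) : opNorm A ≤ c := by
  refine ContinuousLinearMap.opNorm_le_bound _ hc fun s => ?_
  refine le_of_sq_le_sq ?_ (by positivity)
  rw [mul_pow, norm_sq_eq_dotProduct s]
  exact (norm_sq_toEuclideanLin A s).le.trans (h _)

theorem transpose_mulVec_self_le_opNorm {m n : ℕ} (A : Matrix (Fin m) (Fin n) ℝ)
    (y : Fin m → ℝ) : Aᵀ *ᵥ y ⬝ᵥ Aᵀ *ᵥ y ≤ opNorm A ^ 2 * (y ⬝ᵥ y) := by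
  have h1 := mulVec_self_le_opNorm A (Aᵀ *ᵥ y)
  have h2 := dotProduct_sq_le (A *ᵥ (Aᵀ *ᵥ y)) y
  rw [mulVec_dotProduct_mulVec] at h2
  set t := Aᵀ *ᵥ y ⬝ᵥ Aᵀ *ᵥ y with ht
  have h0 : 0 ≤ t := dotProduct_self_nonneg' _
  have hy := dotProduct_self_nonneg' y
  by_contra hlt
  push Not at hlt
  have h3 : t ^ 2 ≤ opNorm A ^ 2 * t * (y ⬝ᵥ y) :=
    h2.trans (mul_le_mul_of_nonneg_right h1 hy)
  have h4 : 0 < t := lt_of_le_of_lt (by positivity) hlt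
  nlinarith

theorem frobSq_eq_trace {p q : ℕ} (B : Matrix (Fin p) (Fin q) ℝ) :
    frobSq B = Matrix.trace (Bᵀ * B) := by
  simp only [frobSq, Matrix.trace, Matrix.diag_apply, Matrix.mul_apply, Matrix.transpose_apply,
    sq]
  exact Finset.sum_comm

theorem frobSq_transpose {p q : ℕ} (B : Matrix (Fin p) (Fin q) ℝ) :
    frobSq Bᵀ = frobSq B := Finset.sum_comm

theorem frobSq_nonneg {p q : ℕ} (B : Matrix (Fin p) (Fin q) ℝ) : 0 ≤ frobSq B :=
  Finset.sum_nonneg fun _ _ => Finset.sum_nonneg fun _ _ => sq_nonneg _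

theorem frobSq_mul_le {m n p : ℕ} (A : Matrix (Fin m) (Fin n) ℝ) (Q : Matrix (Fin n) (Fin p) ℝ) :
    frobSq (A * Q) ≤ opNorm A ^ 2 * frobSq Q := by
  rw [← frobSq_transpose, ← frobSq_transpose Q, frobSq, frobSq, Finset.mul_sum]
  refine Finset.sum_le_sum fun j _ => ?_
  have := mulVec_self_le_opNorm A (fun i => Q i j)
  simpa [dotProduct, sq, Matrix.mul_apply, Matrix.mulVec] using this

/-- The trace of `A N Aᵀ`. For a symmetric idempotent `N` it is `‖A N‖_F²`. -/
def energy {m n : ℕ} (A : Matrix (Fin m) (Fin n) ℝ) (N : Matrix (Fin n) (Fin n) ℝ) : ℝ :=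
  Matrix.trace (A * N * Aᵀ)

theorem regResid_zero {m n : ℕ} {A : Matrix (Fin m) (Fin n) ℝ} {μ : ℝ} (hμ : 0 < μ)
    (s : Fin 0 → EuclideanSpace ℝ (Fin m)) :
    regResid μ A s = 1 := by
  apply Matrix.mulVec_injective
  ext1 x
  rw [← eq_regResid_mulVec A hμ s (x := x) (y := x), Matrix.one_mulVec]
  rw [regGram_mulVec]
  simp

section Energy

variable {m n j : ℕ} {μ : ℝ} (A : Matrix (Fin m) (Fin n) ℝ)

theorem energy_sub (N N' : Matrix (Fin n) (Fin n) ℝ) :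
    energy A (N - N') = energy A N - energy A N' := by
  simp [energy, Matrix.mul_sub, Matrix.sub_mul]

theorem energy_one : energy A 1 = frobSq A := by
  rw [← frobSq_transpose, frobSq_eq_trace, energy, Matrix.mul_one, Matrix.transpose_transpose]

theorem energy_transpose_mul_self (Q : Matrix (Fin n) (Fin n) ℝ) :
    energy A (Qᵀ * Q) = frobSq (A * Qᵀ) := by
  rw [← frobSq_transpose, frobSq_eq_trace, energy, Matrix.transpose_transpose,
    Matrix.transpose_mul, Matrix.transpose_transpose]
  simp only [Matrix.mul_assoc]

theorem energy_nonneg {N : Matrix (Fin n) (Fin n) ℝ} (hN : Nᵀ = N)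
    (hN0 : ∀ x, 0 ≤ x ⬝ᵥ N *ᵥ x) : 0 ≤ energy A N := by
  obtain ⟨Q, rfl⟩ := exists_transpose_mul_self hN hN0
  rw [energy_transpose_mul_self]
  exact frobSq_nonneg _

theorem energy_le_trace {N : Matrix (Fin n) (Fin n) ℝ} (hN : Nᵀ = N)
    (hN0 : ∀ x, 0 ≤ x ⬝ᵥ N *ᵥ x) : energy A N ≤ opNorm A ^ 2 * N.trace := by
  obtain ⟨Q, rfl⟩ := exists_transpose_mul_self hN hN0
  rw [energy_transpose_mul_self, ← frobSq_eq_trace, ← frobSq_transpose Q]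
  exact frobSq_mul_le A Qᵀ

theorem one_sub_transpose {R : Matrix (Fin n) (Fin n) ℝ} (hR : IsPosContraction R) :
    (1 - R)ᵀ = 1 - R := by rw [Matrix.transpose_sub, Matrix.transpose_one, hR.symm]

theorem one_sub_nonneg {R : Matrix (Fin n) (Fin n) ℝ} (hR : IsPosContraction R)
    (x : Fin n → ℝ) : 0 ≤ x ⬝ᵥ (1 - R) *ᵥ x := by
  rw [Matrix.sub_mulVec, Matrix.one_mulVec, dotProduct_sub]
  linarith [hR.le x]

theorem energy_le_frobSq {R : Matrix (Fin n) (Fin n) ℝ} (hR : IsPosContraction R) :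
    energy A R ≤ frobSq A := by
  have := energy_nonneg A (one_sub_transpose hR) (one_sub_nonneg hR)
  rw [energy_sub, energy_one] at this
  linarith

theorem trace_mul_vecMulVec (u : Fin n → ℝ) :
    energy A (Matrix.vecMulVec u u) = A *ᵥ u ⬝ᵥ A *ᵥ u := by
  rw [energy, Matrix.mul_vecMulVec, Matrix.vecMulVec_mul, Matrix.trace_vecMulVec,
    ← Matrix.mulVec_transpose, Matrix.transpose_transpose]

theorem regResid_insertNth (hμ : 0 < μ) (i : Fin (j + 1))
    (v : EuclideanSpace ℝ (Fin m)) (s : Fin j → EuclideanSpace ℝ (Fin m)) :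
    regResid μ A (i.insertNth v s : Fin (j + 1) → EuclideanSpace ℝ (Fin m)) =
      regResid μ A s - (updDenom μ A (regResid μ A s) v)⁻¹ •
        Matrix.vecMulVec (regResid μ A s *ᵥ sketchedRow A v)
          (regResid μ A s *ᵥ sketchedRow A v) := by
  apply Matrix.mulVec_injective
  ext1 x
  rw [regResid_insertNth_mulVec A hμ, Matrix.sub_mulVec, Matrix.smul_mulVec,
    Matrix.vecMulVec_mulVec, dotProduct_mulVec_symm (regResid_isPosContraction A hμ s).symm]
  ext l
  simp [div_eq_inv_mul]
  ring

theorem energy_regResid_insertNth (hμ : 0 < μ) (i : Fin (j + 1))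
    (v : EuclideanSpace ℝ (Fin m)) (s : Fin j → EuclideanSpace ℝ (Fin m)) :
    energy A (regResid μ A (i.insertNth v s : Fin (j + 1) → EuclideanSpace ℝ (Fin m))) =
      energy A (regResid μ A s) -
        (A *ᵥ (regResid μ A s *ᵥ sketchedRow A v) ⬝ᵥ
          A *ᵥ (regResid μ A s *ᵥ sketchedRow A v)) / updDenom μ A (regResid μ A s) v := by
  rw [regResid_insertNth A hμ, energy_sub, ← trace_mul_vecMulVec, div_eq_inv_mul]
  simp [energy]

theorem mulVec_resid_row_le {R : Matrix (Fin n) (Fin n) ℝ} (hR : IsPosContraction R)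
    (hμ : 0 < μ) (v : EuclideanSpace ℝ (Fin m)) :
    A *ᵥ (R *ᵥ sketchedRow A v) ⬝ᵥ A *ᵥ (R *ᵥ sketchedRow A v) ≤
      opNorm A ^ 2 * updDenom μ A R v := by
  refine (mulVec_self_le_opNorm A _).trans (mul_le_mul_of_nonneg_left ?_ (sq_nonneg _))
  refine (hR.mulVec_self_le _).trans ?_
  rw [updDenom]
  linarith

/-- Adding one row to the sketch decreases the residual energy by at most `‖A‖²`. -/
theorem energy_insertNth_mem (hμ : 0 < μ) (i : Fin (j + 1))
    (v : EuclideanSpace ℝ (Fin m)) (s : Fin j → EuclideanSpace ℝ (Fin m)) :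
    energy A (regResid μ A (i.insertNth v s : Fin (j + 1) → EuclideanSpace ℝ (Fin m))) ∈
      Set.Icc (energy A (regResid μ A s) - opNorm A ^ 2) (energy A (regResid μ A s)) := by
  have hR := regResid_isPosContraction A hμ s
  have hD : 0 < updDenom μ A (regResid μ A s) v := hμ.trans_le (le_updDenom A hR v)
  rw [energy_regResid_insertNth A hμ]
  constructor
  · gcongr
    rw [div_le_iff₀ hD]
    exact mulVec_resid_row_le A hR hμ v
  · have := dotProduct_self_nonneg' (A *ᵥ (regResid μ A s *ᵥ sketchedRow A v))
    linarith [div_nonneg this hD.le]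

/-- The trace of the leave-one-out expansion: row `i` contributes `1 - μ / D_i`, so the regularized
residual removes nearly `j + 1` dimensions when the denominators are large compared with `μ`. -/
theorem trace_one_sub_regResid (hμ : 0 < μ) (s : Fin (j + 1) → EuclideanSpace ℝ (Fin m)) :
    (1 - regResid μ A s).trace = ∑ i, (1 - μ /
      updDenom μ A (regResid μ A (i.removeNth s)) (s i)) := by
  have h : 1 - regResid μ A s = ∑ i, (updDenom μ A (regResid μ A (i.removeNth s)) (s i))⁻¹ •
      Matrix.vecMulVec (sketchedRow A (s i))
        (regResid μ A (i.removeNth s) *ᵥ sketchedRow A (s i)) := by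
    apply Matrix.mulVec_injective
    ext1 x
    rw [Matrix.sub_mulVec, Matrix.one_mulVec, sub_regResid_mulVec A hμ, Matrix.sum_mulVec]
    refine Finset.sum_congr rfl fun i _ => ?_
    rw [Matrix.smul_mulVec, Matrix.vecMulVec_mulVec,
      dotProduct_mulVec_symm (regResid_isPosContraction A hμ (i.removeNth s)).symm]
    ext l
    simp [div_eq_inv_mul]
    ring
  rw [h, Matrix.trace_sum]
  refine Finset.sum_congr rfl fun i _ => ?_
  have hD : 0 < updDenom μ A (regResid μ A (i.removeNth s)) (s i) :=
    hμ.trans_le (le_updDenom A (regResid_isPosContraction A hμ _) _)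
  rw [Matrix.trace_smul, Matrix.trace_vecMulVec, smul_eq_mul]
  have : sketchedRow A (s i) ⬝ᵥ regResid μ A (i.removeNth s) *ᵥ sketchedRow A (s i)
      = updDenom μ A (regResid μ A (i.removeNth s)) (s i) - μ := by rw [updDenom]; ring
  rw [this]
  field_simp

theorem trace_one_sub_regResid_le (hμ : 0 < μ) (s : Fin j → EuclideanSpace ℝ (Fin m)) :
    (1 - regResid μ A s).trace ≤ j := by
  cases j with
  | zero =>
    simp [regResid_zero hμ]
  | succ j =>
    rw [trace_one_sub_regResid A hμ]
    refine (Finset.sum_le_sum (g := fun _ => (1 : ℝ)) fun i _ => ?_).trans (by simp)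
    have hD : 0 < updDenom μ A (regResid μ A (i.removeNth s)) (s i) :=
      hμ.trans_le (le_updDenom A (regResid_isPosContraction A hμ _) _)
    linarith [div_pos hμ hD]

theorem frobSq_sub_le_energy (hμ : 0 < μ) (s : Fin j → EuclideanSpace ℝ (Fin m)) :
    frobSq A - j * opNorm A ^ 2 ≤ energy A (regResid μ A s) := by
  have hR := regResid_isPosContraction A hμ s
  have := energy_le_trace A (one_sub_transpose hR) (one_sub_nonneg hR)
  rw [energy_sub, energy_one] at this
  nlinarith [trace_one_sub_regResid_le A hμ s, sq_nonneg (opNorm A)]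

/-- A factor `M` with `Mᵀ M = A R Aᵀ`, to which Euclidean concentration is applied. -/
theorem exists_energy_factor {R : Matrix (Fin n) (Fin n) ℝ} (hR : IsPosContraction R) :
    ∃ M : Matrix (Fin n) (Fin m) ℝ, frobSq M = energy A R ∧ opNorm M ≤ opNorm A ∧
      ∀ s : EuclideanSpace ℝ (Fin m),
        ‖Matrix.toEuclideanLin M s‖ ^ 2 = sketchedRow A s ⬝ᵥ R *ᵥ sketchedRow A s := by
  obtain ⟨Q, hQ⟩ := exists_transpose_mul_self hR.symm hR.nonneg
  have h : ∀ y : Fin m → ℝ, (Q * Aᵀ) *ᵥ y ⬝ᵥ (Q * Aᵀ) *ᵥ y = Aᵀ *ᵥ y ⬝ᵥ R *ᵥ (Aᵀ *ᵥ y) := by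
    intro y
    rw [← Matrix.mulVec_mulVec, mulVec_dotProduct_mulVec, hQ, Matrix.mulVec_mulVec]
  refine ⟨Q * Aᵀ, ?_, ?_, ?_⟩
  · rw [hQ, energy_transpose_mul_self, ← frobSq_transpose, Matrix.transpose_mul,
      Matrix.transpose_transpose]
  · refine opNorm_le_of_forall _ (opNorm_nonneg A) fun y => ?_
    rw [h]
    exact (hR.le _).trans (transpose_mulVec_self_le_opNorm A y)
  · intro s
    rw [norm_sq_toEuclideanLin, h]
    rfl

end Energy

/-! ### The sketched projection and its regularization -/

theorem sub_dotProduct_sub_self {n : ℕ} (x y : Fin n → ℝ) :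
    (x - y) ⬝ᵥ (x - y) = x ⬝ᵥ x - 2 * (x ⬝ᵥ y) + y ⬝ᵥ y := by
  rw [dotProduct_sub, sub_dotProduct, sub_dotProduct, dotProduct_comm y x]
  ring

section Projection

variable {k m n : ℕ} (S : Matrix (Fin k) (Fin m) ℝ) (A : Matrix (Fin m) (Fin n) ℝ)

theorem sketchProj_transpose : (sketchProj S A)ᵀ = sketchProj S A :=
  (isMoorePenrose_pinv (S * A)).symm_right

theorem mul_sketchProj : S * A * sketchProj S A = S * A := by
  rw [sketchProj, ← Matrix.mul_assoc, (isMoorePenrose_pinv (S * A)).mul_mul_self]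

theorem sketchProj_mul_self : sketchProj S A * sketchProj S A = sketchProj S A := by
  conv_lhs => enter [1]; rw [sketchProj]
  rw [Matrix.mul_assoc, mul_sketchProj, sketchProj]

theorem dotProduct_sketchProj (x y : Fin n → ℝ) :
    x ⬝ᵥ sketchProj S A *ᵥ y = sketchProj S A *ᵥ x ⬝ᵥ sketchProj S A *ᵥ y := by
  rw [← dotProduct_mulVec_symm (sketchProj_transpose S A), Matrix.mulVec_mulVec,
    sketchProj_mul_self]

theorem sketchProj_isPosContraction : IsPosContraction (sketchProj S A) := by
  refine ⟨sketchProj_transpose S A, fun x => ?_, fun x => ?_⟩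
  · rw [dotProduct_sketchProj]
    exact dotProduct_self_nonneg' _
  · have h := dotProduct_self_nonneg' (x - sketchProj S A *ᵥ x)
    rw [sub_dotProduct_sub_self, ← dotProduct_sketchProj] at h
    linarith

theorem residual_dotProduct_self (x : Fin n → ℝ) :
    (x - sketchProj S A *ᵥ x) ⬝ᵥ (x - sketchProj S A *ᵥ x) =
      x ⬝ᵥ x - x ⬝ᵥ sketchProj S A *ᵥ x := by
  rw [sub_dotProduct_sub_self, ← dotProduct_sketchProj]
  ring

theorem trace_sketchProj_le : (sketchProj S A).trace ≤ k := by
  have hP := isMoorePenrose_pinv (S * A)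
  rw [sketchProj, Matrix.trace_mul_comm]
  set E := S * A * pinv (S * A) with hE
  have hEE : E * E = E := by
    rw [hE, ← Matrix.mul_assoc, hP.mul_mul_self]
  have hET : Eᵀ = E := hP.symm_left
  have hdiag : ∀ i, E i i ≤ 1 := by
    intro i
    have h1 : E i i = ∑ l, E i l * E i l := by
      conv_lhs => rw [← hEE]
      rw [Matrix.mul_apply]
      refine Finset.sum_congr rfl fun l _ => ?_
      rw [← Matrix.transpose_apply E, hET]
    have h2 : E i i * E i i ≤ ∑ l, E i l * E i l :=
      Finset.single_le_sum (f := fun l => E i l * E i l) (fun l _ => mul_self_nonneg _)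
        (Finset.mem_univ i)
    nlinarith
  calc E.trace ≤ ∑ _i : Fin k, (1 : ℝ) := Finset.sum_le_sum fun i _ => hdiag i
    _ = k := by simp

theorem frobSq_mul_one_sub_sketchProj :
    frobSq (A * (1 - sketchProj S A)) = energy A (1 - sketchProj S A) := by
  have hT := one_sub_transpose (sketchProj_isPosContraction S A)
  have hid : (1 - sketchProj S A)ᵀ * (1 - sketchProj S A) = 1 - sketchProj S A := by
    rw [hT, Matrix.mul_sub, Matrix.mul_one, Matrix.sub_mul, Matrix.one_mul,
      sketchProj_mul_self, sub_self, sub_zero]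
  conv_rhs => rw [← hid, energy_transpose_mul_self, hT]

theorem le_frobSq_mul {σ : ℝ} (hσ : ∀ x : Fin n → ℝ, σ ^ 2 * (x ⬝ᵥ x) ≤ A *ᵥ x ⬝ᵥ A *ᵥ x)
    {p : ℕ} (Q : Matrix (Fin n) (Fin p) ℝ) : σ ^ 2 * frobSq Q ≤ frobSq (A * Q) := by
  rw [← frobSq_transpose, ← frobSq_transpose (A * Q), frobSq, frobSq, Finset.mul_sum]
  refine Finset.sum_le_sum fun j _ => ?_
  have := hσ (fun i => Q i j)
  simpa [dotProduct, sq, Matrix.mul_apply, Matrix.mulVec] using this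

theorem le_frobSq_residual {σ : ℝ}
    (hσ : ∀ x : Fin n → ℝ, σ ^ 2 * (x ⬝ᵥ x) ≤ A *ᵥ x ⬝ᵥ A *ᵥ x) :
    σ ^ 2 * (n - k) ≤ frobSq (A * (1 - sketchProj S A)) := by
  refine le_trans ?_ (le_frobSq_mul A hσ _)
  have hT := one_sub_transpose (sketchProj_isPosContraction S A)
  rw [frobSq_eq_trace, hT, Matrix.mul_sub, Matrix.mul_one, Matrix.sub_mul, Matrix.one_mul,
      sketchProj_mul_self, sub_self, sub_zero, Matrix.trace_sub, Matrix.trace_one,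
      Fintype.card_fin]
  nlinarith [trace_sketchProj_le S A, sq_nonneg σ]

end Projection

section Comparison

variable {j m n : ℕ} {μ : ℝ} (A : Matrix (Fin m) (Fin n) ℝ)

/-- The part of `x` removed by the regularized residual lies in the row space of the sketch, and
`‖S A R x‖² = μ ⟨x - R x, R x⟩`. -/
theorem regResid_normal_eq (hμ : 0 < μ) (s : Fin j → EuclideanSpace ℝ (Fin m))
    (x : Fin n → ℝ) :
    sketchProj (rowMatrix s) A *ᵥ (x - regResid μ A s *ᵥ x) = x - regResid μ A s *ᵥ x ∧
    (rowMatrix s * A) *ᵥ (regResid μ A s *ᵥ x) ⬝ᵥ (rowMatrix s * A) *ᵥ (regResid μ A s *ᵥ x) =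
      μ * ((x - regResid μ A s *ᵥ x) ⬝ᵥ regResid μ A s *ᵥ x) := by
  set w := regResid μ A s *ᵥ x with hw
  set X := rowMatrix s * A with hX
  have h := regGram_mulVec_regResid A hμ s x
  rw [regGram, Matrix.add_mulVec, Matrix.smul_mulVec, Matrix.one_mulVec, ← hw, ← hX] at h
  have h1 : (Xᵀ * X) *ᵥ w = μ • (x - w) := by
    rw [smul_sub, ← h, add_sub_cancel_right]
  have hd : x - w = μ⁻¹ • ((Xᵀ * X) *ᵥ w) := by
    rw [h1, smul_smul, inv_mul_cancel₀ hμ.ne', one_smul]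
  constructor
  · rw [hd, Matrix.mulVec_smul, Matrix.mulVec_mulVec, ← Matrix.mul_assoc]
    congr 3
    have := congrArg Matrix.transpose (mul_sketchProj (rowMatrix s) A)
    rwa [Matrix.transpose_mul, sketchProj_transpose] at this
  · rw [mulVec_dotProduct_mulVec, Matrix.mulVec_mulVec, h1, dotProduct_smul, smul_eq_mul,
      dotProduct_comm]

theorem regResid_mulVec_eq (hμ : 0 < μ) (s : Fin j → EuclideanSpace ℝ (Fin m))
    (x : Fin n → ℝ) :
    regResid μ A s *ᵥ x = x - sketchProj (rowMatrix s) A *ᵥ x +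
      pinv (rowMatrix s * A) *ᵥ ((rowMatrix s * A) *ᵥ (regResid μ A s *ᵥ x)) := by
  have h := (regResid_normal_eq A hμ s x).1
  rw [Matrix.mulVec_sub] at h
  rw [Matrix.mulVec_mulVec]
  change _ = _ + sketchProj (rowMatrix s) A *ᵥ _
  have h2 : sketchProj (rowMatrix s) A *ᵥ x = x - regResid μ A s *ᵥ x +
    sketchProj (rowMatrix s) A *ᵥ (regResid μ A s *ᵥ x) := by rw [← h]; abel
  rw [h2]; abel

/-- In the Loewner order the regularized projection `I - R` lies below the sketched projection. -/
theorem sub_regResid_le_sketchProj (hμ : 0 < μ) (s : Fin j → EuclideanSpace ℝ (Fin m))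
    (x : Fin n → ℝ) :
    x ⬝ᵥ x - x ⬝ᵥ regResid μ A s *ᵥ x ≤ x ⬝ᵥ sketchProj (rowMatrix s) A *ᵥ x := by
  obtain ⟨h1, h2⟩ := regResid_normal_eq A hμ s x
  rw [← dotProduct_sub]
  set w := regResid μ A s *ᵥ x
  set P := sketchProj (rowMatrix s) A
  have h3 : 0 ≤ (x - w) ⬝ᵥ w := by
    have := dotProduct_self_nonneg' ((rowMatrix s * A) *ᵥ w)
    rw [h2] at this
    exact nonneg_of_mul_nonneg_right this hμ
  have h4 : x ⬝ᵥ (x - w) = P *ᵥ x ⬝ᵥ (x - w) := by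
    rw [← dotProduct_mulVec_symm (sketchProj_transpose _ A), h1]
  have h5 := dotProduct_self_nonneg' (P *ᵥ x - (x - w))
  have h6 : (x - w) ⬝ᵥ (x - w) ≤ x ⬝ᵥ (x - w) := by
    have h7 : x ⬝ᵥ (x - w) = (x - w) ⬝ᵥ (x - w) + (x - w) ⬝ᵥ w := by
      rw [← dotProduct_add, sub_add_cancel, dotProduct_comm]
    linarith
  rw [sub_dotProduct_sub_self, ← h4, ← dotProduct_sketchProj] at h5
  linarith

/-- The regularized residual energy exceeds the true one by at most `‖A‖²` times the missing
trace. -/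
theorem energy_regResid_le (hμ : 0 < μ) (s : Fin j → EuclideanSpace ℝ (Fin m)) :
    energy A (regResid μ A s) ≤ frobSq (A * (1 - sketchProj (rowMatrix s) A)) +
      opNorm A ^ 2 * (j - (1 - regResid μ A s).trace) := by
  rw [frobSq_mul_one_sub_sketchProj]
  set P := sketchProj (rowMatrix s) A with hP
  set R := regResid μ A s with hR
  have hRc : IsPosContraction R := regResid_isPosContraction A hμ s
  have hT : (P - (1 - R))ᵀ = P - (1 - R) := by
    rw [Matrix.transpose_sub, sketchProj_transpose, one_sub_transpose hRc]
  have h0 : ∀ x, 0 ≤ x ⬝ᵥ (P - (1 - R)) *ᵥ x := by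
    intro x
    rw [Matrix.sub_mulVec, Matrix.sub_mulVec, Matrix.one_mulVec, dotProduct_sub, dotProduct_sub]
    linarith [sub_regResid_le_sketchProj A hμ s x]
  have h1 := energy_le_trace A hT h0
  rw [energy_sub, energy_sub, Matrix.trace_sub] at h1
  rw [energy_sub]
  nlinarith [trace_sketchProj_le (rowMatrix s) A, sq_nonneg (opNorm A)]

/-- The regularized residual converges to the true residual `I - (S A)† S A` as `μ ↓ 0`; the choice
`μ = 1 / (N + 1)` gives a sequence. -/
theorem tendsto_regResid_mulVec (s : Fin j → EuclideanSpace ℝ (Fin m)) (x : Fin n → ℝ) :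
    Filter.Tendsto (fun N : ℕ => regResid (1 / ((N : ℝ) + 1)) A s *ᵥ x) Filter.atTop
      (nhds (x - sketchProj (rowMatrix s) A *ᵥ x)) := by
  have hpos : ∀ N : ℕ, (0 : ℝ) < 1 / ((N : ℝ) + 1) := fun N => by positivity
  set X := rowMatrix s * A with hX
  have h0 : Filter.Tendsto (fun N : ℕ => X *ᵥ (regResid (1 / ((N : ℝ) + 1)) A s *ᵥ x))
      Filter.atTop (nhds 0) := by
    rw [tendsto_pi_nhds]
    intro i
    have hb : ∀ N : ℕ, |(X *ᵥ (regResid (1 / ((N : ℝ) + 1)) A s *ᵥ x)) i| ≤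
        √(1 / ((N : ℝ) + 1) * (x ⬝ᵥ x)) := by
      intro N
      apply Real.abs_le_sqrt
      have h2 := (regResid_normal_eq A (hpos N) s x).2
      have hR := regResid_isPosContraction A (hpos N) s
      set w := regResid (1 / ((N : ℝ) + 1)) A s *ᵥ x with hw
      have h3 : (X *ᵥ w) i ^ 2 ≤ X *ᵥ w ⬝ᵥ X *ᵥ w := by
        rw [sq]
        exact Finset.single_le_sum (f := fun l => (X *ᵥ w) l * (X *ᵥ w) l)
          (fun l _ => mul_self_nonneg _) (Finset.mem_univ i)
      refine h3.trans (h2.le.trans (mul_le_mul_of_nonneg_left ?_ (hpos N).le))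
      rw [sub_dotProduct]
      linarith [dotProduct_self_nonneg' w, hR.le x]
    refine squeeze_zero_norm hb ?_
    have := ((tendsto_one_div_add_atTop_nhds_zero_nat (𝕜 := ℝ)).mul_const (x ⬝ᵥ x)).sqrt
    simpa using this
  have h1 : Filter.Tendsto (fun N : ℕ => x - sketchProj (rowMatrix s) A *ᵥ x +
      pinv X *ᵥ (X *ᵥ (regResid (1 / ((N : ℝ) + 1)) A s *ᵥ x))) Filter.atTop
      (nhds (x - sketchProj (rowMatrix s) A *ᵥ x + pinv X *ᵥ 0)) := by
    refine tendsto_const_nhds.add ?_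
    have hc : Continuous fun v : Fin j → ℝ => pinv X *ᵥ v := by fun_prop
    exact (hc.tendsto 0).comp h0
  rw [Matrix.mulVec_zero, add_zero] at h1
  refine h1.congr fun N => ?_
  exact (regResid_mulVec_eq A (hpos N) s x).symm

theorem continuous_regResid (hμ : 0 < μ) :
    Continuous fun s : Fin j → EuclideanSpace ℝ (Fin m) => regResid μ A s := by
  have hG : Continuous fun s : Fin j → EuclideanSpace ℝ (Fin m) => regGram μ A s := by
    have : Continuous fun s : Fin j → EuclideanSpace ℝ (Fin m) => rowMatrix s * A := by
      refine Continuous.matrix_mul ?_ continuous_const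
      refine continuous_matrix fun i l => ?_
      simp only [rowMatrix, Matrix.of_apply]
      fun_prop
    exact (this.matrix_transpose.matrix_mul this).add continuous_const
  simp only [regResid, Matrix.inv_def, Ring.inverse_eq_inv']
  have hd := hG.matrix_det.inv₀ fun s => (regGram_isUnit_det A hμ s).ne_zero
  exact (hd.smul hG.matrix_adjugate).const_smul μ

theorem continuous_sketchedRow :
    Continuous fun v : EuclideanSpace ℝ (Fin m) => sketchedRow A v := by
  unfold sketchedRow
  fun_prop

/-- The pseudoinverse is discontinuous in the sketch; the sketched projection is nevertheless
measurable, as a pointwise limit of the continuous regularized projections. -/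
theorem measurable_sketchProj_mulVec (x : Fin n → ℝ) :
    Measurable fun s : Fin j → EuclideanSpace ℝ (Fin m) => sketchProj (rowMatrix s) A *ᵥ x := by
  have h : Measurable fun s : Fin j → EuclideanSpace ℝ (Fin m) =>
      x - sketchProj (rowMatrix s) A *ᵥ x := by
    refine measurable_of_tendsto_metrizable (f := fun N : ℕ =>
      fun s : Fin j → EuclideanSpace ℝ (Fin m) => regResid (1 / ((N : ℝ) + 1)) A s *ᵥ x)
      (fun N => ?_) ?_
    · exact ((continuous_regResid A (by positivity)).matrix_mulVec continuous_const).measurable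
    · rw [tendsto_pi_nhds]
      exact fun s => tendsto_regResid_mulVec A s x
  have h2 := h.const_sub x
  simpa using h2

theorem measurable_sketchProj_apply (a b : Fin n) :
    Measurable fun s : Fin j → EuclideanSpace ℝ (Fin m) => sketchProj (rowMatrix s) A a b := by
  have := (measurable_pi_apply a).comp (measurable_sketchProj_mulVec (j := j) A (Pi.single b 1))
  simpa [Function.comp_def] using this

end Comparison

/-! ### Moments of isotropic, sub-gaussian and Euclidean-concentrated vectors -/

section SubGaussian

variable {Ω : Type*} [MeasurableSpace Ω] {P : Measure Ω} [IsProbabilityMeasure P] {X : Ω → ℝ}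
  {K : ℝ}

/-- If `g (X² / t²)` is dominated by `exp (X² / t²) - 1`, the sub-gaussian bound at scale `t`
controls the expectation of `t ^ q * g (X² / t²)`; letting `t ↓ K` gives a moment bound. -/
theorem SubGaussianConc.moment_le (h : SubGaussianConc P X K) (hK : 0 ≤ K) (hX : Measurable X)
    {q : ℕ} {c : ℝ} (hc : 0 ≤ c)
    (hq : ∀ y : ℝ, 0 ≤ y → y ^ q ≤ c * (Real.exp y - 1)) :
    Integrable (fun ω => X ω ^ (2 * q)) P ∧ ∫ ω, X ω ^ (2 * q) ∂P ≤ c * K ^ (2 * q) := by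
  have hstep : ∀ t' : ℝ, K < t' → Integrable (fun ω => X ω ^ (2 * q)) P ∧
      ∫ ω, X ω ^ (2 * q) ∂P ≤ c * t' ^ (2 * q) := by
    intro t' ht'
    have hlt : sInf (ENNReal.ofReal '' {t : ℝ | 0 < t ∧
        ∫⁻ ω, ENNReal.ofReal (Real.exp (X ω ^ 2 / t ^ 2)) ∂P ≤ 2}) < ENNReal.ofReal t' :=
      lt_of_le_of_lt h ((ENNReal.ofReal_lt_ofReal_iff (hK.trans_lt ht')).2 ht')
    obtain ⟨_, ⟨t, ⟨ht0, ht⟩, rfl⟩, htt⟩ := sInf_lt_iff.mp hlt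
    have htt' : t < t' := (ENNReal.ofReal_lt_ofReal_iff (hK.trans_lt ht')).1 htt
    have hmeas : Measurable fun ω => Real.exp (X ω ^ 2 / t ^ 2) := by fun_prop
    have hint : Integrable (fun ω => Real.exp (X ω ^ 2 / t ^ 2)) P := by
      refine ⟨hmeas.aestronglyMeasurable, ?_⟩
      rw [hasFiniteIntegral_iff_ofReal (Filter.Eventually.of_forall fun ω => (Real.exp_pos _).le)]
      exact ht.trans_lt (by norm_num)
    have hle : ∫ ω, Real.exp (X ω ^ 2 / t ^ 2) ∂P ≤ 2 := by
      rw [integral_eq_lintegral_of_nonneg_ae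
        (Filter.Eventually.of_forall fun ω => (Real.exp_pos _).le) hmeas.aestronglyMeasurable]
      exact ENNReal.toReal_le_of_le_ofReal (by norm_num) (by simpa using ht)
    have hpt : ∀ ω, X ω ^ (2 * q) ≤ c * t ^ (2 * q) * (Real.exp (X ω ^ 2 / t ^ 2) - 1) := by
      intro ω
      have h1 := hq (X ω ^ 2 / t ^ 2) (by positivity)
      rw [div_pow, ← pow_mul, ← pow_mul, div_le_iff₀ (by positivity)] at h1
      linarith
    have hint2 : Integrable
        (fun ω => c * t ^ (2 * q) * (Real.exp (X ω ^ 2 / t ^ 2) - 1)) P :=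
      (hint.sub (integrable_const 1)).const_mul _
    have hnn : ∀ ω, 0 ≤ X ω ^ (2 * q) := fun ω => by rw [pow_mul]; positivity
    have hint3 : Integrable (fun ω => X ω ^ (2 * q)) P := by
      refine hint2.mono' (hX.pow_const _).aestronglyMeasurable
        (Filter.Eventually.of_forall fun ω => ?_)
      rw [Real.norm_eq_abs, abs_of_nonneg (hnn ω)]
      exact hpt ω
    refine ⟨hint3, ?_⟩
    calc ∫ ω, X ω ^ (2 * q) ∂P ≤ ∫ ω, c * t ^ (2 * q) * (Real.exp (X ω ^ 2 / t ^ 2) - 1) ∂P :=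
          integral_mono hint3 hint2 hpt
      _ = c * t ^ (2 * q) * (∫ ω, Real.exp (X ω ^ 2 / t ^ 2) ∂P - 1) := by
          rw [integral_const_mul, integral_sub hint (integrable_const 1)]
          simp
      _ ≤ c * t ^ (2 * q) * 1 := by gcongr; linarith
      _ ≤ c * t' ^ (2 * q) := by rw [mul_one]; gcongr
  refine ⟨(hstep (K + 1) (by linarith)).1, ?_⟩
  have hcont : Continuous fun t : ℝ => c * t ^ (2 * q) := by fun_prop
  refine ge_of_tendsto ((hcont.tendsto K).mono_left (nhdsWithin_le_nhds (s := Set.Ioi K))) ?_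
  filter_upwards [self_mem_nhdsWithin] with t ht using (hstep t ht).2

theorem SubGaussianConc.sq_le (h : SubGaussianConc P X K) (hK : 0 ≤ K) (hX : Measurable X) :
    Integrable (fun ω => X ω ^ 2) P ∧ ∫ ω, X ω ^ 2 ∂P ≤ K ^ 2 := by
  have := h.moment_le hK hX (q := 1) (c := 1) (by norm_num) (fun y _ => by
    have := Real.add_one_le_exp y
    linarith)
  simpa using this

theorem SubGaussianConc.pow_four_le (h : SubGaussianConc P X K) (hK : 0 ≤ K)
    (hX : Measurable X) :
    Integrable (fun ω => X ω ^ 4) P ∧ ∫ ω, X ω ^ 4 ∂P ≤ 2 * K ^ 4 := by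
  have := h.moment_le hK hX (q := 2) (c := 2) (by norm_num) (fun y hy => by
    have := Real.quadratic_le_exp_of_nonneg hy
    linarith)
  simpa using this

end SubGaussian

section Vector

variable {m : ℕ} {ν : Measure (EuclideanSpace ℝ (Fin m))} {K L : ℝ}

theorem Isotropic.integrable_mul (h : Isotropic ν) (i l : Fin m) :
    Integrable (fun s : EuclideanSpace ℝ (Fin m) => s i * s l) ν := by
  have hsq : ∀ i : Fin m, MemLp (fun s : EuclideanSpace ℝ (Fin m) => s i) 2 ν := by
    intro i
    have hm : AEStronglyMeasurable (fun s : EuclideanSpace ℝ (Fin m) => s i) ν :=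
      (by fun_prop : Continuous fun s : EuclideanSpace ℝ (Fin m) => s i).aestronglyMeasurable
    rw [memLp_two_iff_integrable_sq hm]
    have h1 := h i i
    by_contra hc
    have h2 : ∫ s : EuclideanSpace ℝ (Fin m), s i * s i ∂ν = 0 :=
      integral_undef (by simpa [sq] using hc)
    rw [h2] at h1
    simp at h1
  exact (hsq i).integrable_mul (hsq l)

theorem Isotropic.integral_dotProduct_mul (h : Isotropic ν) (u w : Fin m → ℝ) :
    Integrable (fun s : EuclideanSpace ℝ (Fin m) => (s.ofLp ⬝ᵥ u) * (s.ofLp ⬝ᵥ w)) ν ∧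
    ∫ s, (s.ofLp ⬝ᵥ u) * (s.ofLp ⬝ᵥ w) ∂ν = u ⬝ᵥ w := by
  have e : ∀ s : EuclideanSpace ℝ (Fin m), (s.ofLp ⬝ᵥ u) * (s.ofLp ⬝ᵥ w) =
      ∑ i, ∑ l, (s i * s l) * (u i * w l) := by
    intro s
    rw [dotProduct, dotProduct, Finset.sum_mul_sum]
    exact Finset.sum_congr rfl fun i _ => Finset.sum_congr rfl fun l _ => by ring
  simp only [e]
  have hi : ∀ i l, Integrable (fun s : EuclideanSpace ℝ (Fin m) => (s i * s l) * (u i * w l)) ν :=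
    fun i l => (h.integrable_mul i l).mul_const _
  refine ⟨integrable_finsetSum _ fun i _ => integrable_finsetSum _ fun l _ => hi i l, ?_⟩
  rw [integral_finsetSum _ fun i _ => integrable_finsetSum _ fun l _ => hi i l]
  simp_rw [integral_finsetSum _ fun l _ => hi _ l, integral_mul_const, h _ _]
  simp [dotProduct]

theorem Isotropic.integrable_norm_sq (h : Isotropic ν) :
    Integrable (fun s : EuclideanSpace ℝ (Fin m) => ‖s‖ ^ 2) ν := by
  simp only [EuclideanSpace.real_norm_sq_eq]
  simp only [sq]
  exact integrable_finsetSum _ fun i _ => h.integrable_mul i i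

theorem measurable_dotProduct (u : Fin m → ℝ) :
    Measurable fun s : EuclideanSpace ℝ (Fin m) => s.ofLp ⬝ᵥ u :=
  (by unfold dotProduct; fun_prop :
    Continuous fun s : EuclideanSpace ℝ (Fin m) => s.ofLp ⬝ᵥ u).measurable

theorem SubGaussianVector.conc (h : SubGaussianVector ν K) {u : Fin m → ℝ} (hu : u ⬝ᵥ u = 1) :
    SubGaussianConc ν (fun s => s.ofLp ⬝ᵥ u) K := by
  have h1 : ‖(WithLp.toLp 2 u : EuclideanSpace ℝ (Fin m))‖ = 1 := by
    have := norm_sq_eq_dotProduct (WithLp.toLp 2 u : EuclideanSpace ℝ (Fin m))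
    rw [hu] at this
    nlinarith [norm_nonneg (WithLp.toLp 2 u : EuclideanSpace ℝ (Fin m))]
  have h2 := h _ h1
  have e : (fun s : EuclideanSpace ℝ (Fin m) => inner ℝ (WithLp.toLp 2 u) s) =
      fun s => s.ofLp ⬝ᵥ u := by
    ext s
    simp [PiLp.inner_apply, dotProduct]
  rwa [e] at h2

/-- Isotropy gives a coordinate second moment one, which the sub-gaussian constant controls. -/
theorem SubGaussianVector.one_le [IsProbabilityMeasure ν] (h : SubGaussianVector ν K)
    (hK : 0 ≤ K) (hi : Isotropic ν) (hm : 0 < m) : 1 ≤ K := by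
  have hu : (Pi.single ⟨0, hm⟩ 1 : Fin m → ℝ) ⬝ᵥ Pi.single ⟨0, hm⟩ 1 = 1 := by simp
  have h1 := ((h.conc hu).sq_le hK (measurable_dotProduct _)).2
  have h2 := (hi.integral_dotProduct_mul (Pi.single ⟨0, hm⟩ 1) (Pi.single ⟨0, hm⟩ 1)).2
  simp only [sq (_ ⬝ᵥ _)] at h1
  rw [h2, hu] at h1
  nlinarith

theorem EuclideanConc.sq_le [IsProbabilityMeasure ν] (h : EuclideanConc ν L) (hL : 0 ≤ L) {p : ℕ}
    (B : Matrix (Fin p) (Fin m) ℝ) :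
    Integrable (fun s => (‖Matrix.toEuclideanLin B s‖ - √(frobSq B)) ^ 2) ν ∧
    ∫ s, (‖Matrix.toEuclideanLin B s‖ - √(frobSq B)) ^ 2 ∂ν ≤ (L * opNorm B) ^ 2 := by
  refine (h p B).sq_le (mul_nonneg hL (opNorm_nonneg B)) ?_
  exact (((LinearMap.continuous_of_finiteDimensional _).norm).sub continuous_const).measurable

theorem EuclideanConc.pow_four_le [IsProbabilityMeasure ν] (h : EuclideanConc ν L)
    (hL : 0 ≤ L) {p : ℕ}
    (B : Matrix (Fin p) (Fin m) ℝ) :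
    Integrable (fun s => (‖Matrix.toEuclideanLin B s‖ - √(frobSq B)) ^ 4) ν ∧
    ∫ s, (‖Matrix.toEuclideanLin B s‖ - √(frobSq B)) ^ 4 ∂ν ≤ 2 * (L * opNorm B) ^ 4 := by
  refine (h p B).pow_four_le (mul_nonneg hL (opNorm_nonneg B)) ?_
  exact (((LinearMap.continuous_of_finiteDimensional _).norm).sub continuous_const).measurable

/-- Applied to a single row, Euclidean concentration says that `|⟨s, v⟩|` is close to `‖v‖`. -/
theorem EuclideanConc.abs_sub_sq_le [IsProbabilityMeasure ν] (h : EuclideanConc ν L)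
    (hL : 0 ≤ L) (v : Fin m → ℝ) :
    Integrable (fun s : EuclideanSpace ℝ (Fin m) => (|s.ofLp ⬝ᵥ v| - √(v ⬝ᵥ v)) ^ 2) ν ∧
    ∫ s, (|s.ofLp ⬝ᵥ v| - √(v ⬝ᵥ v)) ^ 2 ∂ν ≤ L ^ 2 * (v ⬝ᵥ v) := by
  set B : Matrix (Fin 1) (Fin m) ℝ := Matrix.of fun _ => v with hB
  have e1 : frobSq B = v ⬝ᵥ v := by simp [frobSq, hB, dotProduct, sq]
  have e2 : ∀ s : EuclideanSpace ℝ (Fin m), ‖Matrix.toEuclideanLin B s‖ = |s.ofLp ⬝ᵥ v| := by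
    intro s
    rw [← Real.sqrt_sq (norm_nonneg _), norm_sq_toEuclideanLin, ← Real.sqrt_sq_eq_abs]
    congr 1
    simp [dotProduct, hB, Matrix.mulVec, sq, mul_comm]
  have e3 : opNorm B ^ 2 ≤ v ⬝ᵥ v := by
    have h0 := dotProduct_self_nonneg' v
    have : opNorm B ≤ √(v ⬝ᵥ v) := by
      refine opNorm_le_of_forall B (Real.sqrt_nonneg _) fun x => ?_
      rw [Real.sq_sqrt h0]
      have := dotProduct_sq_le v x
      simpa [hB, Matrix.mulVec, sq, dotProduct] using this
    calc opNorm B ^ 2 ≤ √(v ⬝ᵥ v) ^ 2 := pow_le_pow_left₀ (opNorm_nonneg B) this 2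
      _ = v ⬝ᵥ v := Real.sq_sqrt h0
  have := h.sq_le hL B
  simp only [e1, e2] at this
  refine ⟨this.1, this.2.trans ?_⟩
  rw [mul_pow]
  gcongr

/-- In dimension at least two the concentration constant is bounded below: the numbers
`|s₁|`, `|s₂|`, `|s₁ + s₂| / √2`, `|s₁ - s₂| / √2` are never simultaneously close to one. -/
theorem EuclideanConc.one_le [IsProbabilityMeasure ν] (h : EuclideanConc ν L)
    (hL : 0 ≤ L) (hm : 2 ≤ m) : 1 ≤ 3 * L := by
  set i : Fin m := ⟨0, by omega⟩ with hi
  set l : Fin m := ⟨1, by omega⟩ with hl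
  have hil : i ≠ l := by simp [hi, hl]
  set e : Fin m → ℝ := Pi.single i 1 with he
  set f : Fin m → ℝ := Pi.single l 1 with hf
  have hee : e ⬝ᵥ e = 1 := by simp [he]
  have hff : f ⬝ᵥ f = 1 := by simp [hf]
  have hef : e ⬝ᵥ f = 0 := by simp [he, hf, hil]
  have hfe : f ⬝ᵥ e = 0 := by simp [he, hf, hil.symm]
  have hpp : (e + f) ⬝ᵥ (e + f) = 2 := by
    rw [dotProduct_add, add_dotProduct, add_dotProduct, hee, hff, hef, hfe]; norm_num
  have hmm : (e - f) ⬝ᵥ (e - f) = 2 := by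
    rw [sub_dotProduct_sub_self, hee, hff, hef]; norm_num
  have h1 := h.abs_sub_sq_le hL e
  have h2 := h.abs_sub_sq_le hL f
  have h3 := h.abs_sub_sq_le hL (e + f)
  have h4 := h.abs_sub_sq_le hL (e - f)
  rw [hee, Real.sqrt_one] at h1
  rw [hff, Real.sqrt_one] at h2
  rw [hpp] at h3
  rw [hmm] at h4
  simp only [dotProduct_add, dotProduct_sub] at h3 h4
  have key : ∀ a b : ℝ, 1 ≤ 2 * (|a| - 1) ^ 2 + 2 * (|b| - 1) ^ 2 + (|a + b| - √2) ^ 2 +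
      (|a - b| - √2) ^ 2 := by
    intro a b
    have hs : √2 ^ 2 = 2 := Real.sq_sqrt (by norm_num)
    have hs0 : 0 ≤ √2 := Real.sqrt_nonneg 2
    have hs1 : √2 ≤ 1.4143 := by
      rw [Real.sqrt_le_left (by norm_num)]; norm_num
    have hmax : |a + b| + |a - b| ≤ 2 * |a| ∨ |a + b| + |a - b| ≤ 2 * |b| := by
      rcases abs_cases (a + b) with h1 | h1 <;> rcases abs_cases (a - b) with h2 | h2 <;>
      rcases abs_cases a with h3 | h3 <;> rcases abs_cases b with h4 | h4 <;>
      first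
      | (left; linarith)
      | (right; linarith)
    have e1 : 2 * (|a| - 1) ^ 2 + 2 * (|b| - 1) ^ 2 + (|a + b| - √2) ^ 2 + (|a - b| - √2) ^ 2
        = 4 * |a| ^ 2 + 4 * |b| ^ 2 - 4 * |a| - 4 * |b| + 8 - 2 * √2 * (|a + b| + |a - b|) := by
      have := sq_abs (a + b)
      have := sq_abs (a - b)
      have := sq_abs a
      have := sq_abs b
      nlinarith
    rw [e1]
    have ha := abs_nonneg a
    have hb := abs_nonneg b
    -- The numbers `1 / 2` and `1.20715 ≈ (1 + √2) / 2` minimize the two resulting parabolas.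
    rcases hmax with hmax | hmax
    · have : 2 * √2 * (|a + b| + |a - b|) ≤ 2 * 1.4143 * (2 * |a|) := by gcongr
      nlinarith [sq_nonneg (|b| - 1 / 2), sq_nonneg (|a| - 1.20715)]
    · have : 2 * √2 * (|a + b| + |a - b|) ≤ 2 * 1.4143 * (2 * |b|) := by gcongr
      nlinarith [sq_nonneg (|a| - 1 / 2), sq_nonneg (|b| - 1.20715)]
  have h12 : Integrable (fun s : EuclideanSpace ℝ (Fin m) =>
      2 * (|s.ofLp ⬝ᵥ e| - 1) ^ 2 + 2 * (|s.ofLp ⬝ᵥ f| - 1) ^ 2) ν :=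
    (h1.1.const_mul 2).add (h2.1.const_mul 2)
  have h123 : Integrable (fun s : EuclideanSpace ℝ (Fin m) =>
      2 * (|s.ofLp ⬝ᵥ e| - 1) ^ 2 + 2 * (|s.ofLp ⬝ᵥ f| - 1) ^ 2 +
        (|s.ofLp ⬝ᵥ e + s.ofLp ⬝ᵥ f| - √2) ^ 2) ν := h12.add h3.1
  have h1234 : Integrable (fun s : EuclideanSpace ℝ (Fin m) =>
      2 * (|s.ofLp ⬝ᵥ e| - 1) ^ 2 + 2 * (|s.ofLp ⬝ᵥ f| - 1) ^ 2 +
        (|s.ofLp ⬝ᵥ e + s.ofLp ⬝ᵥ f| - √2) ^ 2 +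
        (|s.ofLp ⬝ᵥ e - s.ofLp ⬝ᵥ f| - √2) ^ 2) ν := h123.add h4.1
  have hint : ∫ _ : EuclideanSpace ℝ (Fin m), (1 : ℝ) ∂ν ≤
      ∫ s : EuclideanSpace ℝ (Fin m), (2 * (|s.ofLp ⬝ᵥ e| - 1) ^ 2 + 2 * (|s.ofLp ⬝ᵥ f| - 1) ^ 2 +
        (|s.ofLp ⬝ᵥ e + s.ofLp ⬝ᵥ f| - √2) ^ 2 + (|s.ofLp ⬝ᵥ e - s.ofLp ⬝ᵥ f| - √2) ^ 2) ∂ν :=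
    integral_mono (integrable_const _) h1234 fun s => key _ _
  rw [integral_add h123 h4.1, integral_add h12 h3.1,
    integral_add (h1.1.const_mul 2) (h2.1.const_mul 2), integral_const_mul,
    integral_const_mul] at hint
  simp only [integral_const, probReal_univ, smul_eq_mul, one_mul] at hint
  nlinarith

end Vector

/-! ### Replacing the random denominators by their mean -/

/-- The standing assumptions on the law `ν` of one row, in normalized form: `θ = L / √r` with `r`
the stable rank, and `K² θ` is small. The regularization level is `θ ‖A‖_F²`. -/
structure SketchHyp {m n : ℕ} (ν : Measure (EuclideanSpace ℝ (Fin m)))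
    (A : Matrix (Fin m) (Fin n) ℝ) (K L θ : ℝ) : Prop where
  isotropic : Isotropic ν
  subGaussian : SubGaussianVector ν K
  concentrated : EuclideanConc ν L
  one_le_K : 1 ≤ K
  L_nonneg : 0 ≤ L
  frob_pos : 0 < frobSq A
  theta_pos : 0 < θ
  theta_sq : θ ^ 2 * frobSq A = L ^ 2 * opNorm A ^ 2
  small : 300 * (K ^ 2 * θ) ≤ 1

theorem continuous_updDenom {m n : ℕ} (μ : ℝ) (A : Matrix (Fin m) (Fin n) ℝ)
    (R : Matrix (Fin n) (Fin n) ℝ) : Continuous fun v => updDenom μ A R v := by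
  have := continuous_sketchedRow A
  unfold updDenom
  exact continuous_const.add (this.dotProduct (continuous_const.matrix_mulVec this))

/-- With `Δ = |Y - f|` for `Y = ‖M s‖`, `f = ‖M‖_F`, the relative fluctuation of the denominator
`μ + Y²` is linear in `Δ` when `Y ≥ f / 2`; otherwise `Δ ≥ f / 2` and the regularization `μ`
keeps it quadratic in `Δ`. -/
theorem abs_ratio_sub_one_le {f Y μ θ : ℝ} (hf : 0 < f) (hY : 0 ≤ Y) (hθ : 0 < θ)
    (hμ : θ * f ^ 2 ≤ μ) :
    |(μ + f ^ 2) / (μ + Y ^ 2) - 1| ≤ 6 * |Y - f| / f + 3 * (Y - f) ^ 2 / (θ * f ^ 2) := by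
  have hμ0 : 0 < μ := lt_of_lt_of_le (by positivity) hμ
  have hD : 0 < μ + Y ^ 2 := by positivity
  have e : (μ + f ^ 2) / (μ + Y ^ 2) - 1 = -((Y - f) * (Y + f)) / (μ + Y ^ 2) := by
    field_simp
    ring
  rw [e, abs_div, abs_neg, abs_mul, abs_of_pos hD, abs_of_nonneg (by positivity : 0 ≤ Y + f)]
  have hΔ := abs_nonneg (Y - f)
  by_cases h : f / 2 ≤ Y
  · have hY0 : 0 < Y := by linarith
    have h1 : |Y - f| * (Y + f) / (μ + Y ^ 2) ≤ 6 * |Y - f| / f := by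
      rw [div_le_div_iff₀ hD hf]
      have : (Y + f) * f ≤ 6 * (μ + Y ^ 2) := by nlinarith
      nlinarith
    have h2 : 0 ≤ 3 * (Y - f) ^ 2 / (θ * f ^ 2) := by positivity
    linarith
  · push Not at h
    have hab : |Y - f| = f - Y := by rw [abs_of_nonpos (by linarith)]; ring
    have h1 : |Y - f| * (Y + f) / (μ + Y ^ 2) ≤ 3 * (Y - f) ^ 2 / (θ * f ^ 2) := by
      rw [div_le_div_iff₀ hD (by positivity)]
      have h3 : |Y - f| * (Y + f) ≤ 3 * (Y - f) ^ 2 := by rw [hab]; nlinarith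
      have h4 : θ * f ^ 2 ≤ μ + Y ^ 2 := by nlinarith [sq_nonneg Y]
      exact mul_le_mul h3 h4 (by positivity) (by positivity)
    have h2 : 0 ≤ 6 * |Y - f| / f := by positivity
    linarith

section Key

variable {m n : ℕ} {ν : Measure (EuclideanSpace ℝ (Fin m))} [IsProbabilityMeasure ν]
  {A : Matrix (Fin m) (Fin n) ℝ} {K L θ : ℝ}

theorem SketchHyp.mu_pos {ν : Measure (EuclideanSpace ℝ (Fin m))} (h : SketchHyp ν A K L θ) :
    0 < θ * frobSq A :=
  mul_pos h.theta_pos h.frob_pos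

theorem SketchHyp.theta_le {ν : Measure (EuclideanSpace ℝ (Fin m))} (h : SketchHyp ν A K L θ) :
    θ ≤ 1 / 300 := by
  have h1 : 1 ≤ K ^ 2 := one_le_pow₀ h.one_le_K
  nlinarith [h.small, h.theta_pos]

/-- A function dominating the relative fluctuation of the denominator, with small second
moment. -/
theorem SketchHyp.exists_bound (h : SketchHyp ν A K L θ) {R : Matrix (Fin n) (Fin n) ℝ}
    (hR : IsPosContraction R) (hE : frobSq A / 2 ≤ energy A R) :
    ∃ W : EuclideanSpace ℝ (Fin m) → ℝ, Integrable (fun s => W s ^ 2) ν ∧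
      ∫ s, W s ^ 2 ∂ν ≤ 288 * θ ^ 2 ∧
      ∀ s, |(θ * frobSq A + energy A R) / updDenom (θ * frobSq A) A R s - 1| ≤ W s := by
  obtain ⟨M, hM1, hM2, hM3⟩ := exists_energy_factor A hR
  have hf0 := h.frob_pos
  have hθ := h.theta_pos
  set e := energy A R with he
  have he0 : 0 < e := by linarith
  have hle : e ≤ frobSq A := energy_le_frobSq A hR
  set f := √e with hf
  have hfp : 0 < f := Real.sqrt_pos.mpr he0
  have hfsq : f ^ 2 = e := Real.sq_sqrt he0.le
  set Z : EuclideanSpace ℝ (Fin m) → ℝ := fun s => ‖Matrix.toEuclideanLin M s‖ - f with hZ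
  have h2 := h.concentrated.sq_le h.L_nonneg M
  have h4 := h.concentrated.pow_four_le h.L_nonneg M
  rw [hM1] at h2 h4
  -- The scale of the Euclidean concentration is `θ ‖A‖_F`.
  have hLM : (L * opNorm M) ^ 2 ≤ θ ^ 2 * frobSq A := by
    rw [h.theta_sq, mul_pow]
    have := opNorm_nonneg M
    gcongr
  have hLM4 : (L * opNorm M) ^ 4 ≤ (θ ^ 2 * frobSq A) ^ 2 := by
    calc (L * opNorm M) ^ 4 = ((L * opNorm M) ^ 2) ^ 2 := by ring
      _ ≤ _ := pow_le_pow_left₀ (by positivity) hLM 2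
  set W : EuclideanSpace ℝ (Fin m) → ℝ :=
    fun s => 6 * |Z s| / f + 3 * Z s ^ 2 / (θ * f ^ 2) with hW
  have hWle : ∀ s, W s ^ 2 ≤ 72 / e * Z s ^ 2 + 18 / (θ ^ 2 * e ^ 2) * Z s ^ 4 := by
    intro s
    have e1 : 72 / e * Z s ^ 2 + 18 / (θ ^ 2 * e ^ 2) * Z s ^ 4 =
        2 * (6 * |Z s| / f) ^ 2 + 2 * (3 * Z s ^ 2 / (θ * f ^ 2)) ^ 2 := by
      rw [div_pow, mul_pow, sq_abs, hfsq, div_pow, mul_pow, mul_pow]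
      ring
    rw [e1]
    simp only [hW]
    nlinarith [sq_nonneg (6 * |Z s| / f - 3 * Z s ^ 2 / (θ * f ^ 2))]
  have hint : Integrable (fun s => 72 / e * Z s ^ 2 + 18 / (θ ^ 2 * e ^ 2) * Z s ^ 4) ν :=
    (h2.1.const_mul _).add (h4.1.const_mul _)
  have hZc : Continuous Z :=
    ((LinearMap.continuous_of_finiteDimensional _).norm).sub continuous_const
  have hWc : Continuous W := by
    simp only [hW]
    fun_prop (disch := positivity)
  have hWi : Integrable (fun s => W s ^ 2) ν := by
    refine hint.mono' (hWc.pow 2).aestronglyMeasurable (Filter.Eventually.of_forall fun s => ?_)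
    rw [Real.norm_eq_abs, abs_of_nonneg (sq_nonneg _)]
    exact hWle s
  refine ⟨W, hWi, ?_, fun s => ?_⟩
  · calc ∫ s, W s ^ 2 ∂ν ≤ ∫ s, (72 / e * Z s ^ 2 + 18 / (θ ^ 2 * e ^ 2) * Z s ^ 4) ∂ν :=
          integral_mono hWi hint hWle
      _ = 72 / e * ∫ s, Z s ^ 2 ∂ν + 18 / (θ ^ 2 * e ^ 2) * ∫ s, Z s ^ 4 ∂ν := by
          rw [integral_add (h2.1.const_mul _) (h4.1.const_mul _), integral_const_mul,
            integral_const_mul]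
      _ ≤ 72 / e * (θ ^ 2 * frobSq A) +
          18 / (θ ^ 2 * e ^ 2) * (2 * (θ ^ 2 * frobSq A) ^ 2) := by
          gcongr
          · exact h2.2.trans hLM
          · exact h4.2.trans (by linarith)
      _ ≤ 72 / e * (θ ^ 2 * (2 * e)) + 18 / (θ ^ 2 * e ^ 2) * (2 * (θ ^ 2 * (2 * e)) ^ 2) := by
          gcongr <;> linarith
      _ = 288 * θ ^ 2 := by field_simp; norm_num
  · have := abs_ratio_sub_one_le (f := f) (Y := ‖Matrix.toEuclideanLin M s‖)
      (μ := θ * frobSq A) hfp (norm_nonneg _) hθ (by rw [hfsq]; gcongr)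
    rw [hfsq, hM3] at this
    simp only [hW, hZ, hfsq]
    exact this

/-- The denominator of the rank-one update may be replaced by its mean, with a relative error of
order `K² θ`. -/
theorem SketchHyp.integral_div_updDenom_unit (h : SketchHyp ν A K L θ)
    {R : Matrix (Fin n) (Fin n) ℝ} (hR : IsPosContraction R)
    (hE : frobSq A / 2 ≤ energy A R) {u w : Fin m → ℝ} (hu : u ⬝ᵥ u = 1) (hw : w ⬝ᵥ w = 1) :
    |(θ * frobSq A + energy A R) * ∫ s, (s.ofLp ⬝ᵥ u) * (s.ofLp ⬝ᵥ w) /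
      updDenom (θ * frobSq A) A R s ∂ν - u ⬝ᵥ w| ≤ 150 * (K ^ 2 * θ) := by
  obtain ⟨W, hW1, hW2, hW3⟩ := h.exists_bound hR hE
  have hK := h.one_le_K
  have hθ := h.theta_pos
  set μ := θ * frobSq A with hμdef
  have hμ : 0 < μ := h.mu_pos
  have hD : ∀ s, 0 < updDenom μ A R s := fun s => hμ.trans_le (le_updDenom A hR s)
  set F := μ + energy A R with hF
  have hXu := (h.subGaussian.conc hu).pow_four_le (by linarith) (measurable_dotProduct u)
  have hXw := (h.subGaussian.conc hw).pow_four_le (by linarith) (measurable_dotProduct w)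
  have hiso := h.isotropic.integral_dotProduct_mul u w
  -- Young's inequality with weight `c` balances the fourth moments `K⁴` of the rows against the
  -- second moment `θ²` of the fluctuation `W`.
  set c := θ / K ^ 2 with hc
  have hcp : 0 < c := by positivity
  set G : EuclideanSpace ℝ (Fin m) → ℝ := fun s =>
    c / 4 * (s.ofLp ⬝ᵥ u) ^ 4 + c / 4 * (s.ofLp ⬝ᵥ w) ^ 4 + 1 / (2 * c) * W s ^ 2 with hG
  have hG1 : Integrable (fun s : EuclideanSpace ℝ (Fin m) =>
    c / 4 * (s.ofLp ⬝ᵥ u) ^ 4 + c / 4 * (s.ofLp ⬝ᵥ w) ^ 4) ν :=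
    (hXu.1.const_mul _).add (hXw.1.const_mul _)
  have hGi : Integrable G ν := hG1.add (hW1.const_mul _)
  have hpt : ∀ s, |(s.ofLp ⬝ᵥ u) * (s.ofLp ⬝ᵥ w) * (F / updDenom μ A R s - 1)| ≤ G s := by
    intro s
    rw [abs_mul]
    set x := s.ofLp ⬝ᵥ u
    set y := s.ofLp ⬝ᵥ w
    have h1 : |x * y| * |F / updDenom μ A R s - 1| ≤ |x * y| * W s :=
      mul_le_mul_of_nonneg_left (hW3 s) (abs_nonneg _)
    have h2 : |x * y| * W s ≤ c / 2 * (x * y) ^ 2 + 1 / (2 * c) * W s ^ 2 := by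
      rw [← sq_abs (x * y)]
      have : c / 2 * |x * y| ^ 2 + 1 / (2 * c) * W s ^ 2 - |x * y| * W s =
        1 / (2 * c) * (c * |x * y| - W s) ^ 2 := by field_simp; ring
      have h3 : 0 ≤ 1 / (2 * c) * (c * |x * y| - W s) ^ 2 := by positivity
      linarith
    have h3 : c / 2 * (x * y) ^ 2 ≤ c / 4 * x ^ 4 + c / 4 * y ^ 4 := by
      have : 0 ≤ c / 4 * (x ^ 2 - y ^ 2) ^ 2 := by positivity
      nlinarith
    simp only [hG]
    linarith
  have hcont : Continuous fun s : EuclideanSpace ℝ (Fin m) =>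
      (s.ofLp ⬝ᵥ u) * (s.ofLp ⬝ᵥ w) * (F / updDenom μ A R s - 1) := by
    have := continuous_updDenom μ A R
    have h1 : Continuous fun s : EuclideanSpace ℝ (Fin m) => s.ofLp ⬝ᵥ u := by
      unfold dotProduct; fun_prop
    have h2 : Continuous fun s : EuclideanSpace ℝ (Fin m) => s.ofLp ⬝ᵥ w := by
      unfold dotProduct; fun_prop
    exact (h1.mul h2).mul ((continuous_const.div this fun s => (hD s).ne').sub continuous_const)
  have hdiff : Integrable (fun s : EuclideanSpace ℝ (Fin m) =>
      (s.ofLp ⬝ᵥ u) * (s.ofLp ⬝ᵥ w) * (F / updDenom μ A R s - 1)) ν :=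
    hGi.mono' hcont.aestronglyMeasurable (Filter.Eventually.of_forall hpt)
  have e1 : F * ∫ s, (s.ofLp ⬝ᵥ u) * (s.ofLp ⬝ᵥ w) / updDenom μ A R s ∂ν - u ⬝ᵥ w =
      ∫ s, (s.ofLp ⬝ᵥ u) * (s.ofLp ⬝ᵥ w) * (F / updDenom μ A R s - 1) ∂ν := by
    rw [← hiso.2, ← integral_const_mul]
    have : ∀ s : EuclideanSpace ℝ (Fin m), F * ((s.ofLp ⬝ᵥ u) * (s.ofLp ⬝ᵥ w) / updDenom μ A R s)
      = (s.ofLp ⬝ᵥ u) * (s.ofLp ⬝ᵥ w) * (F / updDenom μ A R s - 1) +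
        (s.ofLp ⬝ᵥ u) * (s.ofLp ⬝ᵥ w) := fun s => by ring
    simp_rw [this]
    rw [integral_add hdiff hiso.1, add_sub_cancel_right]
  rw [e1]
  calc |∫ s, (s.ofLp ⬝ᵥ u) * (s.ofLp ⬝ᵥ w) * (F / updDenom μ A R s - 1) ∂ν|
      ≤ ∫ s, |(s.ofLp ⬝ᵥ u) * (s.ofLp ⬝ᵥ w) * (F / updDenom μ A R s - 1)| ∂ν :=
        abs_integral_le_integral_abs
    _ ≤ ∫ s, G s ∂ν := integral_mono hdiff.abs hGi hpt
    _ = c / 4 * ∫ s, (s.ofLp ⬝ᵥ u) ^ 4 ∂ν + c / 4 * ∫ s, (s.ofLp ⬝ᵥ w) ^ 4 ∂ν +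
        1 / (2 * c) * ∫ s, W s ^ 2 ∂ν := by
        simp only [hG]
        rw [integral_add hG1 (hW1.const_mul _),
          integral_add (hXu.1.const_mul _) (hXw.1.const_mul _), integral_const_mul,
          integral_const_mul, integral_const_mul]
    _ ≤ c / 4 * (2 * K ^ 4) + c / 4 * (2 * K ^ 4) + 1 / (2 * c) * (288 * θ ^ 2) := by
        gcongr
        · exact hXu.2
        · exact hXw.2
    _ = 145 * (K ^ 2 * θ) := by
        rw [hc]
        field_simp
        norm_num
    _ ≤ 150 * (K ^ 2 * θ) := by
        have : 0 < K ^ 2 * θ := by positivity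
        linarith

/-- The estimate for unit vectors extends to all vectors by homogeneity. -/
theorem SketchHyp.integral_div_updDenom (h : SketchHyp ν A K L θ)
    {R : Matrix (Fin n) (Fin n) ℝ} (hR : IsPosContraction R)
    (hE : frobSq A / 2 ≤ energy A R) (u w : Fin m → ℝ) :
    |(θ * frobSq A + energy A R) * ∫ s, (s.ofLp ⬝ᵥ u) * (s.ofLp ⬝ᵥ w) /
      updDenom (θ * frobSq A) A R s ∂ν - u ⬝ᵥ w| ≤
      150 * (K ^ 2 * θ) * (√(u ⬝ᵥ u) * √(w ⬝ᵥ w)) := by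
  rcases eq_or_ne u 0 with rfl | hu
  · simp
  rcases eq_or_ne w 0 with rfl | hw
  · simp
  have norm : ∀ u : Fin m → ℝ, u ≠ 0 → ∃ (a : ℝ) (v : Fin m → ℝ), 0 < a ∧ u = a • v ∧
      v ⬝ᵥ v = 1 ∧ √(u ⬝ᵥ u) = a := by
    intro u hu
    have hp : 0 < u ⬝ᵥ u := lt_of_le_of_ne (dotProduct_self_nonneg' u)
      (fun h => hu (dotProduct_self_eq_zero.mp h.symm))
    have hs := Real.sqrt_pos.mpr hp
    refine ⟨√(u ⬝ᵥ u), (√(u ⬝ᵥ u))⁻¹ • u, hs, ?_, ?_, rfl⟩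
    · rw [smul_smul, mul_inv_cancel₀ hs.ne', one_smul]
    · rw [dotProduct_smul, smul_dotProduct, smul_eq_mul, smul_eq_mul, ← mul_assoc, ← sq,
        inv_pow, Real.sq_sqrt hp.le, inv_mul_cancel₀ hp.ne']
  obtain ⟨a, u', ha, rfl, hu1, ha'⟩ := norm u hu
  obtain ⟨b, w', hb, rfl, hw1, hb'⟩ := norm w hw
  rw [ha', hb']
  have key := h.integral_div_updDenom_unit hR hE hu1 hw1
  simp only [dotProduct_smul, smul_dotProduct, smul_eq_mul]
  have e1 : ∀ s : EuclideanSpace ℝ (Fin m), a * (s.ofLp ⬝ᵥ u') * (b * (s.ofLp ⬝ᵥ w')) /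
      updDenom (θ * frobSq A) A R s = (a * b) * ((s.ofLp ⬝ᵥ u') * (s.ofLp ⬝ᵥ w') /
      updDenom (θ * frobSq A) A R s) := fun s => by ring
  simp_rw [e1]
  rw [integral_const_mul]
  have e2 : ∀ F I : ℝ, F * (a * b * I) - b * (a * (u' ⬝ᵥ w')) =
    (a * b) * (F * I - u' ⬝ᵥ w') := fun F I => by ring
  rw [e2, abs_mul, abs_of_pos (mul_pos ha hb), mul_comm]
  exact mul_le_mul_of_nonneg_right key (mul_pos ha hb).le

/-- In the mean, the regularization costs each row only a fraction `O(θ)` of a dimension. -/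
theorem SketchHyp.integral_inv_updDenom_le (h : SketchHyp ν A K L θ)
    {R : Matrix (Fin n) (Fin n) ℝ} (hR : IsPosContraction R)
    (hE : frobSq A / 2 ≤ energy A R) :
    ∫ s, θ * frobSq A / updDenom (θ * frobSq A) A R s ∂ν ≤ 4 * θ := by
  obtain ⟨W, hW1, hW2, hW3⟩ := h.exists_bound hR hE
  have hf0 := h.frob_pos
  have hθ := h.theta_pos
  have hθ1 := h.theta_le
  set μ := θ * frobSq A with hμdef
  have hμ : 0 < μ := h.mu_pos
  have hD : ∀ s, 0 < updDenom μ A R s := fun s => hμ.trans_le (le_updDenom A hR s)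
  set F := μ + energy A R with hF
  have hFp : frobSq A / 2 ≤ F := by linarith
  have hpt : ∀ s, μ / updDenom μ A R s ≤ 2 * θ * (3 / 2 + 1 / 2 * W s ^ 2) := by
    intro s
    have h1 : F / updDenom μ A R s ≤ 3 / 2 + 1 / 2 * W s ^ 2 := by
      have := (abs_le.mp (hW3 s)).2
      nlinarith [sq_nonneg (W s - 1)]
    have h2 : μ / updDenom μ A R s ≤ 2 * θ * (F / updDenom μ A R s) := by
      rw [← mul_div_assoc]
      gcongr
      · exact (hD s).le
      · rw [hμdef]; nlinarith
    exact h2.trans (by gcongr)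
  have hint : Integrable (fun s => 2 * θ * (3 / 2 + 1 / 2 * W s ^ 2)) ν :=
    ((integrable_const _).add (hW1.const_mul _)).const_mul _
  have hc : Continuous fun s => μ / updDenom μ A R s :=
    continuous_const.div (continuous_updDenom μ A R) fun s => (hD s).ne'
  have hint2 : Integrable (fun s => μ / updDenom μ A R s) ν := by
    refine hint.mono' hc.aestronglyMeasurable (Filter.Eventually.of_forall fun s => ?_)
    rw [Real.norm_eq_abs, abs_of_nonneg (div_pos hμ (hD s)).le]
    exact hpt s
  calc ∫ s, μ / updDenom μ A R s ∂ν ≤ ∫ s, 2 * θ * (3 / 2 + 1 / 2 * W s ^ 2) ∂ν :=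
        integral_mono hint2 hint hpt
    _ = 2 * θ * (3 / 2 + 1 / 2 * ∫ s, W s ^ 2 ∂ν) := by
        rw [integral_const_mul, integral_add (integrable_const _) (hW1.const_mul _),
          integral_const_mul]
        simp
    _ ≤ 2 * θ * (3 / 2 + 1 / 2 * (288 * θ ^ 2)) := by gcongr
    _ ≤ 4 * θ := by nlinarith

end Key

/-! ### Adding the rows of a sketch one at a time -/

section Splitting

variable {m : ℕ} (ν : Measure (EuclideanSpace ℝ (Fin m))) [IsProbabilityMeasure ν]

theorem measurePreserving_insertNth {j : ℕ} (i : Fin (j + 1)) :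
    MeasurePreserving (fun p : EuclideanSpace ℝ (Fin m) × (Fin j → EuclideanSpace ℝ (Fin m)) =>
      (i.insertNth p.1 p.2 : Fin (j + 1) → EuclideanSpace ℝ (Fin m)))
      (ν.prod (sketchLaw ν j)) (sketchLaw ν (j + 1)) :=
  (measurePreserving_piFinSuccAbove (fun _ : Fin (j + 1) => ν) i).symm

/-- The rows of a sketch are exchangeable and independent: any one of them may be split off. -/
theorem integral_sketchLaw_succ {j : ℕ} (i : Fin (j + 1))
    {f : (Fin (j + 1) → EuclideanSpace ℝ (Fin m)) → ℝ}
    (hf : Integrable f (sketchLaw ν (j + 1))) :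
    Integrable (fun p : EuclideanSpace ℝ (Fin m) × (Fin j → EuclideanSpace ℝ (Fin m)) =>
      f (i.insertNth p.1 p.2)) (ν.prod (sketchLaw ν j)) ∧
    ∫ s, f s ∂(sketchLaw ν (j + 1)) =
      ∫ s, ∫ v, f (i.insertNth v s) ∂ν ∂(sketchLaw ν j) := by
  have hmp := measurePreserving_insertNth ν i
  have hint := (hmp.integrable_comp hf.aestronglyMeasurable).2 hf
  refine ⟨hint, ?_⟩
  have e : ∫ s, f s ∂(sketchLaw ν (j + 1)) =
      ∫ p, f (i.insertNth p.1 p.2) ∂(ν.prod (sketchLaw ν j)) := by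
    rw [← hmp.map_eq] at hf ⊢
    exact integral_map hmp.measurable.aemeasurable hf.aestronglyMeasurable
  rw [e]
  exact integral_prod_symm _ hint

end Splitting

section Recursion

variable {m n : ℕ} {ν : Measure (EuclideanSpace ℝ (Fin m))} [IsProbabilityMeasure ν]
  {A : Matrix (Fin m) (Fin n) ℝ} {K L θ : ℝ}

theorem continuous_dotProduct_left (u : Fin m → ℝ) :
    Continuous fun s : EuclideanSpace ℝ (Fin m) => s.ofLp ⬝ᵥ u := by
  unfold dotProduct; fun_prop

theorem Isotropic.integrable_div_updDenom {ν : Measure (EuclideanSpace ℝ (Fin m))}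
    (h : Isotropic ν) {μ : ℝ} (hμ : 0 < μ)
    {R : Matrix (Fin n) (Fin n) ℝ} (hR : IsPosContraction R) (u w : Fin m → ℝ) :
    Integrable (fun s : EuclideanSpace ℝ (Fin m) =>
      (s.ofLp ⬝ᵥ u) * (s.ofLp ⬝ᵥ w) / updDenom μ A R s) ν := by
  have hD : ∀ s, 0 < updDenom μ A R s := fun s => hμ.trans_le (le_updDenom A hR s)
  have hc : Continuous fun s : EuclideanSpace ℝ (Fin m) =>
      (s.ofLp ⬝ᵥ u) * (s.ofLp ⬝ᵥ w) / updDenom μ A R s :=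
    ((continuous_dotProduct_left u).mul (continuous_dotProduct_left w)).div
      (continuous_updDenom μ A R) fun s => (hD s).ne'
  refine ((h.integral_dotProduct_mul u w).1.abs.div_const μ).mono' hc.aestronglyMeasurable
    (Filter.Eventually.of_forall fun s => ?_)
  rw [Real.norm_eq_abs, abs_div, abs_of_pos (hD s)]
  gcongr
  exact le_updDenom A hR s

theorem integrable_of_continuous_bounded {Ω : Type*} [TopologicalSpace Ω] [MeasurableSpace Ω]
    [OpensMeasurableSpace Ω] {P : Measure Ω} [IsFiniteMeasure P] {f : Ω → ℝ} (hf : Continuous f)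
    (C : ℝ) (hC : ∀ ω, |f ω| ≤ C) : Integrable f P :=
  Integrable.of_bound hf.measurable.aestronglyMeasurable C (Filter.Eventually.of_forall hC)

/-- The mean quadratic form `𝔼 ⟨x, R x⟩` of the regularized residual of `j` rows. -/
def meanResid (ν : Measure (EuclideanSpace ℝ (Fin m))) (A : Matrix (Fin m) (Fin n) ℝ) (μ : ℝ)
    (j : ℕ) (x : Fin n → ℝ) : ℝ :=
  ∫ s, x ⬝ᵥ regResid μ A s *ᵥ x ∂(sketchLaw ν j)

/-- The mean `𝔼 ‖A R x‖²` for the regularized residual `R` of `j` rows. -/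
def meanImage (ν : Measure (EuclideanSpace ℝ (Fin m))) (A : Matrix (Fin m) (Fin n) ℝ) (μ : ℝ)
    (j : ℕ) (x : Fin n → ℝ) : ℝ :=
  ∫ s, A *ᵥ (regResid μ A s *ᵥ x) ⬝ᵥ A *ᵥ (regResid μ A s *ᵥ x) ∂(sketchLaw ν j)

theorem integrable_resid {μ : ℝ} (hμ : 0 < μ) (j : ℕ) (x : Fin n → ℝ) :
    Integrable (fun s : Fin j → EuclideanSpace ℝ (Fin m) => x ⬝ᵥ regResid μ A s *ᵥ x)
      (sketchLaw ν j) := by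
  refine integrable_of_continuous_bounded ?_ (x ⬝ᵥ x) fun s => ?_
  · exact continuous_const.dotProduct ((continuous_regResid A hμ).matrix_mulVec continuous_const)
  · have hR := regResid_isPosContraction A hμ s
    rw [abs_of_nonneg (hR.nonneg x)]
    exact hR.le x

theorem continuous_image {μ : ℝ} (hμ : 0 < μ) (j : ℕ) (x : Fin n → ℝ) :
    Continuous fun s : Fin j → EuclideanSpace ℝ (Fin m) =>
      A *ᵥ (regResid μ A s *ᵥ x) ⬝ᵥ A *ᵥ (regResid μ A s *ᵥ x) := by
  have h : Continuous fun s : Fin j → EuclideanSpace ℝ (Fin m) => A *ᵥ (regResid μ A s *ᵥ x) :=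
    continuous_const.matrix_mulVec ((continuous_regResid A hμ).matrix_mulVec continuous_const)
  exact h.dotProduct h

theorem integrable_image {μ : ℝ} (hμ : 0 < μ) (j : ℕ) (x : Fin n → ℝ) :
    Integrable (fun s : Fin j → EuclideanSpace ℝ (Fin m) =>
      A *ᵥ (regResid μ A s *ᵥ x) ⬝ᵥ A *ᵥ (regResid μ A s *ᵥ x)) (sketchLaw ν j) := by
  refine integrable_of_continuous_bounded (continuous_image hμ j x)
    (opNorm A ^ 2 * (x ⬝ᵥ x)) fun s => ?_
  have hR := regResid_isPosContraction A hμ s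
  rw [abs_of_nonneg (dotProduct_self_nonneg' _)]
  exact (mulVec_self_le_opNorm A _).trans
    (mul_le_mul_of_nonneg_left (hR.mulVec_self_le_self x) (sq_nonneg _))

/-- Two-sided bound for the mean of `⟨s, w⟩² / D`. -/
theorem SketchHyp.integral_sq_div_mem (h : SketchHyp ν A K L θ) {R : Matrix (Fin n) (Fin n) ℝ}
    (hR : IsPosContraction R) (hE : frobSq A / 2 ≤ energy A R) (w : Fin m → ℝ) :
    ∫ s, (s.ofLp ⬝ᵥ w) ^ 2 / updDenom (θ * frobSq A) A R s ∂ν ∈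
      Set.Icc ((w ⬝ᵥ w) / (4 * frobSq A)) (3 * (w ⬝ᵥ w) / frobSq A) := by
  have key := h.integral_div_updDenom hR hE w w
  have hf := h.frob_pos
  have hw := dotProduct_self_nonneg' w
  rw [Real.mul_self_sqrt hw] at key
  simp only [← sq] at key
  set I := ∫ s, (s.ofLp ⬝ᵥ w) ^ 2 / updDenom (θ * frobSq A) A R s ∂ν with hI
  have hI0 : 0 ≤ I := integral_nonneg fun s =>
    div_nonneg (sq_nonneg _) (h.mu_pos.le.trans (le_updDenom A hR s))
  have hs : 150 * (K ^ 2 * θ) * (w ⬝ᵥ w) ≤ 1 / 2 * (w ⬝ᵥ w) := by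
    gcongr
    linarith [h.small]
  have hF1 : frobSq A / 2 ≤ θ * frobSq A + energy A R := by linarith [h.mu_pos]
  have hF2 : θ * frobSq A + energy A R ≤ 2 * frobSq A := by
    have := energy_le_frobSq A hR
    nlinarith [h.theta_le]
  rw [abs_le] at key
  constructor
  · rw [div_le_iff₀ (by positivity)]
    nlinarith
  · rw [le_div_iff₀ hf]
    nlinarith

/-- Adding a row to the sketch lowers the mean residual form by about `𝔼 ‖A R x‖² / ‖A‖_F²`. -/
theorem SketchHyp.meanResid_sub_mem (h : SketchHyp ν A K L θ) {j : ℕ}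
    (hj : 2 * (j * opNorm A ^ 2) ≤ frobSq A) (x : Fin n → ℝ) :
    meanResid ν A (θ * frobSq A) j x - meanResid ν A (θ * frobSq A) (j + 1) x ∈
      Set.Icc (meanImage ν A (θ * frobSq A) j x / (4 * frobSq A))
        (3 * meanImage ν A (θ * frobSq A) j x / frobSq A) := by
  have hμ := h.mu_pos
  set μ := θ * frobSq A with hμdef
  obtain ⟨h1, h2⟩ := integral_sketchLaw_succ ν (0 : Fin (j + 1))
    (integrable_resid (A := A) hμ (j + 1) x)
  have hinner : ∀ s : Fin j → EuclideanSpace ℝ (Fin m),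
      ∫ v, x ⬝ᵥ regResid μ A ((0 : Fin (j + 1)).insertNth v s :
        Fin (j + 1) → EuclideanSpace ℝ (Fin m)) *ᵥ x ∂ν = x ⬝ᵥ regResid μ A s *ᵥ x -
        ∫ v, (v.ofLp ⬝ᵥ A *ᵥ (regResid μ A s *ᵥ x)) ^ 2 / updDenom μ A (regResid μ A s) v ∂ν := by
    intro s
    have hi := h.isotropic.integrable_div_updDenom (A := A) hμ (regResid_isPosContraction A hμ s)
      (A *ᵥ (regResid μ A s *ᵥ x)) (A *ᵥ (regResid μ A s *ᵥ x))
    simp only [← sq] at hi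
    simp only [dotProduct_regResid_insertNth A hμ, sketchedRow_dotProduct]
    rw [integral_sub (integrable_const _) hi]
    simp
  have hE : ∀ s : Fin j → EuclideanSpace ℝ (Fin m), frobSq A / 2 ≤ energy A (regResid μ A s) :=
    fun s => le_trans (by linarith) (frobSq_sub_le_energy A hμ s)
  have hmem := fun s : Fin j → EuclideanSpace ℝ (Fin m) => h.integral_sq_div_mem
    (regResid_isPosContraction A hμ s) (hE s) (A *ᵥ (regResid μ A s *ᵥ x))
  have hi2 := h1.integral_prod_right
  have e1 : meanResid ν A μ j x - meanResid ν A μ (j + 1) x = ∫ s,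
      ∫ v, (v.ofLp ⬝ᵥ A *ᵥ (regResid μ A s *ᵥ x)) ^ 2 / updDenom μ A (regResid μ A s) v ∂ν
        ∂(sketchLaw ν j) := by
    rw [meanResid, meanResid, h2, ← integral_sub (integrable_resid hμ j x) hi2]
    refine integral_congr_ae (Filter.Eventually.of_forall fun s => ?_)
    simp only
    rw [hinner s]
    ring
  have hi3 : Integrable (fun s => ∫ v, (v.ofLp ⬝ᵥ A *ᵥ (regResid μ A s *ᵥ x)) ^ 2 /
      updDenom μ A (regResid μ A s) v ∂ν) (sketchLaw ν j) := by
    refine ((integrable_resid (A := A) hμ j x).sub hi2).congr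
      (Filter.Eventually.of_forall fun s => ?_)
    simp only [Pi.sub_apply]
    rw [hinner s]
    ring
  have hq := integrable_image (ν := ν) (A := A) hμ j x
  rw [e1]
  constructor
  · rw [meanImage, ← integral_div]
    exact integral_mono (hq.div_const _) hi3 fun s => (hmem s).1
  · rw [meanImage, ← integral_const_mul, ← integral_div]
    exact integral_mono hi3 ((hq.const_mul 3).div_const _) fun s => (hmem s).2

/-- Given the residual of the other rows, adding a row can raise the mean of `‖A R x‖²` only by a
factor `1 + O(1 / r)`: the cross term is nonpositive up to fluctuations of the denominator. -/
theorem SketchHyp.integral_image_insertNth_le (h : SketchHyp ν A K L θ) {j : ℕ}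
    (hj : 2 * (j * opNorm A ^ 2) ≤ frobSq A) (x : Fin n → ℝ)
    (s : Fin j → EuclideanSpace ℝ (Fin m)) {f : EuclideanSpace ℝ (Fin m) → ℝ}
    (hf : ∀ v, f v = A *ᵥ (regResid (θ * frobSq A) A ((0 : Fin (j + 1)).insertNth v s :
        Fin (j + 1) → EuclideanSpace ℝ (Fin m)) *ᵥ x) ⬝ᵥ
      A *ᵥ (regResid (θ * frobSq A) A ((0 : Fin (j + 1)).insertNth v s :
        Fin (j + 1) → EuclideanSpace ℝ (Fin m)) *ᵥ x)) (hfi : Integrable f ν) :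
    ∫ v, f v ∂ν ≤ (1 + 5 * (opNorm A ^ 2 / frobSq A)) *
      (A *ᵥ (regResid (θ * frobSq A) A s *ᵥ x) ⬝ᵥ A *ᵥ (regResid (θ * frobSq A) A s *ᵥ x)) := by
  have hμ := h.mu_pos
  set μ := θ * frobSq A with hμdef
  have hR := regResid_isPosContraction A hμ s
  have hE : frobSq A / 2 ≤ energy A (regResid μ A s) :=
    le_trans (by linarith) (frobSq_sub_le_energy A hμ s)
  simp only [regResid_insertNth_mulVec A hμ] at hf
  set R := regResid μ A s with hRdef
  set w := A *ᵥ (R *ᵥ x) with hw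
  set w' := A *ᵥ (R *ᵥ (Aᵀ *ᵥ w)) with hw'
  set α := opNorm A ^ 2 with hα
  have hα0 : 0 ≤ α := sq_nonneg _
  have hD : ∀ s, 0 < updDenom μ A R s := fun s => hμ.trans_le (le_updDenom A hR s)
  have hpt : ∀ v, f v ≤ w ⬝ᵥ w - 2 * ((v.ofLp ⬝ᵥ w) * (v.ofLp ⬝ᵥ w') / updDenom μ A R v) +
      α * ((v.ofLp ⬝ᵥ w) ^ 2 / updDenom μ A R v) := by
    intro v
    have e1 : w ⬝ᵥ A *ᵥ (R *ᵥ sketchedRow A v) = v.ofLp ⬝ᵥ w' := by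
      rw [dotProduct_comm, mulVec_dotProduct_mulVec, dotProduct_comm,
        dotProduct_mulVec_symm hR.symm, dotProduct_comm, sketchedRow_dotProduct]
    have h2 := mulVec_resid_row_le A hR hμ v
    rw [hf v, sketchedRow_dotProduct, Matrix.mulVec_sub, Matrix.mulVec_smul, ← hw,
      sub_dotProduct_sub_self, dotProduct_smul, dotProduct_smul, smul_dotProduct, e1]
    simp only [smul_eq_mul]
    set g := v.ofLp ⬝ᵥ w
    set D := updDenom μ A R v
    have hDv : 0 < D := hD v
    have h3 : g / D * (g / D * (A *ᵥ (R *ᵥ sketchedRow A v) ⬝ᵥ A *ᵥ (R *ᵥ sketchedRow A v))) ≤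
        α * (g ^ 2 / D) := by
      calc _ = (g / D) ^ 2 *
            (A *ᵥ (R *ᵥ sketchedRow A v) ⬝ᵥ A *ᵥ (R *ᵥ sketchedRow A v)) := by ring
        _ ≤ (g / D) ^ 2 * (α * D) := by gcongr
        _ = α * (g ^ 2 / D) := by field_simp
    have h4 : g / D * (v.ofLp ⬝ᵥ w') = g * (v.ofLp ⬝ᵥ w') / D := by ring
    rw [h4]
    linarith
  have hi1 := h.isotropic.integrable_div_updDenom (A := A) hμ hR w w'
  have hi2 := h.isotropic.integrable_div_updDenom (A := A) hμ hR w w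
  simp only [← sq] at hi2
  have hi12 : Integrable (fun v : EuclideanSpace ℝ (Fin m) => w ⬝ᵥ w -
      2 * ((v.ofLp ⬝ᵥ w) * (v.ofLp ⬝ᵥ w') / updDenom μ A R v)) ν :=
    (integrable_const _).sub (hi1.const_mul 2)
  have hle : ∫ v, f v ∂ν ≤ w ⬝ᵥ w -
      2 * ∫ v, (v.ofLp ⬝ᵥ w) * (v.ofLp ⬝ᵥ w') / updDenom μ A R v ∂ν +
      α * ∫ v, (v.ofLp ⬝ᵥ w) ^ 2 / updDenom μ A R v ∂ν := by
    refine (integral_mono hfi (hi12.add (hi2.const_mul α)) hpt).trans_eq ?_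
    rw [integral_add' hi12 (hi2.const_mul α), integral_sub (integrable_const _) (hi1.const_mul 2),
      integral_const_mul, integral_const_mul]
    simp
  have hfp := h.frob_pos
  have hww := dotProduct_self_nonneg' w
  have hk2 := (h.integral_sq_div_mem hR hE w).2
  have hk1 := h.integral_div_updDenom hR hE w w'
  rw [← hμdef] at hk1 hk2
  set I1 := ∫ v, (v.ofLp ⬝ᵥ w) * (v.ofLp ⬝ᵥ w') / updDenom μ A R v ∂ν
  set I2 := ∫ v, (v.ofLp ⬝ᵥ w) ^ 2 / updDenom μ A R v ∂ν
  -- With the denominator replaced by its mean, the cross term has a nonnegative expectation.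
  have hpos : 0 ≤ w ⬝ᵥ w' := by
    rw [hw', dotProduct_comm, mulVec_dotProduct_mulVec, dotProduct_comm]
    exact hR.nonneg _
  have hw'le : √(w' ⬝ᵥ w') ≤ α * √(w ⬝ᵥ w) := by
    have : w' ⬝ᵥ w' ≤ α ^ 2 * (w ⬝ᵥ w) := by
      calc w' ⬝ᵥ w' ≤ α * (R *ᵥ (Aᵀ *ᵥ w) ⬝ᵥ R *ᵥ (Aᵀ *ᵥ w)) := mulVec_self_le_opNorm A _
        _ ≤ α * (Aᵀ *ᵥ w ⬝ᵥ Aᵀ *ᵥ w) := by gcongr; exact hR.mulVec_self_le_self _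
        _ ≤ α * (α * (w ⬝ᵥ w)) := by gcongr; exact transpose_mulVec_self_le_opNorm A w
        _ = _ := by ring
    calc √(w' ⬝ᵥ w') ≤ √(α ^ 2 * (w ⬝ᵥ w)) := Real.sqrt_le_sqrt this
      _ = α * √(w ⬝ᵥ w) := by rw [Real.sqrt_mul (by positivity), Real.sqrt_sq hα0]
  have hF1 : frobSq A / 2 ≤ μ + energy A R := by linarith
  have hk3 : -(1 / 2 * (α * (w ⬝ᵥ w))) ≤ (μ + energy A R) * I1 := by
    have h1 := (abs_le.mp hk1).1
    have h2 : √(w ⬝ᵥ w) * √(w' ⬝ᵥ w') ≤ α * (w ⬝ᵥ w) := by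
      calc √(w ⬝ᵥ w) * √(w' ⬝ᵥ w') ≤ √(w ⬝ᵥ w) * (α * √(w ⬝ᵥ w)) := by gcongr
        _ = α * (√(w ⬝ᵥ w) * √(w ⬝ᵥ w)) := by ring
        _ = α * (w ⬝ᵥ w) := by rw [Real.mul_self_sqrt hww]
    have h3 : 150 * (K ^ 2 * θ) * (√(w ⬝ᵥ w) * √(w' ⬝ᵥ w')) ≤ 1 / 2 * (α * (w ⬝ᵥ w)) := by
      gcongr
      linarith [h.small]
    linarith
  have hk4 : -(α * (w ⬝ᵥ w) / frobSq A) ≤ I1 := by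
    by_contra hlt
    push Not at hlt
    have hp : 0 ≤ α * (w ⬝ᵥ w) / frobSq A := by positivity
    have e2 : α * (w ⬝ᵥ w) = frobSq A * (α * (w ⬝ᵥ w) / frobSq A) := by field_simp
    rw [e2] at hk3
    nlinarith
  have hk5 : α * I2 ≤ 3 * (α * (w ⬝ᵥ w) / frobSq A) := by
    calc α * I2 ≤ α * (3 * (w ⬝ᵥ w) / frobSq A) := by gcongr
      _ = _ := by ring
  have e3 : (1 + 5 * (α / frobSq A)) * (w ⬝ᵥ w) =
    w ⬝ᵥ w + 5 * (α * (w ⬝ᵥ w) / frobSq A) := by ring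
  rw [e3]
  linarith

theorem SketchHyp.meanImage_succ_le (h : SketchHyp ν A K L θ) {j : ℕ}
    (hj : 2 * (j * opNorm A ^ 2) ≤ frobSq A) (x : Fin n → ℝ) :
    meanImage ν A (θ * frobSq A) (j + 1) x ≤ (1 + 5 * (opNorm A ^ 2 / frobSq A)) *
      meanImage ν A (θ * frobSq A) j x := by
  have hμ := h.mu_pos
  obtain ⟨h1, h2⟩ := integral_sketchLaw_succ ν (0 : Fin (j + 1))
    (integrable_image (A := A) hμ (j + 1) x)
  rw [meanImage, meanImage, h2, ← integral_const_mul]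
  refine integral_mono_ae h1.integral_prod_right ((integrable_image hμ j x).const_mul _) ?_
  filter_upwards [h1.prod_left_ae] with s hs
  exact h.integral_image_insertNth_le hj x s (fun v => rfl) hs

theorem meanImage_nonneg {ν : Measure (EuclideanSpace ℝ (Fin m))} (μ : ℝ) (j : ℕ)
    (x : Fin n → ℝ) : 0 ≤ meanImage ν A μ j x :=
  integral_nonneg fun _ => dotProduct_self_nonneg' _

theorem two_mul_mul_le {j k : ℕ} (hjk : j ≤ k) {α f : ℝ} (hα : 0 ≤ α)
    (hk : 100 * (k * α) ≤ f) : 2 * (j * α) ≤ f := by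
  have h1 : (j : ℝ) * α ≤ k * α := by gcongr
  have h2 : 0 ≤ (k : ℝ) * α := by positivity
  linarith

/-- Over `k ≤ r / 100` steps the mean of `‖A R x‖²` at most doubles. -/
theorem SketchHyp.meanImage_le_two_mul (h : SketchHyp ν A K L θ) {k : ℕ}
    (hk : 100 * (k * opNorm A ^ 2) ≤ frobSq A) (x : Fin n → ℝ) {i j : ℕ} (hij : i ≤ j)
    (hjk : j ≤ k) :
    meanImage ν A (θ * frobSq A) j x ≤ 2 * meanImage ν A (θ * frobSq A) i x := by
  have hf := h.frob_pos
  set ρ := opNorm A ^ 2 / frobSq A with hρ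
  have hρ0 : 0 ≤ ρ := by positivity
  have hkρ : 100 * (k * ρ) ≤ 1 := by
    rw [hρ, ← mul_div_assoc, ← mul_div_assoc, div_le_one hf]
    exact hk
  have step : ∀ d : ℕ, i + d ≤ k → meanImage ν A (θ * frobSq A) (i + d) x ≤
      (1 + 5 * ρ) ^ d * meanImage ν A (θ * frobSq A) i x := by
    intro d
    induction d with
    | zero => intro _; simp
    | succ d ih =>
      intro hd
      have h1 := ih (by omega)
      have h2 := h.meanImage_succ_le (j := i + d)
        (two_mul_mul_le (by omega) (sq_nonneg _) hk) x
      rw [← add_assoc, pow_succ']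
      calc _ ≤ _ := h2
        _ ≤ (1 + 5 * ρ) * ((1 + 5 * ρ) ^ d * meanImage ν A (θ * frobSq A) i x) := by gcongr
        _ = _ := by ring
  obtain ⟨d, rfl⟩ := Nat.exists_eq_add_of_le hij
  refine (step d hjk).trans (mul_le_mul_of_nonneg_right ?_ (meanImage_nonneg _ _ _))
  have hdk : (d : ℝ) ≤ k := by exact_mod_cast (by omega : d ≤ k)
  calc (1 + 5 * ρ) ^ d ≤ Real.exp (5 * ρ) ^ d := by
        gcongr
        linarith [Real.add_one_le_exp (5 * ρ)]
    _ = Real.exp (d * (5 * ρ)) := by rw [← Real.exp_nat_mul]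
    _ ≤ Real.exp (1 / 2) := by
        apply Real.exp_le_exp.mpr
        nlinarith
    _ ≤ 2 := by
        have h1 : Real.exp (1 / 2) ^ 2 ≤ 2 ^ 2 := by
          rw [← Real.exp_nat_mul]
          have := Real.exp_one_lt_d9
          norm_num
          linarith
        exact (pow_le_pow_iff_left₀ (Real.exp_pos _).le (by norm_num) (by norm_num)).mp h1

theorem meanResid_zero {μ : ℝ} (hμ : 0 < μ) (x : Fin n → ℝ) :
    meanResid ν A μ 0 x = x ⬝ᵥ x := by
  simp [meanResid, regResid_zero hμ]

theorem meanImage_zero {μ : ℝ} (hμ : 0 < μ) (x : Fin n → ℝ) :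
    meanImage ν A μ 0 x = A *ᵥ x ⬝ᵥ A *ᵥ x := by
  simp [meanImage, regResid_zero hμ]

/-- An upper bound for the mean regularized projection, by summing the increments of the rows. -/
theorem SketchHyp.sub_meanResid_le (h : SketchHyp ν A K L θ) {k : ℕ}
    (hk : 100 * (k * opNorm A ^ 2) ≤ frobSq A) (x : Fin n → ℝ) :
    x ⬝ᵥ x - meanResid ν A (θ * frobSq A) k x ≤ k * (6 * (A *ᵥ x ⬝ᵥ A *ᵥ x) / frobSq A) := by
  have hf := h.frob_pos
  rw [← meanResid_zero (ν := ν) (A := A) h.mu_pos x,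
    ← Finset.sum_range_sub' (fun j => meanResid ν A (θ * frobSq A) j x)]
  calc _ ≤ ∑ _i ∈ Finset.range k, 6 * (A *ᵥ x ⬝ᵥ A *ᵥ x) / frobSq A := by
        refine Finset.sum_le_sum fun j hj => ?_
        have hjk : j ≤ k := (Finset.mem_range.mp hj).le
        have h1 := (h.meanResid_sub_mem (two_mul_mul_le hjk (sq_nonneg _) hk) x).2
        refine h1.trans ?_
        have h2 := h.meanImage_le_two_mul hk x (Nat.zero_le j) hjk
        rw [meanImage_zero h.mu_pos] at h2
        rw [div_le_div_iff_of_pos_right hf]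
        linarith
    _ = _ := by simp

/-- A lower bound in terms of the final `𝔼 ‖A R x‖²`, which is at most twice each earlier one. -/
theorem SketchHyp.le_sub_meanResid (h : SketchHyp ν A K L θ) {k : ℕ}
    (hk : 100 * (k * opNorm A ^ 2) ≤ frobSq A) (x : Fin n → ℝ) :
    (k + 1) * (meanImage ν A (θ * frobSq A) k x / (8 * frobSq A)) ≤
      x ⬝ᵥ x - meanResid ν A (θ * frobSq A) (k + 1) x := by
  have hf := h.frob_pos
  rw [← meanResid_zero (ν := ν) (A := A) h.mu_pos x,
    ← Finset.sum_range_sub' (fun j => meanResid ν A (θ * frobSq A) j x)]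
  calc _ = ∑ _i ∈ Finset.range (k + 1), meanImage ν A (θ * frobSq A) k x / (8 * frobSq A) := by
        simp
    _ ≤ _ := by
        refine Finset.sum_le_sum fun j hj => ?_
        have hjk : j ≤ k := Nat.lt_succ_iff.mp (Finset.mem_range.mp hj)
        have h1 := (h.meanResid_sub_mem (two_mul_mul_le hjk (sq_nonneg _) hk) x).1
        refine le_trans ?_ h1
        have h2 := h.meanImage_le_two_mul hk x hjk le_rfl
        rw [div_le_div_iff₀ (by positivity) (by positivity)]
        nlinarith

end Recursion

/-! ### Fluctuation and bias of the residual energy -/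

section Variance

variable {m : ℕ} {ν : Measure (EuclideanSpace ℝ (Fin m))} [IsProbabilityMeasure ν]

/-- A bounded-differences variance bound in the style of Efron and Stein: a function of `j`
independent rows that changes by at most `c` when one row is replaced has variance at most
`j c²`. -/
theorem integral_sub_integral_sq_le {c C : ℝ} (hc : 0 ≤ c) :
    ∀ (j : ℕ) (f : (Fin j → EuclideanSpace ℝ (Fin m)) → ℝ), Measurable f → (∀ s, |f s| ≤ C) →
      (∀ s i v, |f (Function.update s i v) - f s| ≤ c) →
      ∫ s, (f s - ∫ s', f s' ∂(sketchLaw ν j)) ^ 2 ∂(sketchLaw ν j) ≤ j * c ^ 2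
  | 0, f, _, _, _ => by
    have e : ∀ s : Fin 0 → EuclideanSpace ℝ (Fin m), f s = f default := fun s =>
      congrArg f (Subsingleton.elim _ _)
    simp_rw [e]
    simp
  | j + 1, f, hf, hfC, hfc => by
    have hbdd : ∀ {Ω : Type} [MeasurableSpace Ω] (P : Measure Ω) [IsProbabilityMeasure P]
        (g : Ω → ℝ) (D : ℝ), Measurable g → (∀ ω, |g ω| ≤ D) → Integrable g P :=
      fun P _ g D hg hD =>
        Integrable.of_bound hg.aestronglyMeasurable D (Filter.Eventually.of_forall hD)
    have hmp := measurePreserving_insertNth ν (0 : Fin (j + 1))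
    have hF : Measurable fun p : EuclideanSpace ℝ (Fin m) × (Fin j → EuclideanSpace ℝ (Fin m)) =>
        f ((0 : Fin (j + 1)).insertNth p.1 p.2) := hf.comp hmp.measurable
    have hFs : ∀ s : Fin j → EuclideanSpace ℝ (Fin m), Measurable fun v =>
        f ((0 : Fin (j + 1)).insertNth v s) := fun s => hF.comp measurable_prodMk_right
    have hFi : ∀ s : Fin j → EuclideanSpace ℝ (Fin m), Integrable (fun v =>
        f ((0 : Fin (j + 1)).insertNth v s)) ν := fun s => hbdd ν _ C (hFs s) fun v => hfC _
    set g : (Fin j → EuclideanSpace ℝ (Fin m)) → ℝ :=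
      fun s => ∫ v, f ((0 : Fin (j + 1)).insertNth v s) ∂ν with hg
    have hgm : Measurable g := by
      have := hF.stronglyMeasurable.integral_prod_left' (μ := ν)
      exact this.measurable
    have hgC : ∀ s, |g s| ≤ C := by
      intro s
      calc |g s| ≤ ∫ v, |f ((0 : Fin (j + 1)).insertNth v s)| ∂ν := abs_integral_le_integral_abs
        _ ≤ ∫ _v, C ∂ν := integral_mono (hFi s).abs (integrable_const _) fun v => hfC _
        _ = C := by simp
    have hgc : ∀ s i v, |g (Function.update s i v) - g s| ≤ c := by
      intro s i v
      rw [hg]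
      simp only
      rw [← integral_sub (hFi _) (hFi _)]
      calc _ ≤ ∫ w, |f ((0 : Fin (j + 1)).insertNth w (Function.update s i v)) -
            f ((0 : Fin (j + 1)).insertNth w s)| ∂ν := abs_integral_le_integral_abs
        _ ≤ ∫ _w, c ∂ν := by
          refine integral_mono ((hFi _).sub (hFi _)).abs (integrable_const _) fun w => ?_
          have := hfc ((0 : Fin (j + 1)).insertNth w s) i.succ v
          simp only [Fin.insertNth_zero', ← Fin.cons_update] at this ⊢
          exact this
        _ = c := by simp
    have hfg : ∀ v s, |f ((0 : Fin (j + 1)).insertNth v s) - g s| ≤ c := by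
      intro v s
      have e : f ((0 : Fin (j + 1)).insertNth v s) - g s =
          ∫ w, (f ((0 : Fin (j + 1)).insertNth v s) - f ((0 : Fin (j + 1)).insertNth w s)) ∂ν := by
        rw [integral_sub (integrable_const _) (hFi s)]
        simp [hg]
      rw [e]
      calc _ ≤ ∫ w, |f ((0 : Fin (j + 1)).insertNth v s) -
            f ((0 : Fin (j + 1)).insertNth w s)| ∂ν := abs_integral_le_integral_abs
        _ ≤ ∫ _w, c ∂ν := by
          refine integral_mono ((integrable_const _).sub (hFi s)).abs (integrable_const _)
            fun w => ?_
          have := hfc ((0 : Fin (j + 1)).insertNth w s) 0 v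
          simpa only [Fin.insertNth_zero', Fin.update_cons_zero] using this
        _ = c := by simp
    have hmean : ∫ s, f s ∂(sketchLaw ν (j + 1)) = ∫ s, g s ∂(sketchLaw ν j) :=
      (integral_sketchLaw_succ ν 0 (hbdd _ f C hf hfC)).2
    -- The conditional mean `g` given the last `j` rows inherits the bounded differences.
    have hih := integral_sub_integral_sq_le hc j g hgm hgC hgc
    rw [hmean]
    set M := ∫ s, g s ∂(sketchLaw ν j) with hM
    have hMC : |M| ≤ C := by
      calc |M| ≤ ∫ s, |g s| ∂(sketchLaw ν j) := abs_integral_le_integral_abs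
        _ ≤ ∫ _s, C ∂(sketchLaw ν j) :=
          integral_mono (hbdd _ g C hgm hgC).abs (integrable_const _) hgC
        _ = C := by simp
    have hsq : ∀ a : ℝ, |a| ≤ C → |(a - M) ^ 2| ≤ (2 * C) ^ 2 := by
      intro a ha
      rw [abs_pow]
      refine pow_le_pow_left₀ (abs_nonneg _) ?_ 2
      calc |a - M| ≤ |a| + |M| := abs_sub _ _
        _ ≤ 2 * C := by linarith
    have hfi2 : Integrable (fun s => (f s - M) ^ 2) (sketchLaw ν (j + 1)) :=
      hbdd _ _ ((2 * C) ^ 2) ((hf.sub_const M).pow_const 2) fun s => hsq _ (hfC s)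
    have hgi2 : Integrable (fun s => (g s - M) ^ 2) (sketchLaw ν j) :=
      hbdd _ _ ((2 * C) ^ 2) ((hgm.sub_const M).pow_const 2) fun s => hsq _ (hgC s)
    obtain ⟨h1, h2⟩ := integral_sketchLaw_succ ν 0 hfi2
    rw [h2]
    have hin : ∀ s, ∫ v, (f ((0 : Fin (j + 1)).insertNth v s) - M) ^ 2 ∂ν ≤
        c ^ 2 + (g s - M) ^ 2 := by
      intro s
      have hd : Integrable (fun v => f ((0 : Fin (j + 1)).insertNth v s) - g s) ν :=
        (hFi s).sub (integrable_const _)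
      have hi : Integrable (fun v => c ^ 2 + (g s - M) ^ 2 + 2 * (g s - M) *
          (f ((0 : Fin (j + 1)).insertNth v s) - g s)) ν :=
        (integrable_const _).add (hd.const_mul _)
      have hi2 : Integrable (fun v => (f ((0 : Fin (j + 1)).insertNth v s) - M) ^ 2) ν :=
        hbdd _ _ ((2 * C) ^ 2) (((hFs s).sub_const M).pow_const 2) fun v => hsq _ (hfC _)
      refine (integral_mono hi2 hi fun v => ?_).trans_eq ?_
      · have h3 : (f ((0 : Fin (j + 1)).insertNth v s) - g s) ^ 2 ≤ c ^ 2 :=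
          sq_le_sq' (abs_le.mp (hfg v s)).1 (abs_le.mp (hfg v s)).2
        simp only
        nlinarith
      · rw [integral_add (integrable_const _) (hd.const_mul _),
          integral_const_mul, integral_sub (hFi s) (integrable_const _)]
        simp [hg]
    calc _ ≤ ∫ s, (c ^ 2 + (g s - M) ^ 2) ∂(sketchLaw ν j) :=
          integral_mono h1.integral_prod_right ((integrable_const _).add hgi2) hin
      _ = c ^ 2 + ∫ s, (g s - M) ^ 2 ∂(sketchLaw ν j) := by
          rw [integral_add (integrable_const _) hgi2]
          simp
      _ ≤ c ^ 2 + j * c ^ 2 := by linarith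
      _ = ((j + 1 : ℕ) : ℝ) * c ^ 2 := by push_cast; ring

end Variance

section Energy

variable {m n : ℕ} {ν : Measure (EuclideanSpace ℝ (Fin m))} [IsProbabilityMeasure ν]
  {A : Matrix (Fin m) (Fin n) ℝ} {K L θ μ : ℝ}

theorem continuous_energy_regResid (hμ : 0 < μ) (j : ℕ) :
    Continuous fun s : Fin j → EuclideanSpace ℝ (Fin m) => energy A (regResid μ A s) := by
  unfold energy
  exact ((continuous_const.matrix_mul (continuous_regResid A hμ)).matrix_mul
    continuous_const).matrix_trace

theorem abs_energy_regResid_le (hμ : 0 < μ) {j : ℕ} (s : Fin j → EuclideanSpace ℝ (Fin m)) :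
    |energy A (regResid μ A s)| ≤ frobSq A := by
  have hR := regResid_isPosContraction A hμ s
  rw [abs_of_nonneg (energy_nonneg A hR.symm hR.nonneg)]
  exact energy_le_frobSq A hR

theorem integrable_energy (hμ : 0 < μ) (j : ℕ) :
    Integrable (fun s : Fin j → EuclideanSpace ℝ (Fin m) => energy A (regResid μ A s))
      (sketchLaw ν j) :=
  integrable_of_continuous_bounded (continuous_energy_regResid hμ j) (frobSq A)
    (abs_energy_regResid_le hμ)

/-- The mean residual energy of the regularized problem. -/
def meanEnergy (ν : Measure (EuclideanSpace ℝ (Fin m))) (A : Matrix (Fin m) (Fin n) ℝ) (μ : ℝ)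
    (j : ℕ) : ℝ :=
  ∫ s, energy A (regResid μ A s) ∂(sketchLaw ν j)

/-- Replacing one row of the sketch changes the residual energy by at most `‖A‖²`, as the energy is
within `‖A‖²` of the energy without that row in both cases. -/
theorem integral_energy_sub_sq_le (hμ : 0 < μ) (j : ℕ) :
    ∫ s, (energy A (regResid μ A s) - meanEnergy ν A μ j) ^ 2 ∂(sketchLaw ν j) ≤
      j * (opNorm A ^ 2) ^ 2 := by
  refine integral_sub_integral_sq_le (C := frobSq A) (sq_nonneg _) j _
    (continuous_energy_regResid hμ j).measurable (abs_energy_regResid_le hμ) ?_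
  cases j with
  | zero => exact fun s i => i.elim0
  | succ j =>
    intro s i v
    have h1 := energy_insertNth_mem A hμ i v (i.removeNth s)
    have h2 := energy_insertNth_mem A hμ i (s i) (i.removeNth s)
    rw [Fin.insertNth_removeNth] at h1
    rw [Fin.insertNth_self_removeNth] at h2
    rw [abs_le]
    constructor <;> linarith [h1.1, h1.2, h2.1, h2.2]

theorem frobSq_residual_le {k : ℕ} (S : Matrix (Fin k) (Fin m) ℝ) :
    frobSq (A * (1 - sketchProj S A)) ≤ frobSq A := by
  rw [frobSq_mul_one_sub_sketchProj, energy_sub, energy_one]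
  have hP := sketchProj_isPosContraction S A
  linarith [energy_nonneg A hP.symm hP.nonneg]

theorem integrable_frobSq_residual (j : ℕ) :
    Integrable (fun s => frobSq (A * (1 - sketchProj (rowMatrix s) A))) (sketchLaw ν j) := by
  refine Integrable.of_bound (Measurable.aestronglyMeasurable ?_) (frobSq A)
    (Filter.Eventually.of_forall fun s => ?_)
  · have hm := measurable_sketchProj_apply (j := j) A
    simp only [frobSq, Matrix.mul_apply, Matrix.sub_apply]
    fun_prop
  · rw [Real.norm_eq_abs, abs_of_nonneg (frobSq_nonneg _)]
    exact frobSq_residual_le _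

/-- Splitting one row off an integrable function of that row and of the remaining ones. -/
theorem integral_removeNth {j : ℕ} (i : Fin (j + 1))
    {g : EuclideanSpace ℝ (Fin m) × (Fin j → EuclideanSpace ℝ (Fin m)) → ℝ}
    (hg : Integrable g (ν.prod (sketchLaw ν j))) :
    Integrable (fun s => g (s i, i.removeNth s)) (sketchLaw ν (j + 1)) ∧
    ∫ s, g (s i, i.removeNth s) ∂(sketchLaw ν (j + 1)) =
      ∫ s, ∫ v, g (v, s) ∂ν ∂(sketchLaw ν j) := by
  have hmp : MeasurePreserving (fun s : Fin (j + 1) → EuclideanSpace ℝ (Fin m) =>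
      (s i, i.removeNth s)) (sketchLaw ν (j + 1)) (ν.prod (sketchLaw ν j)) :=
    measurePreserving_piFinSuccAbove (fun _ : Fin (j + 1) => ν) i
  refine ⟨(hmp.integrable_comp hg.aestronglyMeasurable).2 hg, ?_⟩
  rw [← integral_prod_symm _ hg]
  have hg' := hg.aestronglyMeasurable
  rw [← hmp.map_eq] at hg' ⊢
  exact (integral_map hmp.measurable.aemeasurable hg').symm

theorem continuous_updDenom_regResid (hμ : 0 < μ) (j : ℕ) :
    Continuous fun p : EuclideanSpace ℝ (Fin m) × (Fin j → EuclideanSpace ℝ (Fin m)) =>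
      updDenom μ A (regResid μ A p.2) p.1 := by
  have h1 : Continuous fun p : EuclideanSpace ℝ (Fin m) × (Fin j → EuclideanSpace ℝ (Fin m)) =>
    sketchedRow A p.1 := (continuous_sketchedRow A).comp continuous_fst
  have h2 : Continuous fun p : EuclideanSpace ℝ (Fin m) × (Fin j → EuclideanSpace ℝ (Fin m)) =>
    regResid μ A p.2 := (continuous_regResid A hμ).comp continuous_snd
  unfold updDenom
  exact continuous_const.add (h1.dotProduct (h2.matrix_mulVec h1))

/-- The regularization changes the mean residual energy only by a relative amount `O(θ)`. -/
theorem SketchHyp.meanEnergy_le (h : SketchHyp ν A K L θ) {j : ℕ}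
    (hj : 100 * (j * opNorm A ^ 2) ≤ frobSq A) :
    meanEnergy ν A (θ * frobSq A) j ≤ svdErr ν A j + θ * frobSq A := by
  have hμ := h.mu_pos
  set μ := θ * frobSq A with hμdef
  -- The mean trace of `I - R` falls short of `j` by at most `4 θ j`.
  have htr : Integrable (fun s : Fin j → EuclideanSpace ℝ (Fin m) =>
      (j : ℝ) - (1 - regResid μ A s).trace) (sketchLaw ν j) ∧
      ∫ s, ((j : ℝ) - (1 - regResid μ A s).trace) ∂(sketchLaw ν j) ≤ j * (4 * θ) := by
    cases j with
    | zero => simp [regResid_zero hμ]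
    | succ j =>
      have hj2 := two_mul_mul_le j.le_succ (sq_nonneg (opNorm A)) hj
      set g : EuclideanSpace ℝ (Fin m) × (Fin j → EuclideanSpace ℝ (Fin m)) → ℝ :=
        fun p => μ / updDenom μ A (regResid μ A p.2) p.1 with hg
      have hD : ∀ p : EuclideanSpace ℝ (Fin m) × (Fin j → EuclideanSpace ℝ (Fin m)),
          μ ≤ updDenom μ A (regResid μ A p.2) p.1 := fun p =>
        le_updDenom A (regResid_isPosContraction A hμ p.2) p.1
      have hgi : Integrable g (ν.prod (sketchLaw ν j)) := by
        refine integrable_of_continuous_bounded (continuous_const.div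
          (continuous_updDenom_regResid hμ j) fun p => (hμ.trans_le (hD p)).ne') 1 fun p => ?_
        rw [abs_of_nonneg (div_nonneg hμ.le (hμ.trans_le (hD p)).le)]
        exact div_le_one_of_le₀ (hD p) (hμ.trans_le (hD p)).le
      have e : ∀ s : Fin (j + 1) → EuclideanSpace ℝ (Fin m),
          ((j + 1 : ℕ) : ℝ) - (1 - regResid μ A s).trace = ∑ i, g (s i, i.removeNth s) := by
        intro s
        rw [trace_one_sub_regResid A hμ, Finset.sum_sub_distrib]
        simp [hg]
      have hin : ∀ s, ∫ v, g (v, s) ∂ν ≤ 4 * θ := by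
        intro s
        have hE : frobSq A / 2 ≤ energy A (regResid μ A s) :=
          le_trans (by linarith) (frobSq_sub_le_energy A hμ s)
        have := h.integral_inv_updDenom_le (regResid_isPosContraction A hμ s) hE
        rw [← hμdef] at this
        simpa only [hg] using this
      clear_value g
      have hsplit := fun i : Fin (j + 1) => integral_removeNth (ν := ν) i hgi
      simp only [e]
      refine ⟨integrable_finsetSum _ fun i _ => (hsplit i).1, ?_⟩
      rw [integral_finsetSum _ fun i _ => (hsplit i).1]
      calc _ ≤ ∑ _i : Fin (j + 1), 4 * θ := by
            refine Finset.sum_le_sum fun i _ => ?_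
            rw [(hsplit i).2]
            calc _ ≤ ∫ _s, 4 * θ ∂(sketchLaw ν j) :=
                  integral_mono hgi.integral_prod_right (integrable_const _) hin
              _ = 4 * θ := by simp
        _ = _ := by simp
  have hF := integrable_frobSq_residual (ν := ν) (A := A) j
  have h1 : meanEnergy ν A μ j ≤ svdErr ν A j +
      opNorm A ^ 2 * ∫ s, ((j : ℝ) - (1 - regResid μ A s).trace) ∂(sketchLaw ν j) := by
    rw [meanEnergy, svdErr, ← integral_const_mul, ← integral_add hF (htr.1.const_mul _)]
    exact integral_mono (integrable_energy hμ j) (hF.add (htr.1.const_mul _))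
      fun s => energy_regResid_le A hμ s
  have h2 : opNorm A ^ 2 * ∫ s, ((j : ℝ) - (1 - regResid μ A s).trace) ∂(sketchLaw ν j) ≤
      opNorm A ^ 2 * (j * (4 * θ)) := by
    gcongr
    exact htr.2
  have h3 : opNorm A ^ 2 * (j * (4 * θ)) ≤ μ := by
    have : opNorm A ^ 2 * (j * (4 * θ)) = 4 * θ * (j * opNorm A ^ 2) := by ring
    rw [this, hμdef]
    nlinarith [h.theta_pos, h.frob_pos]
  linarith

end Energy

/-! ### The leave-one-out formula in expectation -/

/-- A real symmetric matrix has a unit eigenvector at which its quadratic form is maximal. -/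
theorem exists_unit_eigenvector_max {n : ℕ} (hn : 0 < n) {N : Matrix (Fin n) (Fin n) ℝ}
    (hN : Nᵀ = N) : ∃ (x : Fin n → ℝ) (ρ : ℝ), x ⬝ᵥ x = 1 ∧ N *ᵥ x = ρ • x ∧
      ∀ y, y ⬝ᵥ N *ᵥ y ≤ ρ * (y ⬝ᵥ y) := by
  have hH : N.IsHermitian := by
    simpa [Matrix.IsHermitian, Matrix.conjTranspose_eq_transpose_of_trivial] using hN
  have : Nonempty (Fin n) := ⟨⟨0, hn⟩⟩
  obtain ⟨i, hi⟩ := Finite.exists_max hH.eigenvalues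
  refine ⟨(hH.eigenvectorBasis i).ofLp, hH.eigenvalues i, ?_, ?_, fun y => ?_⟩
  · rw [← norm_sq_eq_dotProduct, hH.eigenvectorBasis.orthonormal.1 i, one_pow]
  · exact hH.mulVec_eigenvectorBasis i
  · set U : Matrix (Fin n) (Fin n) ℝ := (hH.eigenvectorUnitary : Matrix (Fin n) (Fin n) ℝ) with hU
    set d := hH.eigenvalues with hd
    have hUU : U * Uᵀ = 1 := by
      have := Unitary.coe_mul_star_self hH.eigenvectorUnitary
      simpa [Matrix.star_eq_conjTranspose] using this
    have hsp : N = U * Matrix.diagonal d * Uᵀ := by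
      have := hH.spectral_theorem
      rw [Unitary.conjStarAlgAut_apply] at this
      simpa [Matrix.star_eq_conjTranspose, Function.comp_def] using this
    set z := Uᵀ *ᵥ y with hz
    have e1 : y ⬝ᵥ N *ᵥ y = ∑ l, d l * (z l * z l) := by
      rw [hsp, ← Matrix.mulVec_mulVec, ← Matrix.mulVec_mulVec, ← hz, dotProduct_comm,
        mulVec_dotProduct_mulVec, ← hz]
      simp only [dotProduct, Matrix.mulVec_diagonal]
      exact Finset.sum_congr rfl fun l _ => by ring
    have e2 : y ⬝ᵥ y = ∑ l, z l * z l := by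
      change _ = z ⬝ᵥ z
      rw [hz, mulVec_dotProduct_mulVec, Matrix.transpose_transpose, Matrix.mulVec_mulVec, hUU,
        Matrix.one_mulVec]
    rw [e1, e2, Finset.mul_sum]
    exact Finset.sum_le_sum fun l _ => mul_le_mul_of_nonneg_right (hi l) (mul_self_nonneg _)

section Spectral

variable {m n : ℕ} {ν : Measure (EuclideanSpace ℝ (Fin m))} [IsProbabilityMeasure ν]
  {A : Matrix (Fin m) (Fin n) ℝ} {K L θ μ : ℝ}

/-- The entrywise mean of the regularized residual. -/
def meanResidMatrix (ν : Measure (EuclideanSpace ℝ (Fin m))) (A : Matrix (Fin m) (Fin n) ℝ)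
    (μ : ℝ) (j : ℕ) : Matrix (Fin n) (Fin n) ℝ :=
  Matrix.of fun a b => ∫ s, regResid μ A s a b ∂(sketchLaw ν j)

theorem integrable_regResid_bilin (hμ : 0 < μ) (j : ℕ) (x y : Fin n → ℝ) :
    Integrable (fun s : Fin j → EuclideanSpace ℝ (Fin m) => y ⬝ᵥ regResid μ A s *ᵥ x)
      (sketchLaw ν j) := by
  refine integrable_of_continuous_bounded ?_ ((y ⬝ᵥ y) + (x ⬝ᵥ x)) fun s => ?_
  · exact continuous_const.dotProduct ((continuous_regResid A hμ).matrix_mulVec continuous_const)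
  · have hR := regResid_isPosContraction A hμ s
    have h1 := dotProduct_sq_le y (regResid μ A s *ᵥ x)
    have h2 := hR.mulVec_self_le_self x
    have h3 := dotProduct_self_nonneg' y
    have h4 := dotProduct_self_nonneg' x
    apply abs_le_of_sq_le_sq _ (by positivity)
    nlinarith

theorem dotProduct_meanResidMatrix (hμ : 0 < μ) (j : ℕ) (x y : Fin n → ℝ) :
    y ⬝ᵥ meanResidMatrix ν A μ j *ᵥ x = ∫ s, y ⬝ᵥ regResid μ A s *ᵥ x ∂(sketchLaw ν j) := by
  have hent : ∀ a b, Integrable (fun s : Fin j → EuclideanSpace ℝ (Fin m) => regResid μ A s a b)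
      (sketchLaw ν j) := by
    intro a b
    have := integrable_regResid_bilin (ν := ν) (A := A) hμ j (Pi.single b 1) (Pi.single a 1)
    simpa using this
  have e : ∀ N : Matrix (Fin n) (Fin n) ℝ, y ⬝ᵥ N *ᵥ x = ∑ a, ∑ b, y a * x b * N a b := by
    intro N
    simp only [dotProduct, Matrix.mulVec, Finset.mul_sum]
    exact Finset.sum_congr rfl fun a _ => Finset.sum_congr rfl fun b _ => by ring
  simp only [e]
  rw [integral_finsetSum _ fun a _ => integrable_finsetSum _ fun b _ => (hent a b).const_mul _]
  refine Finset.sum_congr rfl fun a _ => ?_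
  rw [integral_finsetSum _ fun b _ => (hent a b).const_mul _]
  refine Finset.sum_congr rfl fun b _ => ?_
  rw [integral_const_mul]
  rfl

theorem meanResidMatrix_transpose {ν : Measure (EuclideanSpace ℝ (Fin m))} (hμ : 0 < μ) (j : ℕ) :
    (meanResidMatrix ν A μ j)ᵀ = meanResidMatrix ν A μ j := by
  ext a b
  simp only [meanResidMatrix, Matrix.transpose_apply, Matrix.of_apply]
  congr 1
  ext s
  rw [← Matrix.transpose_apply (regResid μ A s), (regResid_isPosContraction A hμ s).symm]

/-- The leave-one-out formula in expectation: by exchangeability, each of the `k + 1` rows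
contributes the same amount to the mean of `1 - R`, and its residual is independent of it. -/
theorem integral_sub_regResid (hi : Isotropic ν) (hμ : 0 < μ) (k : ℕ) (x y : Fin n → ℝ) :
    Integrable (fun s : Fin k → EuclideanSpace ℝ (Fin m) =>
      ∫ v, (v.ofLp ⬝ᵥ A *ᵥ y) * (v.ofLp ⬝ᵥ A *ᵥ (regResid μ A s *ᵥ x)) /
        updDenom μ A (regResid μ A s) v ∂ν) (sketchLaw ν k) ∧
    y ⬝ᵥ x - y ⬝ᵥ meanResidMatrix ν A μ (k + 1) *ᵥ x =
      (k + 1) * ∫ s, ∫ v, (v.ofLp ⬝ᵥ A *ᵥ y) * (v.ofLp ⬝ᵥ A *ᵥ (regResid μ A s *ᵥ x)) /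
        updDenom μ A (regResid μ A s) v ∂ν ∂(sketchLaw ν k) := by
  set g : EuclideanSpace ℝ (Fin m) × (Fin k → EuclideanSpace ℝ (Fin m)) → ℝ :=
    fun p => (p.1.ofLp ⬝ᵥ A *ᵥ y) * (p.1.ofLp ⬝ᵥ A *ᵥ (regResid μ A p.2 *ᵥ x)) /
        updDenom μ A (regResid μ A p.2) p.1 with hg
  have hD : ∀ p : EuclideanSpace ℝ (Fin m) × (Fin k → EuclideanSpace ℝ (Fin m)),
      μ ≤ updDenom μ A (regResid μ A p.2) p.1 := fun p =>
    le_updDenom A (regResid_isPosContraction A hμ p.2) p.1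
  have hgi : Integrable g (ν.prod (sketchLaw ν k)) := by
    have hc : Continuous g := by
      have h1 : Continuous fun p : EuclideanSpace ℝ (Fin m) × (Fin k → EuclideanSpace ℝ (Fin m)) =>
        regResid μ A p.2 := (continuous_regResid A hμ).comp continuous_snd
      have h2 : Continuous fun p : EuclideanSpace ℝ (Fin m) × (Fin k → EuclideanSpace ℝ (Fin m)) =>
        p.1.ofLp := (by fun_prop : Continuous fun v : EuclideanSpace ℝ (Fin m) => v.ofLp).comp
          continuous_fst
      exact ((h2.dotProduct continuous_const).mul (h2.dotProduct (continuous_const.matrix_mulVec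
        (h1.matrix_mulVec continuous_const)))).div (continuous_updDenom_regResid hμ k)
        fun p => (hμ.trans_le (hD p)).ne'
    have hdom : Integrable (fun p : EuclideanSpace ℝ (Fin m) × (Fin k → EuclideanSpace ℝ (Fin m)) =>
        ‖p.1‖ ^ 2 * (((A *ᵥ y ⬝ᵥ A *ᵥ y) + opNorm A ^ 2 * (x ⬝ᵥ x)) / (2 * μ)))
        (ν.prod (sketchLaw ν k)) := (hi.integrable_norm_sq.mul_const _).comp_fst _
    refine hdom.mono' hc.aestronglyMeasurable (Filter.Eventually.of_forall fun p => ?_)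
    have hR := regResid_isPosContraction A hμ p.2
    have h1 := dotProduct_sq_le p.1.ofLp (A *ᵥ y)
    have h2 := dotProduct_sq_le p.1.ofLp (A *ᵥ (regResid μ A p.2 *ᵥ x))
    have h3 : A *ᵥ (regResid μ A p.2 *ᵥ x) ⬝ᵥ A *ᵥ (regResid μ A p.2 *ᵥ x) ≤
        opNorm A ^ 2 * (x ⬝ᵥ x) := (mulVec_self_le_opNorm A _).trans
      (mul_le_mul_of_nonneg_left (hR.mulVec_self_le_self x) (sq_nonneg _))
    rw [norm_sq_eq_dotProduct]
    have h0 := dotProduct_self_nonneg' p.1.ofLp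
    have h4 := h2.trans (mul_le_mul_of_nonneg_left h3 h0)
    simp only [hg]
    rw [Real.norm_eq_abs, abs_div, abs_of_pos (hμ.trans_le (hD p)), abs_mul, ← mul_div_assoc,
      div_le_div_iff₀ (hμ.trans_le (hD p)) (by positivity)]
    set a := p.1.ofLp ⬝ᵥ A *ᵥ y
    set b := p.1.ofLp ⬝ᵥ A *ᵥ (regResid μ A p.2 *ᵥ x)
    have h5 : |a| * |b| * 2 ≤ (p.1.ofLp ⬝ᵥ p.1.ofLp) *
        ((A *ᵥ y ⬝ᵥ A *ᵥ y) + opNorm A ^ 2 * (x ⬝ᵥ x)) := by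
      have h6 := sq_nonneg (|a| - |b|)
      have h7 := sq_abs a
      have h8 := sq_abs b
      linarith
    calc |a| * |b| * (2 * μ) = |a| * |b| * 2 * μ := by ring
      _ ≤ _ := mul_le_mul h5 (hD p) hμ.le ((by positivity : (0 : ℝ) ≤ |a| * |b| * 2).trans h5)
  have e : ∀ s : Fin (k + 1) → EuclideanSpace ℝ (Fin m),
      y ⬝ᵥ x - y ⬝ᵥ regResid μ A s *ᵥ x = ∑ i, g (s i, i.removeNth s) := by
    intro s
    rw [← dotProduct_sub, sub_regResid_mulVec A hμ, dotProduct_sum]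
    refine Finset.sum_congr rfl fun i _ => ?_
    rw [dotProduct_smul, smul_eq_mul, dotProduct_comm y, sketchedRow_dotProduct,
      sketchedRow_dotProduct]
    simp only [hg]
    ring
  have h1 : ∫ s, (y ⬝ᵥ x - y ⬝ᵥ regResid μ A s *ᵥ x) ∂(sketchLaw ν (k + 1)) =
      y ⬝ᵥ x - y ⬝ᵥ meanResidMatrix ν A μ (k + 1) *ᵥ x := by
    rw [integral_sub (integrable_const _) (integrable_regResid_bilin hμ _ x y),
      dotProduct_meanResidMatrix hμ]
    simp
  rw [← h1]
  simp only [e]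
  change Integrable (fun s => ∫ v, g (v, s) ∂ν) _ ∧
    _ = _ * ∫ s, ∫ v, g (v, s) ∂ν ∂(sketchLaw ν k)
  clear_value g
  have hsplit := fun i : Fin (k + 1) => integral_removeNth (ν := ν) i hgi
  refine ⟨hgi.integral_prod_right, ?_⟩
  rw [integral_finsetSum _ fun i _ => (hsplit i).1, Finset.sum_congr rfl fun i _ => (hsplit i).2]
  simp

/-- A lower bound for the leave-one-out mean given the residual `R` of the other rows, with the
random level `F = μ + tr (A R Aᵀ)` linearized around a deterministic value `G`. -/
theorem SketchHyp.le_integral_leave_one_out (h : SketchHyp ν A K L θ)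
    {R : Matrix (Fin n) (Fin n) ℝ} (hR : IsPosContraction R)
    (hE : frobSq A / 2 ≤ energy A R) {x y : Fin n → ℝ} (hx : x ⬝ᵥ x = 1)
    (hy : Aᵀ *ᵥ (A *ᵥ y) = x) {σ : ℝ} (hσ : 0 < σ) (hyσ : (A *ᵥ y ⬝ᵥ A *ᵥ y) * σ ^ 2 ≤ 1)
    {G : ℝ} (hG : 0 < G) :
    (x ⬝ᵥ R *ᵥ x) / G - |θ * frobSq A + energy A R - G| / G ^ 2 -
      150 * (K ^ 2 * θ) / frobSq A *
        (1 + (A *ᵥ (R *ᵥ x) ⬝ᵥ A *ᵥ (R *ᵥ x)) / σ ^ 2) ≤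
    ∫ v, (v.ofLp ⬝ᵥ A *ᵥ y) * (v.ofLp ⬝ᵥ A *ᵥ (R *ᵥ x)) / updDenom (θ * frobSq A) A R v ∂ν := by
  have hf := h.frob_pos
  have hθ := h.theta_pos
  have key := (abs_le.mp (h.integral_div_updDenom hR hE (A *ᵥ y) (A *ᵥ (R *ᵥ x)))).1
  set I := ∫ v, (v.ofLp ⬝ᵥ A *ᵥ y) * (v.ofLp ⬝ᵥ A *ᵥ (R *ᵥ x)) /
    updDenom (θ * frobSq A) A R v ∂ν
  have e1 : A *ᵥ y ⬝ᵥ A *ᵥ (R *ᵥ x) = x ⬝ᵥ R *ᵥ x := by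
    rw [dotProduct_comm, mulVec_dotProduct_mulVec, hy, dotProduct_comm]
  rw [e1] at key
  set q := A *ᵥ (R *ᵥ x) ⬝ᵥ A *ᵥ (R *ᵥ x)
  set z := A *ᵥ y ⬝ᵥ A *ᵥ y
  have hq0 : 0 ≤ q := dotProduct_self_nonneg' _
  have hz0 : 0 ≤ z := dotProduct_self_nonneg' _
  set F := θ * frobSq A + energy A R with hF
  have hFf : frobSq A / 2 ≤ F := by linarith [h.mu_pos]
  have hFp : 0 < F := by linarith
  set p := x ⬝ᵥ R *ᵥ x
  have hp0 : 0 ≤ p := hR.nonneg x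
  have hp1 : p ≤ 1 := hx ▸ hR.le x
  have h1 : √z * √q ≤ 1 / 2 * (1 + q / σ ^ 2) := by
    have h2 : √z * √q ≤ 1 / 2 * (z * σ ^ 2 + q / σ ^ 2) := by
      have h3 := sq_nonneg (√z * σ - √q / σ)
      have h4 : √z * σ * (√q / σ) = √z * √q := by field_simp
      have h5 : (√z * σ - √q / σ) ^ 2 = √z ^ 2 * σ ^ 2 - 2 * (√z * σ * (√q / σ)) +
        √q ^ 2 / σ ^ 2 := by ring
      rw [h5, h4, Real.sq_sqrt hz0, Real.sq_sqrt hq0] at h3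
      linarith
    linarith
  set η := K ^ 2 * θ
  have hη : 0 ≤ η := by positivity
  have hlow : p / F - 150 * η / frobSq A * (1 + q / σ ^ 2) ≤ I := by
    have h3 : p - 150 * η * (1 / 2 * (1 + q / σ ^ 2)) ≤ F * I := by
      have : 150 * η * (√z * √q) ≤ 150 * η * (1 / 2 * (1 + q / σ ^ 2)) := by gcongr
      linarith
    have h4 : p / F - 150 * η / F * (1 / 2 * (1 + q / σ ^ 2)) ≤ I := by
      have : p / F - 150 * η / F * (1 / 2 * (1 + q / σ ^ 2)) =
        (p - 150 * η * (1 / 2 * (1 + q / σ ^ 2))) / F := by ring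
      rw [this, div_le_iff₀ hFp]
      linarith
    have h5 : 150 * η / F * (1 / 2 * (1 + q / σ ^ 2)) ≤
        150 * η / frobSq A * (1 + q / σ ^ 2) := by
      have : 150 * η / F ≤ 2 * (150 * η / frobSq A) := by
        rw [← mul_div_assoc, div_le_div_iff₀ hFp hf]
        nlinarith
      have h6 : 0 ≤ 1 / 2 * (1 + q / σ ^ 2) := by positivity
      nlinarith
    linarith
  have hlin : p / G - |F - G| / G ^ 2 ≤ p / F := by
    have h7 : 1 / G - (F - G) / G ^ 2 ≤ 1 / F := by
      have : 1 / F - (1 / G - (F - G) / G ^ 2) = (F - G) ^ 2 / (F * G ^ 2) := by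
        field_simp
        ring
      have h8 : 0 ≤ (F - G) ^ 2 / (F * G ^ 2) := by positivity
      linarith
    have h9 : p * ((F - G) / G ^ 2) ≤ |F - G| / G ^ 2 := by
      calc p * ((F - G) / G ^ 2) ≤ p * (|F - G| / G ^ 2) := by gcongr; exact le_abs_self _
        _ ≤ 1 * (|F - G| / G ^ 2) := by gcongr
        _ = _ := one_mul _
    have h10 := mul_le_mul_of_nonneg_left h7 hp0
    have h11 : p * (1 / G - (F - G) / G ^ 2) = p / G - p * ((F - G) / G ^ 2) := by ring
    have h12 : p * (1 / F) = p / F := by ring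
    linarith
  linarith

end Spectral

/-! ### The smallest eigenvalue of the mean projection -/

section Main

variable {m n : ℕ} {ν : Measure (EuclideanSpace ℝ (Fin m))} [IsProbabilityMeasure ν]
  {A : Matrix (Fin m) (Fin n) ℝ} {K L θ : ℝ}

/-- A positive lower bound on the singular values makes `AᵀA` surjective. -/
theorem exists_gram_mulVec_eq {σ : ℝ} (hσ0 : 0 < σ)
    (hσ : ∀ x : Fin n → ℝ, σ ^ 2 * (x ⬝ᵥ x) ≤ A *ᵥ x ⬝ᵥ A *ᵥ x) (x : Fin n → ℝ) :
    ∃ y : Fin n → ℝ, Aᵀ *ᵥ (A *ᵥ y) = x := by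
  have hinj : Function.Injective (Matrix.mulVecLin (Aᵀ * A)) := by
    rw [← LinearMap.ker_eq_bot, LinearMap.ker_eq_bot']
    intro y hy
    rw [Matrix.mulVecLin_apply, ← Matrix.mulVec_mulVec] at hy
    have h1 := hσ y
    rw [mulVec_dotProduct_mulVec, hy, dotProduct_zero] at h1
    have h2 := dotProduct_self_nonneg' y
    exact dotProduct_self_eq_zero.mp (le_antisymm
      (nonpos_of_mul_nonpos_right h1 (by positivity)) h2)
  obtain ⟨y, hy⟩ := LinearMap.injective_iff_surjective.mp hinj x
  exact ⟨y, by rwa [Matrix.mulVecLin_apply, ← Matrix.mulVec_mulVec] at hy⟩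

theorem frobSq_pos_dim (hf : 0 < frobSq A) : 0 < n := by
  rcases Nat.eq_zero_or_pos n with rfl | h
  · simp [frobSq] at hf
  · exact h

/-- In mean absolute value the residual energy fluctuates by at most the regularization level.
This is where the lower bound on `L` enters, through `‖A‖² ≤ 9 L² ‖A‖² = 9 θ² ‖A‖_F²`. -/
theorem SketchHyp.integral_abs_energy_sub_le (h : SketchHyp ν A K L θ) (hL : 1 ≤ 3 * L) {k : ℕ}
    (hk : 100 * (k * opNorm A ^ 2) ≤ frobSq A) :
    Integrable (fun s => |energy A (regResid (θ * frobSq A) A s) -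
      meanEnergy ν A (θ * frobSq A) k|) (sketchLaw ν k) ∧
    ∫ s, |energy A (regResid (θ * frobSq A) A s) - meanEnergy ν A (θ * frobSq A) k|
      ∂(sketchLaw ν k) ≤ θ * frobSq A := by
  have hμ := h.mu_pos
  have hf := h.frob_pos
  have hvar := integral_energy_sub_sq_le (ν := ν) (A := A) hμ k
  have hmem := h.theta_sq
  set μ := θ * frobSq A with hμdef
  set M := meanEnergy ν A μ k with hM
  set α := opNorm A ^ 2 with hα
  have hα0 : 0 ≤ α := sq_nonneg _
  have hMC : |M| ≤ frobSq A := by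
    calc |M| ≤ ∫ s, |energy A (regResid μ A s)| ∂(sketchLaw ν k) := abs_integral_le_integral_abs
      _ ≤ ∫ _s, frobSq A ∂(sketchLaw ν k) := integral_mono (integrable_energy hμ k).abs
          (integrable_const _) fun s => abs_energy_regResid_le hμ s
      _ = frobSq A := by simp
  have hc := continuous_energy_regResid (A := A) hμ k
  have hi1 : Integrable (fun s => |energy A (regResid μ A s) - M|) (sketchLaw ν k) :=
    ((integrable_energy hμ k).sub (integrable_const _)).abs
  have hi2 : Integrable (fun s => (energy A (regResid μ A s) - M) ^ 2) (sketchLaw ν k) := by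
    refine integrable_of_continuous_bounded ((hc.sub continuous_const).pow 2)
      ((2 * frobSq A) ^ 2) fun s => ?_
    rw [abs_pow]
    refine pow_le_pow_left₀ (abs_nonneg _) ?_ 2
    calc _ ≤ |energy A (regResid μ A s)| + |M| := abs_sub _ _
      _ ≤ _ := by linarith [abs_energy_regResid_le (A := A) hμ s]
  refine ⟨hi1, ?_⟩
  have hpt : ∀ s : Fin k → EuclideanSpace ℝ (Fin m), |energy A (regResid μ A s) - M| ≤
      μ / 2 + 1 / (2 * μ) * (energy A (regResid μ A s) - M) ^ 2 := by
    intro s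
    rw [← sq_abs (energy A (regResid μ A s) - M)]
    set t := |energy A (regResid μ A s) - M|
    have : μ / 2 + 1 / (2 * μ) * t ^ 2 - t = 1 / (2 * μ) * (t - μ) ^ 2 := by
      field_simp
      ring
    have h2 : 0 ≤ 1 / (2 * μ) * (t - μ) ^ 2 := by positivity
    linarith
  have hα9 : α ≤ 9 * (θ ^ 2 * frobSq A) := by
    rw [hmem]
    have : 1 ≤ 9 * L ^ 2 := by nlinarith
    nlinarith
  calc _ ≤ ∫ s, (μ / 2 + 1 / (2 * μ) * (energy A (regResid μ A s) - M) ^ 2) ∂(sketchLaw ν k) :=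
        integral_mono hi1 ((integrable_const _).add (hi2.const_mul _)) hpt
    _ = μ / 2 + 1 / (2 * μ) * ∫ s, (energy A (regResid μ A s) - M) ^ 2 ∂(sketchLaw ν k) := by
        rw [integral_add (integrable_const _) (hi2.const_mul _), integral_const_mul]
        simp
    _ ≤ μ / 2 + 1 / (2 * μ) * (frobSq A / 100 * (9 * (θ ^ 2 * frobSq A))) := by
        gcongr
        refine hvar.trans ?_
        calc (k : ℝ) * α ^ 2 = k * α * α := by ring
          _ ≤ frobSq A / 100 * (9 * (θ ^ 2 * frobSq A)) := by
            gcongr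
            linarith
    _ = μ / 2 + 9 / 200 * μ := by
        have : θ ^ 2 * frobSq A * frobSq A = μ ^ 2 := by rw [hμdef]; ring
        have h3 : frobSq A / 100 * (9 * (θ ^ 2 * frobSq A)) = 9 / 100 * μ ^ 2 := by
          rw [← this]; ring
        rw [h3]
        field_simp
        ring
    _ ≤ μ := by linarith

theorem SketchHyp.le_energy_regResid {ν : Measure (EuclideanSpace ℝ (Fin m))}
    (h : SketchHyp ν A K L θ) {k : ℕ}
    (hk : 100 * (k * opNorm A ^ 2) ≤ frobSq A) (s : Fin k → EuclideanSpace ℝ (Fin m)) :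
    frobSq A / 2 ≤ energy A (regResid (θ * frobSq A) A s) :=
  le_trans (by linarith [two_mul_mul_le le_rfl (sq_nonneg (opNorm A)) hk])
    (frobSq_sub_le_energy A h.mu_pos s)

theorem SketchHyp.meanEnergy_mem (h : SketchHyp ν A K L θ) {k : ℕ}
    (hk : 100 * (k * opNorm A ^ 2) ≤ frobSq A) :
    meanEnergy ν A (θ * frobSq A) k ∈ Set.Icc (frobSq A / 2) (frobSq A) := by
  have hμ := h.mu_pos
  constructor
  · calc frobSq A / 2 = ∫ _s, frobSq A / 2 ∂(sketchLaw ν k) := by simp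
      _ ≤ _ := integral_mono (integrable_const _) (integrable_energy hμ k)
        (h.le_energy_regResid hk)
  · calc _ ≤ ∫ _s, frobSq A ∂(sketchLaw ν k) := integral_mono (integrable_energy hμ k)
          (integrable_const _) fun s => energy_le_frobSq A (regResid_isPosContraction A hμ s)
      _ = frobSq A := by simp

/-- The averaged form of the leave-one-out lower bound, with `G` the mean of the level `F`. -/
theorem SketchHyp.le_mean_leave_one_out (h : SketchHyp ν A K L θ) (hL : 1 ≤ 3 * L) {k : ℕ}
    (hk : 100 * (k * opNorm A ^ 2) ≤ frobSq A) {x y : Fin n → ℝ} (hx : x ⬝ᵥ x = 1)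
    (hy : Aᵀ *ᵥ (A *ᵥ y) = x) {σ : ℝ} (hσ : 0 < σ) (hyσ : (A *ᵥ y ⬝ᵥ A *ᵥ y) * σ ^ 2 ≤ 1) :
    meanResid ν A (θ * frobSq A) k x / (θ * frobSq A + meanEnergy ν A (θ * frobSq A) k) -
      θ * frobSq A / (θ * frobSq A + meanEnergy ν A (θ * frobSq A) k) ^ 2 -
      150 * (K ^ 2 * θ) / frobSq A * (1 + meanImage ν A (θ * frobSq A) k x / σ ^ 2) ≤
    ∫ s, ∫ v, (v.ofLp ⬝ᵥ A *ᵥ y) * (v.ofLp ⬝ᵥ A *ᵥ (regResid (θ * frobSq A) A s *ᵥ x)) /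
      updDenom (θ * frobSq A) A (regResid (θ * frobSq A) A s) v ∂ν ∂(sketchLaw ν k) := by
  have hμ := h.mu_pos
  have hf := h.frob_pos
  obtain ⟨hE1, -⟩ := h.meanEnergy_mem hk
  obtain ⟨hd1, hd2⟩ := h.integral_abs_energy_sub_le hL hk
  have hIi := (integral_sub_regResid (A := A) h.isotropic hμ k x y).1
  have hpt : ∀ s : Fin k → EuclideanSpace ℝ (Fin m), _ := fun s =>
    h.le_integral_leave_one_out (regResid_isPosContraction A hμ s)
      (h.le_energy_regResid hk s) hx hy hσ hyσ (add_pos_of_pos_of_nonneg hμ (by linarith) :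
        0 < θ * frobSq A + meanEnergy ν A (θ * frobSq A) k)
  simp only [add_sub_add_left_eq_sub] at hpt
  set G := θ * frobSq A + meanEnergy ν A (θ * frobSq A) k
  have hi1 := (integrable_resid (ν := ν) (A := A) hμ k x).div_const G
  have hi2 := hd1.div_const (G ^ 2)
  have hi3 := (integrable_image (ν := ν) (A := A) hμ k x).div_const (σ ^ 2)
  have hi5 := ((integrable_const (1 : ℝ)).add hi3).const_mul (150 * (K ^ 2 * θ) / frobSq A)
  have hmono := integral_mono ((hi1.sub hi2).sub hi5) hIi hpt
  rw [integral_sub' (hi1.sub hi2) hi5, integral_sub' hi1 hi2, integral_div, integral_div,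
    integral_const_mul, integral_add' (integrable_const (1 : ℝ)) hi3, integral_div] at hmono
  simp only [integral_const, probReal_univ, smul_eq_mul, one_mul] at hmono
  refine le_trans ?_ hmono
  rw [meanResid, meanImage]
  gcongr

/-- The arithmetic at the end of the spectral argument: the eigenvalue `lam` satisfies
`lam ≥ (1 - O(η)) γ σ² (1 - lam)` with `γ = k / Err`, which is solved for `lam`.
The number `49` is a bound for `1 + 𝔼 ‖A R x‖² / σ²`. -/
theorem le_of_leave_one_out_estimate {f θ η lam G Err k I P z σ : ℝ} (hf : 0 < f) (hθ : 0 < θ)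
    (hθη : θ ≤ η) (hη : 30000 * η ≤ 1) (hlam0 : 0 ≤ lam) (hlam : lam ≤ 1 / 2)
    (hG1 : f / 2 ≤ G) (hG2 : G ≤ 2 * f) (hErr : G ≤ Err + 2 * (θ * f)) (hk : 0 < k)
    (hP : 1 - lam ≤ P) (hIlow : P / G - θ * f / G ^ 2 - 150 * η / f * 49 ≤ I)
    (hI : lam * z = k * I) (hzσ : z * σ ^ 2 ≤ 1) :
    (1 - 30000 * η) * (k / Err * σ ^ 2 / (k / Err * σ ^ 2 + 1)) ≤ lam := by
  have hGp : 0 < G := by linarith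
  have hη0 : 0 < η := hθ.trans_le hθη
  have hfG : θ * f ≤ 2 * η * G := by
    calc θ * f ≤ η * (2 * G) := mul_le_mul hθη (by linarith) hf.le hη0.le
      _ = 2 * η * G := by ring
  have hIG : 1 - lam - 14702 * η ≤ G * I := by
    have h1 := mul_le_mul_of_nonneg_left hIlow hGp.le
    have h2 : G * (P / G - θ * f / G ^ 2 - 150 * η / f * 49) =
        P - θ * f / G - 7350 * η * (G / f) := by
      field_simp
      ring
    have h3 : θ * f / G ≤ 2 * η := by rwa [div_le_iff₀ hGp]
    have h4 : G / f ≤ 2 := by rwa [div_le_iff₀ hf]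
    have h5 : 7350 * η * (G / f) ≤ 7350 * η * 2 := by gcongr
    linarith
  have hErrG : (1 - 4 * η) * G ≤ Err := by linarith
  have hErrp : 0 < Err := lt_of_lt_of_le (mul_pos (by linarith) hGp) hErrG
  set g := k / Err with hg
  have hg0 : 0 ≤ g := by positivity
  have hgG : (1 - 4 * η) * g ≤ k / G := by
    rw [hg, ← mul_div_assoc, div_le_div_iff₀ hErrp hGp]
    have := mul_le_mul_of_nonneg_left hErrG hk.le
    linarith
  have hfin : (1 - 30000 * η) * (g * σ ^ 2) * (1 - lam) ≤ lam := by
    -- As `1 - lam ≥ 1 / 2`, the additive error `14702 η` is a relative error `29404 η`.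
    have h1 : (1 - 29404 * η) * (1 - lam) ≤ 1 - lam - 14702 * η := by nlinarith
    have h2 : lam * z = k / G * (G * I) := by
      rw [hI]
      field_simp
    have h3 : 0 ≤ (1 - 29404 * η) * (1 - lam) := by
      apply mul_nonneg <;> linarith
    have h4 : (1 - 4 * η) * g * ((1 - 29404 * η) * (1 - lam)) ≤ lam * z := by
      rw [h2]
      calc _ ≤ k / G * ((1 - 29404 * η) * (1 - lam)) := mul_le_mul_of_nonneg_right hgG h3
        _ ≤ k / G * (G * I) := mul_le_mul_of_nonneg_left (h1.trans hIG) (by positivity)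
    have h6 : lam * z * σ ^ 2 ≤ lam := by
      calc lam * z * σ ^ 2 = lam * (z * σ ^ 2) := by ring
        _ ≤ lam * 1 := mul_le_mul_of_nonneg_left hzσ hlam0
        _ = lam := mul_one _
    have h7 : 1 - 30000 * η ≤ (1 - 4 * η) * (1 - 29404 * η) := by
      have : 0 ≤ η * η := by positivity
      linarith
    have h8 : 0 ≤ g * σ ^ 2 * (1 - lam) := mul_nonneg (by positivity) (by linarith)
    calc (1 - 30000 * η) * (g * σ ^ 2) * (1 - lam)
        = (1 - 30000 * η) * (g * σ ^ 2 * (1 - lam)) := by ring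
      _ ≤ ((1 - 4 * η) * (1 - 29404 * η)) * (g * σ ^ 2 * (1 - lam)) :=
          mul_le_mul_of_nonneg_right h7 h8
      _ = (1 - 4 * η) * g * ((1 - 29404 * η) * (1 - lam)) * σ ^ 2 := by ring
      _ ≤ lam * z * σ ^ 2 := mul_le_mul_of_nonneg_right h4 (sq_nonneg σ)
      _ ≤ lam := h6
  have ha : 0 ≤ g * σ ^ 2 := by positivity
  rw [← mul_div_assoc, div_le_iff₀ (by positivity)]
  have : 0 ≤ 30000 * η * (g * σ ^ 2 * lam) := by positivity
  linarith

/-- The spectral lower bound for the mean regularized projection of `k + 1` rows. Its smallest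
eigenvalue `lam`, with unit eigenvector `x`, is compared with `γ σ² / (γ σ² + 1)` by testing the
leave-one-out formula at `x` against `y = (AᵀA)⁻¹ x`. -/
theorem SketchHyp.le_sub_meanResid_of_sigma (h : SketchHyp ν A K L θ) (hL : 1 ≤ 3 * L) {k : ℕ}
    (hk : 100 * ((k + 1 : ℕ) * opNorm A ^ 2) ≤ frobSq A) {σ : ℝ} (hσ0 : 0 < σ)
    (hσ : ∀ x : Fin n → ℝ, σ ^ 2 * (x ⬝ᵥ x) ≤ A *ᵥ x ⬝ᵥ A *ᵥ x)
    (hv : ∃ v : Fin n → ℝ, v ⬝ᵥ v = 1 ∧ A *ᵥ v ⬝ᵥ A *ᵥ v ≤ σ ^ 2)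
    (hη : 30000 * (K ^ 2 * θ) ≤ 1) (w : Fin n → ℝ) :
    (1 - 30000 * (K ^ 2 * θ)) * (gammaCoeff ν A (k + 1) * σ ^ 2 /
      (gammaCoeff ν A (k + 1) * σ ^ 2 + 1)) * (w ⬝ᵥ w) ≤
      w ⬝ᵥ w - meanResid ν A (θ * frobSq A) (k + 1) w := by
  have hμ := h.mu_pos
  have hf := h.frob_pos
  have hθ := h.theta_pos
  have hK : 1 ≤ K ^ 2 := one_le_pow₀ h.one_le_K
  have hk' : 100 * (k * opNorm A ^ 2) ≤ frobSq A := by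
    refine le_trans ?_ hk
    gcongr
    exact Nat.le_succ k
  have hk2 := two_mul_mul_le k.le_succ (sq_nonneg (opNorm A)) hk
  have hbias := h.meanEnergy_le hk'
  set μ := θ * frobSq A with hμdef
  set η := K ^ 2 * θ with hηdef
  have hθη : θ ≤ η := by rw [hηdef]; nlinarith
  have hη0 : 0 < η := by positivity
  set α := opNorm A ^ 2 with hα
  obtain ⟨x, ρ, hx1, hxρ, hmax⟩ := exists_unit_eigenvector_max (frobSq_pos_dim hf)
    (meanResidMatrix_transpose (ν := ν) (A := A) hμ (k + 1))
  have hres : ∀ y, y ⬝ᵥ meanResidMatrix ν A μ (k + 1) *ᵥ y = meanResid ν A μ (k + 1) y :=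
    fun y => dotProduct_meanResidMatrix hμ _ y y
  simp only [hres] at hmax
  set lam := 1 - ρ with hlam
  have hlx : x ⬝ᵥ x - meanResid ν A μ (k + 1) x = lam := by
    rw [← hres, hxρ, dotProduct_smul, hx1, smul_eq_mul, mul_one]
  -- The bottom right singular vector bounds the smallest eigenvalue `lam` from above.
  obtain ⟨v, hv1, hvσ⟩ := hv
  have hk0 : (0 : ℝ) < k + 1 := by positivity
  have hlam_le : lam ≤ (k + 1) * (6 * σ ^ 2 / frobSq A) := by
    have h1 := hmax v
    have h2 := h.sub_meanResid_le (ν := ν) hk v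
    rw [hv1] at h1 h2
    push_cast at h2
    calc lam ≤ 1 - meanResid ν A μ (k + 1) v := by rw [hlam]; linarith
      _ ≤ _ := h2
      _ ≤ _ := by gcongr
  have hσα : σ ^ 2 ≤ α := by
    have := (hσ v).trans (mulVec_self_le_opNorm A v)
    rw [hv1] at this
    linarith
  have hlam_half : lam ≤ 1 / 2 := by
    refine hlam_le.trans ?_
    rw [← mul_div_assoc, div_le_iff₀ hf]
    push_cast at hk
    nlinarith
  -- The increments of the mean projection at the eigenvector then bound `𝔼 ‖A R x‖²`.
  have hq := h.le_sub_meanResid hk' x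
  rw [hlx] at hq
  set q := meanImage ν A μ k x with hqdef
  have hq0 : 0 ≤ q := meanImage_nonneg _ _ _
  have hlam0 : 0 ≤ lam := le_trans (by positivity) hq
  have hqσ : q / σ ^ 2 ≤ 48 := by
    rw [div_le_iff₀ (by positivity)]
    have h1 : q / (8 * frobSq A) ≤ 6 * σ ^ 2 / frobSq A :=
      le_of_mul_le_mul_left (hq.trans hlam_le) hk0
    rw [div_le_div_iff₀ (by positivity) hf] at h1
    nlinarith
  -- Test the eigenvalue equation against `y` with `AᵀA y = x`.
  obtain ⟨y, hy⟩ := exists_gram_mulVec_eq hσ0 hσ x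
  have hzx : A *ᵥ y ⬝ᵥ A *ᵥ y = y ⬝ᵥ x := by rw [mulVec_dotProduct_mulVec, hy]
  set z := y ⬝ᵥ x with hz
  have hz0 : 0 ≤ z := hzx ▸ dotProduct_self_nonneg' _
  have hzσ : z * σ ^ 2 ≤ 1 := by
    have h1 := dotProduct_sq_le y x
    have h2 := hσ y
    rw [hzx] at h2
    rw [hx1, mul_one] at h1
    by_contra hc
    push Not at hc
    have h3 : z ^ 2 * σ ^ 2 ≤ z := by
      calc z ^ 2 * σ ^ 2 ≤ (y ⬝ᵥ y) * σ ^ 2 := by gcongr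
        _ ≤ z := by linarith
    have h4 : 0 < z := by
      rcases hz0.eq_or_lt with h5 | h5
      · rw [← h5] at hc; linarith
      · exact h5
    nlinarith
  have hI := (integral_sub_regResid (A := A) h.isotropic hμ k x y).2
  have hl : y ⬝ᵥ x - y ⬝ᵥ meanResidMatrix ν A μ (k + 1) *ᵥ x = lam * z := by
    rw [hxρ, dotProduct_smul, smul_eq_mul, hlam]
    ring
  rw [hl] at hI
  set I := ∫ s, ∫ v, (v.ofLp ⬝ᵥ A *ᵥ y) * (v.ofLp ⬝ᵥ A *ᵥ (regResid μ A s *ᵥ x)) /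
    updDenom μ A (regResid μ A s) v ∂ν ∂(sketchLaw ν k) with hIdef
  set E := meanEnergy ν A μ k with hEdef
  set G := μ + E with hG
  obtain ⟨hE1, hE2⟩ := h.meanEnergy_mem hk'
  have hG1 : frobSq A / 2 ≤ G := by linarith
  have hG2 : G ≤ 2 * frobSq A := by
    have := h.theta_le
    rw [hG, hμdef]
    nlinarith
  have hIlow : meanResid ν A μ k x / G - μ / G ^ 2 - 150 * η / frobSq A * 49 ≤ I := by
    refine le_trans ?_ (h.le_mean_leave_one_out hL hk' hx1 hy hσ0 (by rw [hzx]; exact hzσ))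
    have : 1 + q / σ ^ 2 ≤ 49 := by linarith
    gcongr
  have hpk : 1 - lam ≤ meanResid ν A μ k x := by
    have h1 := (h.meanResid_sub_mem hk2 x).1
    have h2 : 0 ≤ meanImage ν A μ k x / (4 * frobSq A) := by positivity
    rw [hx1] at hlx
    linarith
  have hErrG : G ≤ svdErr ν A k + 2 * (θ * frobSq A) := by linarith
  have hgam : gammaCoeff ν A (k + 1) = (k + 1) / svdErr ν A k := by
    simp [gammaCoeff]
  have hlow := le_of_leave_one_out_estimate hf hθ hθη hη hlam0 hlam_half hG1 hG2 hErrG hk0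
    hpk hIlow hI hzσ
  rw [← hgam] at hlow
  have hw := hmax w
  have hw0 := dotProduct_self_nonneg' w
  calc _ ≤ lam * (w ⬝ᵥ w) := mul_le_mul_of_nonneg_right hlow hw0
    _ ≤ _ := by rw [hlam]; linarith

end Main

/-! ### Extreme singular values -/

section SingularValues

variable {m n : ℕ} (A : Matrix (Fin m) (Fin n) ℝ)

/-- For `n = 0` the index `n - 1` truncates, hence the positivity hypothesis. -/
theorem sigmaMin_sq_mul_le (hn : 0 < n) (x : Fin n → ℝ) :
    sigmaMin A ^ 2 * (x ⬝ᵥ x) ≤ A *ᵥ x ⬝ᵥ A *ᵥ x := by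
  set T := Matrix.toEuclideanLin A with hT
  have hd : Module.finrank ℝ (EuclideanSpace ℝ (Fin n)) = n := by simp
  have hS := T.isSymmetric_adjoint_comp_self
  set b := hS.eigenvectorBasis hd with hb
  set v : EuclideanSpace ℝ (Fin n) := WithLp.toLp 2 x with hv
  have e1 : A *ᵥ x ⬝ᵥ A *ᵥ x = inner ℝ ((LinearMap.adjoint T ∘ₗ T) v) v := by
    have := norm_sq_toEuclideanLin A v
    simp only [hv] at this
    rw [← this, LinearMap.comp_apply, LinearMap.adjoint_inner_left, real_inner_self_eq_norm_sq]
  have e2 : x ⬝ᵥ x = ∑ i, b.repr v i ^ 2 := by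
    have h1 := norm_sq_eq_dotProduct v
    simp only [hv] at h1
    rw [← h1, ← b.repr.norm_map, EuclideanSpace.real_norm_sq_eq]
  rw [e1, e2, ← b.repr.inner_map_map, PiLp.inner_apply, Finset.mul_sum]
  refine Finset.sum_le_sum fun i _ => ?_
  rw [hS.eigenvectorBasis_apply_self_apply hd]
  have h3 : sigmaMin A ^ 2 ≤ hS.eigenvalues hd i := by
    rw [sigmaMin, ← hT, T.sq_singularValues_of_lt hd (by omega : n - 1 < n)]
    refine hS.eigenvalues_antitone hd ?_
    rw [Fin.le_def]
    simp only
    omega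
  simp only [RCLike.ofReal_real_eq_id, id_eq]
  calc sigmaMin A ^ 2 * b.repr v i ^ 2 ≤ hS.eigenvalues hd i * b.repr v i ^ 2 := by gcongr
    _ = _ := by simp [hb]; ring

theorem exists_mulVec_eq_sigmaMin (hn : 0 < n) :
    ∃ v : Fin n → ℝ, v ⬝ᵥ v = 1 ∧ A *ᵥ v ⬝ᵥ A *ᵥ v ≤ sigmaMin A ^ 2 := by
  set T := Matrix.toEuclideanLin A with hT
  have hd : Module.finrank ℝ (EuclideanSpace ℝ (Fin n)) = n := by simp
  have hS := T.isSymmetric_adjoint_comp_self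
  set i : Fin n := ⟨n - 1, by omega⟩ with hi
  set v := hS.eigenvectorBasis hd i with hv
  have h1 : ‖v‖ = 1 := (hS.eigenvectorBasis hd).orthonormal.1 i
  refine ⟨v.ofLp, ?_, ?_⟩
  · rw [← norm_sq_eq_dotProduct, h1, one_pow]
  · rw [← norm_sq_toEuclideanLin, ← hT, ← real_inner_self_eq_norm_sq,
      ← LinearMap.adjoint_inner_left, ← LinearMap.comp_apply, hv,
      hS.apply_eigenvectorBasis hd, ← hv, inner_smul_left, real_inner_self_eq_norm_sq, h1,
      sigmaMin, ← hT, T.sq_singularValues_of_lt hd (by omega : n - 1 < n)]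
    simp [hi]

theorem sigmaMin_pos (hn : 0 < n) (hA : A.rank = n) : 0 < sigmaMin A := by
  rw [sigmaMin, LinearMap.singularValues_pos_iff_lt_finrank_range]
  have h : Module.finrank ℝ (Matrix.toEuclideanLin A).range = A.rank := by
    rw [Matrix.rank_eq_finrank_range_toLin A (EuclideanSpace.basisFun (Fin m) ℝ).toBasis
      (EuclideanSpace.basisFun (Fin n) ℝ).toBasis, Matrix.toEuclideanLin_eq_toLin_orthonormal]
  rw [h, hA]
  omega

/-- The stable rank is at most the number of rows. -/
theorem frobSq_le_opNorm_mul_rows : frobSq A ≤ opNorm A ^ 2 * m := by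
  have h1 := energy_le_trace Aᵀ (N := 1) Matrix.transpose_one
    (fun x => by rw [Matrix.one_mulVec]; exact dotProduct_self_nonneg' x)
  rw [energy_one, frobSq_transpose, Matrix.trace_one, Fintype.card_fin] at h1
  have h2 : opNorm Aᵀ ≤ opNorm A :=
    opNorm_le_of_forall _ (opNorm_nonneg A) (transpose_mulVec_self_le_opNorm A)
  refine h1.trans ?_
  have := opNorm_nonneg Aᵀ
  gcongr

end SingularValues

/-! ### From the mean projection to the convergence rate -/

section Rate

variable {k m n : ℕ} {ν : Measure (EuclideanSpace ℝ (Fin m))} [IsProbabilityMeasure ν]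
  (A : Matrix (Fin m) (Fin n) ℝ)

/-- The error vector `x_t - x_*` after `t` steps, driven by the rows `s 0, s 1, …` of the
sketches. -/
def errVec (A : Matrix (Fin m) (Fin n) ℝ) (e₀ : Fin n → ℝ)
    (s : ℕ → Fin k → EuclideanSpace ℝ (Fin m)) : ℕ → Fin n → ℝ
  | 0 => e₀
  | t + 1 => errVec A e₀ s t - sketchProj (rowMatrix (s t)) A *ᵥ errVec A e₀ s t

theorem iterate_sub_eq_errVec {b : EuclideanSpace ℝ (Fin m)} {xs : EuclideanSpace ℝ (Fin n)}
    (hb : Matrix.toEuclideanLin A xs = b) (x₀ : EuclideanSpace ℝ (Fin n))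
    (s : ℕ → Fin k → EuclideanSpace ℝ (Fin m)) (t : ℕ) :
    (iterate A b (fun τ => rowMatrix (s τ)) x₀ t - xs).ofLp =
      errVec A (x₀ - xs).ofLp s t := by
  induction t with
  | zero => rfl
  | succ t ih =>
    rw [errVec, ← ih, iterate, ← hb, ← map_sub, sub_right_comm, sketchProj,
      ← Matrix.mulVec_mulVec, ← Matrix.mulVec_mulVec]
    simp [Matrix.toLpLin_apply]

theorem errVec_congr (e₀ : Fin n → ℝ) {s s' : ℕ → Fin k → EuclideanSpace ℝ (Fin m)} {t : ℕ}
    (h : ∀ τ < t, s τ = s' τ) : errVec A e₀ s t = errVec A e₀ s' t := by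
  induction t with
  | zero => rfl
  | succ t ih =>
    rw [errVec, errVec, ih fun τ hτ => h τ (by omega), h t (by omega)]

theorem measurable_errVec (e₀ : Fin n → ℝ) (t : ℕ) :
    Measurable fun s : ℕ → Fin k → EuclideanSpace ℝ (Fin m) => errVec A e₀ s t := by
  induction t with
  | zero => exact measurable_const
  | succ t ih =>
    have hP := fun a b => (measurable_sketchProj_apply (j := k) A a b).comp
      (measurable_pi_apply (X := fun _ : ℕ => Fin k → EuclideanSpace ℝ (Fin m)) t)
    have hih := fun a => (measurable_pi_apply a).comp ih
    simp only [Function.comp_def] at hP hih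
    refine measurable_pi_lambda _ fun a => ?_
    simp only [errVec, Pi.sub_apply, Matrix.mulVec, dotProduct]
    exact (hih a).sub (Finset.measurable_fun_sum _ fun b _ => (hP a b).mul (hih b))

theorem errVec_dotProduct_self_le (e₀ : Fin n → ℝ)
    (s : ℕ → Fin k → EuclideanSpace ℝ (Fin m)) (t : ℕ) :
    errVec A e₀ s t ⬝ᵥ errVec A e₀ s t ≤ e₀ ⬝ᵥ e₀ := by
  induction t with
  | zero => exact le_rfl
  | succ t ih =>
    rw [errVec, residual_dotProduct_self]
    linarith [(sketchProj_isPosContraction (rowMatrix (s t)) A).nonneg (errVec A e₀ s t)]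

/-- The error before step `t` depends only on the sketches of the earlier steps. -/
theorem indepFun_errVec (e₀ : Fin n → ℝ) (t : ℕ) :
    IndepFun (fun s => errVec A e₀ s t)
      (fun s : ℕ → Fin k → EuclideanSpace ℝ (Fin m) => s t)
      (Measure.infinitePi fun _ : ℕ => sketchLaw ν k) := by
  have hind := iIndepFun_infinitePi (P := fun _ : ℕ => sketchLaw ν k) (X := fun _ ω => ω)
    fun _ => measurable_id
  have h := hind.indepFun_finset (Finset.range t) {t} (by simp) fun i => measurable_pi_apply i
  set ext : (Finset.range t → Fin k → EuclideanSpace ℝ (Fin m)) →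
      ℕ → Fin k → EuclideanSpace ℝ (Fin m) :=
    fun r τ => if hτ : τ ∈ Finset.range t then r ⟨τ, hτ⟩ else 0 with hext
  have hextm : Measurable ext := by
    refine measurable_pi_lambda _ fun τ => ?_
    by_cases hτ : τ ∈ Finset.range t
    · simp only [hext, hτ, dite_true]
      exact measurable_pi_apply _
    · simp only [hext, hτ, dite_false]
      exact measurable_const
  have h2 := h.comp ((measurable_errVec (k := k) A e₀ t).comp hextm)
    (measurable_pi_apply (X := fun _ : ({t} : Finset ℕ) => Fin k → EuclideanSpace ℝ (Fin m))
      ⟨t, by simp⟩)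
  refine h2.congr (Filter.Eventually.of_forall fun s => ?_) (Filter.Eventually.of_forall
    fun s => rfl)
  simp only [Function.comp_apply]
  refine errVec_congr A e₀ fun τ hτ => ?_
  simp [hext, hτ]

theorem integrable_sketchProj (w : Fin n → ℝ) :
    Integrable (fun s => w ⬝ᵥ sketchProj (rowMatrix s) A *ᵥ w) (sketchLaw ν k) := by
  refine Integrable.of_bound (Measurable.aestronglyMeasurable ?_) (w ⬝ᵥ w)
    (Filter.Eventually.of_forall fun r => ?_)
  · have hP := measurable_sketchProj_apply (j := k) A
    simp only [Matrix.mulVec, dotProduct]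
    fun_prop
  · have hP := sketchProj_isPosContraction (rowMatrix r) A
    rw [Real.norm_eq_abs, abs_of_nonneg (hP.nonneg w)]
    exact hP.le w

/-- Every step contracts the mean squared error by `1 - ρ`, whatever the error before it. -/
theorem integral_errVec_le {ρ : ℝ} (hρ : ρ ≤ 1)
    (h : ∀ w : Fin n → ℝ, ρ * (w ⬝ᵥ w) ≤
      ∫ s, w ⬝ᵥ sketchProj (rowMatrix s) A *ᵥ w ∂(sketchLaw ν k)) (e₀ : Fin n → ℝ) (t : ℕ) :
    ∫ s, errVec A e₀ s t ⬝ᵥ errVec A e₀ s t ∂(Measure.infinitePi fun _ : ℕ => sketchLaw ν k) ≤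
      (1 - ρ) ^ t * (e₀ ⬝ᵥ e₀) := by
  induction t with
  | zero => simp [errVec]
  | succ t ih =>
    set Q := Measure.infinitePi fun _ : ℕ => sketchLaw ν k with hQ
    have hem := measurable_errVec (k := k) A e₀ t
    have hdotm : Measurable fun e : Fin n → ℝ => e ⬝ᵥ e := by
      simp only [dotProduct]
      fun_prop
    set g : (Fin n → ℝ) × (Fin k → EuclideanSpace ℝ (Fin m)) → ℝ :=
      fun p => p.1 ⬝ᵥ p.1 - p.1 ⬝ᵥ sketchProj (rowMatrix p.2) A *ᵥ p.1 with hg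
    have hgm : Measurable g := by
      have hP : ∀ a b, Measurable fun p : (Fin n → ℝ) × (Fin k → EuclideanSpace ℝ (Fin m)) =>
          sketchProj (rowMatrix p.2) A a b :=
        fun a b => (measurable_sketchProj_apply (j := k) A a b).comp measurable_snd
      have h1 : ∀ a, Measurable fun p : (Fin n → ℝ) × (Fin k → EuclideanSpace ℝ (Fin m)) =>
        p.1 a := fun a => (measurable_pi_apply a).comp measurable_fst
      refine (hdotm.comp measurable_fst).sub ?_
      simp only [Matrix.mulVec, dotProduct]
      exact Finset.measurable_fun_sum _ fun a _ => (h1 a).mul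
        (Finset.measurable_fun_sum _ fun b _ => (hP a b).mul (h1 b))
    have hg0 : ∀ e r, 0 ≤ g (e, r) := fun e r => by
      have := (sketchProj_isPosContraction (rowMatrix r) A).le e
      simp only [hg]
      linarith
    have hg1 : ∀ e r, g (e, r) ≤ e ⬝ᵥ e := fun e r => by
      have := (sketchProj_isPosContraction (rowMatrix r) A).nonneg e
      simp only [hg]
      linarith
    have hpair : Measurable fun s : ℕ → Fin k → EuclideanSpace ℝ (Fin m) =>
      (errVec A e₀ s t, s t) := hem.prodMk (measurable_pi_apply t)
    have hmap : Q.map (fun s => (errVec A e₀ s t, s t)) =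
        (Q.map fun s => errVec A e₀ s t).prod (sketchLaw ν k) := by
      rw [(indepFun_errVec (ν := ν) A e₀ t).map_prod_eq_prod_map_map hem.aemeasurable
        (measurable_pi_apply t).aemeasurable, Measure.infinitePi_map_eval]
    have hprob : IsProbabilityMeasure (Q.map fun s => errVec A e₀ s t) :=
      Measure.isProbabilityMeasure_map hem.aemeasurable
    have hbdd : Integrable (fun s => g (errVec A e₀ s t, s t)) Q := by
      refine Integrable.of_bound (hgm.comp hpair).aestronglyMeasurable (e₀ ⬝ᵥ e₀)
        (Filter.Eventually.of_forall fun s => ?_)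
      rw [Real.norm_eq_abs, abs_of_nonneg (hg0 _ _)]
      exact (hg1 _ _).trans (errVec_dotProduct_self_le A e₀ s t)
    have hbdd2 : Integrable (fun s => errVec A e₀ s t ⬝ᵥ errVec A e₀ s t) Q := by
      refine Integrable.of_bound (hdotm.comp hem).aestronglyMeasurable (e₀ ⬝ᵥ e₀)
        (Filter.Eventually.of_forall fun s => ?_)
      rw [Real.norm_eq_abs, abs_of_nonneg (dotProduct_self_nonneg' _)]
      exact errVec_dotProduct_self_le A e₀ s t
    have hgi : Integrable g ((Q.map fun s => errVec A e₀ s t).prod (sketchLaw ν k)) := by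
      rw [← hmap]
      exact (integrable_map_measure hgm.aestronglyMeasurable hpair.aemeasurable).2 hbdd
    have hinner : ∀ e, ∫ r, g (e, r) ∂(sketchLaw ν k) ≤ (1 - ρ) * (e ⬝ᵥ e) := by
      intro e
      have hi := integrable_sketchProj (ν := ν) (k := k) A e
      simp only [hg]
      rw [integral_sub (integrable_const _) hi]
      simp only [integral_const, probReal_univ, smul_eq_mul, one_mul]
      linarith [h e]
    have hint3 : Integrable (fun e : Fin n → ℝ => (1 - ρ) * (e ⬝ᵥ e))
        (Q.map fun s => errVec A e₀ s t) :=
      ((integrable_map_measure hdotm.aestronglyMeasurable hem.aemeasurable).2 hbdd2).const_mul _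
    calc ∫ s, errVec A e₀ s (t + 1) ⬝ᵥ errVec A e₀ s (t + 1) ∂Q
        = ∫ s, g (errVec A e₀ s t, s t) ∂Q := by
          simp only [errVec, residual_dotProduct_self, hg]
      _ = ∫ p, g p ∂((Q.map fun s => errVec A e₀ s t).prod (sketchLaw ν k)) := by
          rw [← hmap]
          exact (integral_map hpair.aemeasurable hgm.aestronglyMeasurable).symm
      _ = ∫ e, ∫ r, g (e, r) ∂(sketchLaw ν k) ∂(Q.map fun s => errVec A e₀ s t) :=
          integral_prod _ hgi
      _ ≤ ∫ e, (1 - ρ) * (e ⬝ᵥ e) ∂(Q.map fun s => errVec A e₀ s t) :=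
          integral_mono hgi.integral_prod_left hint3 hinner
      _ = (1 - ρ) * ∫ s, errVec A e₀ s t ⬝ᵥ errVec A e₀ s t ∂Q := by
          rw [integral_const_mul, integral_map hem.aemeasurable hdotm.aestronglyMeasurable]
      _ ≤ (1 - ρ) * ((1 - ρ) ^ t * (e₀ ⬝ᵥ e₀)) :=
          mul_le_mul_of_nonneg_left ih (by linarith)
      _ = (1 - ρ) ^ (t + 1) * (e₀ ⬝ᵥ e₀) := by ring

/-- A Loewner lower bound on the mean sketched projection is a lower bound on the rate. -/
theorem le_rate (hn : 0 < n) {b : EuclideanSpace ℝ (Fin m)} {xs : EuclideanSpace ℝ (Fin n)}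
    (hb : Matrix.toEuclideanLin A xs = b) {ρ : ℝ} (hρ : ρ ≤ 1)
    (h : ∀ w : Fin n → ℝ, ρ * (w ⬝ᵥ w) ≤
      ∫ s, w ⬝ᵥ sketchProj (rowMatrix s) A *ᵥ w ∂(sketchLaw ν k)) :
    ρ ≤ rate ν A b xs k := by
  refine le_csSup ⟨1, ?_⟩ ?_
  · intro ρ' hρ'
    -- One step from a starting point at distance one forces `1 - ρ' ≥ 0`.
    have h1 := hρ' (xs + EuclideanSpace.single ⟨0, hn⟩ 1) 1
    rw [add_sub_cancel_left, PiLp.norm_single, norm_one, one_pow, mul_one,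
      pow_one] at h1
    have h2 : 0 ≤ ∫ s : ℕ → Fin k → EuclideanSpace ℝ (Fin m), ‖iterate A b
        (fun τ => rowMatrix (s τ)) (xs + EuclideanSpace.single ⟨0, hn⟩ 1) 1 - xs‖ ^ 2
        ∂(Measure.infinitePi fun _ : ℕ => sketchLaw ν k) :=
      integral_nonneg fun s => sq_nonneg _
    linarith
  · intro x₀ t
    simp only [norm_sq_eq_dotProduct, iterate_sub_eq_errVec A hb]
    exact integral_errVec_le A hρ h _ t

end Rate

/-! ### The stable rank hypothesis and the simplified bound -/

section Main

variable {k m n : ℕ} {ν : Measure (EuclideanSpace ℝ (Fin m))} [IsProbabilityMeasure ν]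
  {A : Matrix (Fin m) (Fin n) ℝ} {K L : ℝ}

/-- With `θ = L / √r` for the stable rank `r`, the hypothesis on `r` puts the sketch into the
regime of small `K² θ`. -/
theorem sketchHyp_of_stableRank (hi : Isotropic ν) (hsg : SubGaussianVector ν K)
    (hconc : EuclideanConc ν L) (hK : 0 ≤ K) (hL : 0 ≤ L) {p : ℝ} (hp : 0 < p)
    (hf : frobSq A = p * opNorm A ^ 2) (ho : 0 < opNorm A ^ 2) (hm : 2 ≤ m)
    (hr : 10 ^ 10 * (K ^ 4 * L ^ 2) ≤ p) :
    SketchHyp ν A K L (L / √p) ∧ K ^ 2 * (L / √p) ≤ 1 / 10 ^ 5 := by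
  have hL1 := hconc.one_le hL hm
  have hs : 0 < √p := Real.sqrt_pos.2 hp
  have hsq : (L / √p) ^ 2 = L ^ 2 / p := by rw [div_pow, Real.sq_sqrt hp.le]
  have hη : K ^ 2 * (L / √p) ≤ 1 / 10 ^ 5 := by
    refine abs_le_of_sq_le_sq' ?_ (by norm_num) |>.2
    rw [mul_pow, hsq, ← pow_mul, ← mul_div_assoc, div_le_iff₀ hp]
    linarith
  refine ⟨⟨hi, hsg, hconc, hsg.one_le hK hi (by omega), hL, ?_, ?_, ?_, ?_⟩, hη⟩
  · rw [hf]
    positivity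
  · have : 0 < L := by linarith
    positivity
  · rw [hsq, hf]
    field_simp
  · linarith

/-- A sketch of `j` rows removes at most `j` dimensions, and every remaining one contributes at
least `σ²` to the error. -/
theorem le_svdErr {σ : ℝ} (hσ : ∀ x : Fin n → ℝ, σ ^ 2 * (x ⬝ᵥ x) ≤ A *ᵥ x ⬝ᵥ A *ᵥ x) (j : ℕ) :
    σ ^ 2 * (n - j) ≤ svdErr ν A j := by
  have h := integral_mono (μ := sketchLaw ν j) (integrable_const (σ ^ 2 * ((n : ℝ) - j)))
    (integrable_frobSq_residual (A := A) j) fun s => le_frobSq_residual (rowMatrix s) A hσ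
  simpa [svdErr] using h

/-- The bound in terms of `γ_k` dominates the simplified one, because
`γ_k σ² (n - k) ≤ k`; here the number of rows is `k + 1`. -/
theorem one_sub_div_mul_le {σ : ℝ} (hn : 0 < n)
    (hσ : ∀ x : Fin n → ℝ, σ ^ 2 * (x ⬝ᵥ x) ≤ A *ᵥ x ⬝ᵥ A *ᵥ x) :
    (1 - ((k + 1 : ℕ) : ℝ) / n) * (((k + 1 : ℕ) : ℝ) * σ ^ 2 / svdErr ν A k) ≤
      gammaCoeff ν A (k + 1) * σ ^ 2 / (gammaCoeff ν A (k + 1) * σ ^ 2 + 1) := by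
  have hE0 : 0 ≤ svdErr ν A k := integral_nonneg fun s => frobSq_nonneg _
  have hE := le_svdErr (ν := ν) hσ k
  have hn' : (0 : ℝ) < n := by exact_mod_cast hn
  rw [gammaCoeff, Nat.add_sub_cancel, div_mul_eq_mul_div]
  set a := ((k + 1 : ℕ) : ℝ) * σ ^ 2 / svdErr ν A k with ha
  have ha0 : 0 ≤ a := by positivity
  have hak : a * ((n : ℝ) - (k + 1 : ℕ)) ≤ (k + 1 : ℕ) := by
    rcases hE0.eq_or_lt with h0 | h0
    · rw [ha, ← h0, div_zero, zero_mul]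
      positivity
    · rw [ha, div_mul_eq_mul_div, div_le_iff₀ h0, mul_assoc]
      refine mul_le_mul_of_nonneg_left (le_trans ?_ hE) (by positivity)
      refine mul_le_mul_of_nonneg_left ?_ (sq_nonneg σ)
      push_cast
      linarith
  rw [le_div_iff₀ (by positivity)]
  have h1 : (1 - ((k + 1 : ℕ) : ℝ) / n) * (a + 1) ≤ 1 := by
    rw [one_sub_div hn'.ne', div_mul_eq_mul_div, div_le_one hn']
    linarith
  calc (1 - ((k + 1 : ℕ) : ℝ) / n) * a * (a + 1)
      = a * ((1 - ((k + 1 : ℕ) : ℝ) / n) * (a + 1)) := by ring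
    _ ≤ a * 1 := mul_le_mul_of_nonneg_left h1 ha0
    _ = a := mul_one a

end Main

end SketchProject

end

open SketchProject in
theorem corollary3p3 :
    ∃ C₁ C₂ : ℝ, 0 < C₁ ∧ 0 < C₂ ∧
      ∀ (m n k : ℕ) (A : Matrix (Fin m) (Fin n) ℝ)
        (b : EuclideanSpace ℝ (Fin m)) (xs : EuclideanSpace ℝ (Fin n))
        (ν : MeasureTheory.Measure (EuclideanSpace ℝ (Fin m)))
        [MeasureTheory.IsProbabilityMeasure ν] (K L : ℝ),
        1 ≤ k → A.rank = n → Matrix.toEuclideanLin A xs = b →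
        0 ≤ K → 0 ≤ L →
        Isotropic ν → SubGaussianVector ν K → EuclideanConc ν L →
        C₁ * max (k : ℝ) (max (L ^ 2 * Real.log (condNumber A)) (K ^ 4 * L ^ 2)) ≤ stableRank A →
        ∃ ε : ℝ, 0 ≤ ε ∧ ε ≤ C₂ * K ^ 2 * L / √(stableRank A) ∧
          (1 - ε) * (gammaCoeff ν A k * sigmaMin A ^ 2 / (gammaCoeff ν A k * sigmaMin A ^ 2 + 1))
            ≤ rate ν A b xs k ∧
          (1 - ε) * (1 - (k : ℝ) / n) * ((k : ℝ) * sigmaMin A ^ 2 / svdErr ν A (k - 1))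
            ≤ (1 - ε) *
              (gammaCoeff ν A k * sigmaMin A ^ 2 / (gammaCoeff ν A k * sigmaMin A ^ 2 + 1)) := by
  refine ⟨10 ^ 10, 30000, by norm_num, by norm_num, ?_⟩
  intro m n k A b xs ν _ K L hk hrank hb hK hL hi hsg hconc hr
  obtain ⟨k, rfl⟩ : ∃ j, k = j + 1 := ⟨k - 1, by omega⟩
  set p := stableRank A with hpdef
  have hk1 : (1 : ℝ) ≤ (k + 1 : ℕ) := by exact_mod_cast hk
  have hpk : 10 ^ 10 * ((k + 1 : ℕ) : ℝ) ≤ p :=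
    (mul_le_mul_of_nonneg_left (le_max_left _ _) (by norm_num)).trans hr
  have hpKL : 10 ^ 10 * (K ^ 4 * L ^ 2) ≤ p :=
    (mul_le_mul_of_nonneg_left ((le_max_right _ _).trans (le_max_right _ _)) (by norm_num)).trans hr
  have hp : 0 < p := by linarith
  -- A zero matrix has stable rank `0 / 0 = 0`, which is excluded.
  have ho : 0 < opNorm A ^ 2 := by
    refine (sq_nonneg _).lt_of_ne fun h0 => ?_
    rw [hpdef, stableRank, ← h0, div_zero] at hp
    exact hp.false
  have hf : frobSq A = p * opNorm A ^ 2 := (div_mul_cancel₀ _ ho.ne').symm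
  have hf0 : 0 < frobSq A := hf ▸ mul_pos hp ho
  have hn := frobSq_pos_dim hf0
  have hm : 2 ≤ m := by
    have h1 := frobSq_le_opNorm_mul_rows A
    rw [hf, mul_comm] at h1
    have h2 : p ≤ m := le_of_mul_le_mul_left h1 ho
    have h3 : (2 : ℝ) ≤ m := by linarith
    exact_mod_cast h3
  obtain ⟨h, hη⟩ := sketchHyp_of_stableRank hi hsg hconc hK hL hp hf ho hm hpKL
  have hσ := sigmaMin_sq_mul_le A hn
  have hη' : 30000 * (K ^ 2 * (L / √p)) ≤ 1 := by linarith
  have hη0 : 0 ≤ 30000 * (K ^ 2 * (L / √p)) := by positivity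
  refine ⟨30000 * (K ^ 2 * (L / √p)), hη0, le_of_eq (by ring), ?_, ?_⟩
  · have hg : 0 ≤ gammaCoeff ν A (k + 1) * sigmaMin A ^ 2 :=
      mul_nonneg (div_nonneg (Nat.cast_nonneg _) (integral_nonneg fun s => frobSq_nonneg _))
        (sq_nonneg _)
    refine le_rate A hn hb ?_ fun w => ?_
    · refine mul_le_one₀ (by linarith) (by positivity) ?_
      rw [div_le_one (by positivity)]
      linarith
    · have hk2 : 100 * (((k + 1 : ℕ) : ℝ) * opNorm A ^ 2) ≤ frobSq A := by
        rw [hf, ← mul_assoc]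
        exact mul_le_mul_of_nonneg_right (by linarith) ho.le
      refine (h.le_sub_meanResid_of_sigma (hconc.one_le hL hm) hk2 (sigmaMin_pos A hn hrank) hσ
        (exists_mulVec_eq_sigmaMin A hn) hη' w).trans ?_
      have hint := integrable_resid (ν := ν) (A := A) h.mu_pos (k + 1) w
      have hmono := integral_mono ((integrable_const (w ⬝ᵥ w)).sub hint)
        (integrable_sketchProj (ν := ν) A w) fun s =>
          sub_regResid_le_sketchProj A h.mu_pos s w
      simp only [Pi.sub_apply] at hmono
      rw [integral_sub (integrable_const _) hint] at hmono
      simpa [meanResid] using hmono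
  · rw [mul_assoc]
    exact mul_le_mul_of_nonneg_left (one_sub_div_mul_le hn hσ) (by linarith)
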